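/- **Setting.** Let $\lambda_1,\dots,\lambda_N$ be distinct nonzero real numbers, $\Lambda=\mathrm{diag}(\lambda_1,\dots,\lambda_N)$, $\langle\cdot,\cdot\rangle$ the Euclidean inner product of $\mathbb R^N$, and $$TS^{N-1}=\{(p,q)\in\mathbb R^{2N}:\ F:=\langle p,q\rangle=0,\ G:=\langle p,p\rangle-1=0\}.$$ Put $\{f,g\}=\sum_{j}\big(\tfrac{\partial f}{\partial q_j}\tfrac{\partial g}{\partial p_j}-\tfrac{\partial f}{\partial p_j}\tfrac{\partial g}{\partial q_j}\big)$ and $\{f,g\}_D=\{f,g\}+\frac{1}{\{F,G\}}\big(\{f,F\}\{G,g\}-\{f,G\}\{F,g\}\big)$. For $k\ge 0$ let $$H_{-k}=-\tfrac12\langle\Lambda^{-k-1}p,p\rangle+\tfrac12\sum_{j=0}^{k}\Big(\langle\Lambda^{-j-1}p,p\rangle\langle\Lambda^{-k+j-1}q,q\rangle-\langle\Lambda^{-j-1}p,q\rangle\langle\Lambda^{-k+j-1}p,q\rangle\Big),$$ and, for $\lambda\in\mathbb C$ with $|\lambda|<\min_j|\lambda_j|$, $H^-_\lambda=\sum_{k\ge0}H_{-k}\lambda^k$.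 The backward Neumann flow with time $t_{-k-2}$ is the Hamiltonian flow $\dot p=\{p,H_{-k}\}_D$, $\dot q=\{q,H_{-k}\}_D$ on $TS^{N-1}$. Likewise $d/dt^-_\lambda$ is the derivative along the flow of $H^-_\lambda$; for non-real $\lambda$ it is the derivative along the flow of $\operatorname{Re}H^-_\lambda$ plus $\sqrt{-1}$ times the derivative along the flow of $\operatorname{Im}H^-_\lambda$. Let $a(\lambda)=\prod_{k=1}^N(\lambda-\lambda_k)$, $Q_\lambda(x,y)=\sum_j \frac{x_jy_j}{\lambda-\lambda_j}$, and let $$V_\lambda=\begin{pmatrix}-Q_\lambda(p,q)&Q_\lambda(p,p)\\-(1+Q_\lambda(q,q))&Q_\lambda(p,q)\end{pmatrix},\qquad R(\lambda)=a(\lambda)^2\det V_\lambda,\qquad a(\lambda)Q_\lambda(p,p)=\prod_{k=1}^{N-1}(\lambda-\mu_k).$$ Fix a polynomial $R$ with simple roots. On the set of points of $TS^{N-1}$ whose spectral polynomial $a^2\det V_\lambda$ equals $R$, consider the compact Riemann surface $\Gamma$ (of genus $N-1$, with one point at infinity) of the curve $\xi^2+R(\lambda)=0$, a finite point $P_0\in\Gamma$,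 closed paths $a_1,\dots,a_{N-1},b_1,\dots,b_{N-1}$ on $\Gamma$ based at $P_0$ whose classes form a basis of $H_1(\Gamma,\mathbb Z)$ (e.g. a canonical basis), and the holomorphic differentials $\tilde\omega_j=\frac{\lambda^{N-1-j}d\lambda}{4\xi}$, $1\le j\le N-1$. Let $A_{ij}=\int_{a_j}\tilde\omega_i$ (non-singular for a canonical basis), $C=A^{-1}$ with columns $C_1,\dots,C_{N-1}$, $\omega=C\tilde\omega$, let $\mathcal T\subset\mathbb C^{N-1}$ be the $\mathbb Z$-span of the vectors $\int_{a_j}\omega$, $\int_{b_j}\omega$, and let $J(\Gamma)=\mathbb C^{N-1}/\mathcal T$. Choose a sign $\varepsilon\in\{1,-1\}$, put $P(\mu_k)=\big(\mu_k,\ \varepsilon\,(aV^{11})(\mu_k)\big)\in\Gamma$, where $V^{11}=-Q_\lambda(p,q)$, and let $$\bar\phi=\sum_{k=1}^{N-1}\int_{P_0}^{P(\mu_k)}\omega\ \in J(\Gamma).$$ Finally let $\frac1{a(\lambda)}=\sum_{k\ge0}\mathscr A_{-k}\lambda^k$ near $\lambda=0$, and $$\Omega_{-k}=\tfrac12\sum_{\substack{1\le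 j\le N-1\\ N-1-j\le k}}C_j\,\mathscr A_{-(k-(N-1-j))},\qquad k\ge0,$$ that is, $\Omega_{-k}=\frac12(C_{N-1-k}\mathscr A_0+\dots+C_{N-1}\mathscr A_{-k})$ for $0\le k\le N-2$ and $\Omega_{-k}=\frac12(C_1\mathscr A_{-(k-N+2)}+\dots+C_{N-1}\mathscr A_{-k})$ for $k\ge N-1$. **Theorem.** The backward Neumann flows leave $R$ invariant and are linearized by the Abel–Jacobi variable $\bar\phi$ on $J(\Gamma)$: $$\frac{d\bar\phi}{dt_{-k-2}}=-\varepsilon\,\Omega_{-k}\quad(k\ge0),\qquad \frac{d\bar\phi}{dt^-_\lambda}=-\varepsilon\sum_{k=0}^\infty\Omega_{-k}\lambda^k\quad(|\lambda|<\min_j|\lambda_j|).$$ In particular, with the sheet $\varepsilon=-1$ one has $\frac{d\bar\phi}{dt_{-k-2}}=\Omega_{-k}$ and $\frac{d\bar\phi}{dt^-_\lambda}=\sum_{k\ge0}\Omega_{-k}\lambda^k$. Here the derivative of a curve in $J(\Gamma)$ is that of any continuous lift to $\mathbb C^{N-1}$, and the formulas hold along every solution on every open time interval. -/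

import Mathlib

open Polynomial Topology

noncomputable section

namespace Neumann

/-! ### Phase space, Poisson bracket, Dirac bracket -/

/-- A point `(p, q)` of `ℝ^N × ℝ^N`. -/
abbrev Phase (N : ℕ) := (Fin N → ℝ) × (Fin N → ℝ)

/-- `∂f/∂p_j`. -/
def dp {N : ℕ} (f : Phase N → ℝ) (j : Fin N) (z : Phase N) : ℝ :=
  fderiv ℝ f z (Pi.single j 1, 0)

/-- `∂f/∂q_j`. -/
def dq {N : ℕ} (f : Phase N → ℝ) (j : Fin N) (z : Phase N) : ℝ :=
  fderiv ℝ f z (0, Pi.single j 1)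

/-- The Poisson bracket `{f, g} = ∑ (∂f/∂q_j ∂g/∂p_j - ∂f/∂p_j ∂g/∂q_j)`. -/
def poisson {N : ℕ} (f g : Phase N → ℝ) (z : Phase N) : ℝ :=
  ∑ j, (dq f j z * dp g j z - dp f j z * dq g j z)

/-- `F = ⟨p, q⟩`. -/
def casF {N : ℕ} (z : Phase N) : ℝ := ∑ j, z.1 j * z.2 j

/-- `G = ⟨p, p⟩ - 1`. -/
def casG {N : ℕ} (z : Phase N) : ℝ := ∑ j, z.1 j * z.1 j - 1

/-- The tangent bundle of the unit sphere, `F = G = 0`. -/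
def TSphere (N : ℕ) : Set (Phase N) := {z | casF z = 0 ∧ casG z = 0}

/-- The Dirac bracket of the constraints `F`, `G`; on `TSphere N` one has `{F, G} = 2`. -/
def dirac {N : ℕ} (f g : Phase N → ℝ) (z : Phase N) : ℝ :=
  poisson f g z + 1 / poisson casF casG z *
    (poisson f casF z * poisson casG g z - poisson f casG z * poisson casF g z)

/-- `γ` solves, on the time set `I`, the Hamiltonian system
`p' = {p, H}_D`, `q' = {q, H}_D` on the tangent bundle of the sphere. -/
def IsFlow {N : ℕ} (H : Phase N → ℝ) (I : Set ℝ) (γ : ℝ → Phase N) : Prop :=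
  ∀ t ∈ I, γ t ∈ TSphere N ∧ ∀ j,
    HasDerivAt (fun s => (γ s).1 j) (dirac (fun z => z.1 j) H (γ t)) t ∧
    HasDerivAt (fun s => (γ s).2 j) (dirac (fun z => z.2 j) H (γ t)) t

/-! ### The backward Hamiltonians -/

/-- `⟨Λ^{-m} x, y⟩` with `Λ = diag(λ_1, …, λ_N)`. -/
def brk {N : ℕ} (lam : Fin N → ℝ) (m : ℕ) (x y : Fin N → ℝ) : ℝ :=
  ∑ j, (lam j)⁻¹ ^ m * x j * y j

/-- The Hamiltonian `H_{-k}` of the `t_{-k-2}`-flow, `k ≥ 0`. -/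
def ham {N : ℕ} (lam : Fin N → ℝ) (k : ℕ) (z : Phase N) : ℝ :=
  -(1 / 2) * brk lam (k + 1) z.1 z.1 +
    1 / 2 * ∑ j ∈ Finset.range (k + 1),
      (brk lam (j + 1) z.1 z.1 * brk lam (k - j + 1) z.2 z.2 -
        brk lam (j + 1) z.1 z.2 * brk lam (k - j + 1) z.1 z.2)

/-- The generating function `H_λ = ∑ H_{-k} λ^k`, `|λ| < min |λ_j|`, of the backward
Hamiltonians. -/
def hamGen {N : ℕ} (lam : Fin N → ℝ) (l : ℂ) (z : Phase N) : ℂ :=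
  ∑' k : ℕ, (ham lam k z : ℂ) * l ^ k

/-! ### The Lax matrix and the spectral polynomial -/

/-- `a(λ) = ∏ (λ - λ_k)`. -/
def aPoly {N : ℕ} (lam : Fin N → ℝ) : ℂ[X] := ∏ k, (X - C (lam k : ℂ))

/-- `a(λ) Q_λ(x, y) = a(λ) ∑ x_j y_j / (λ - λ_j)`, as a polynomial. -/
def aQ {N : ℕ} (lam : Fin N → ℝ) (x y : Fin N → ℝ) : ℂ[X] :=
  ∑ j, C ((x j * y j : ℝ) : ℂ) * ∏ i ∈ Finset.univ.erase j, (X - C (lam i : ℂ))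

/-- `a(λ) V_λ`, where `V_λ` is the Lax matrix
`[[-Q_λ(p,q), Q_λ(p,p)], [-(1 + Q_λ(q,q)), Q_λ(p,q)]]`. -/
def laxMatrix {N : ℕ} (lam : Fin N → ℝ) (z : Phase N) : Matrix (Fin 2) (Fin 2) ℂ[X] :=
  !![-aQ lam z.1 z.2, aQ lam z.1 z.1; -(aPoly lam + aQ lam z.2 z.2), aQ lam z.1 z.2]

/-- `R(λ) = a(λ)² det V_λ`. -/
def spectralPoly {N : ℕ} (lam : Fin N → ℝ) (z : Phase N) : ℂ[X] := (laxMatrix lam z).det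

/-- `m(λ) = a(λ) Q_λ(p, p) = ∏ (λ - μ_k)`, whose roots are the elliptic variables `μ_k`. -/
def mPoly {N : ℕ} (lam : Fin N → ℝ) (z : Phase N) : ℂ[X] := laxMatrix lam z 0 1

/-! ### The hyperelliptic Riemann surface -/

/-- The affine curve `ξ² + R(λ) = 0`, with points `(λ, ξ)`. -/
abbrev AffineCurve (R : ℂ[X]) := {P : ℂ × ℂ // P.2 ^ 2 + R.eval P.1 = 0}

/-- The surface `Γ`: for `R` squarefree of odd degree the compact Riemann surface of the curve
has exactly one point at infinity, so it is the one-point compactification. -/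
abbrev Surface (R : ℂ[X]) := OnePoint (AffineCurve R)

/-- `f` is a primitive on `U ⊆ Γ` of the holomorphic differential `λ^e dλ / (4 ξ)`. Where `ξ ≠ 0`
the function `λ` is a local coordinate and the derivative of `f` with respect to it is
`λ^e / (4 ξ)`; at the branch points continuity suffices (removable singularities). -/
def IsPrimitiveOn (R : ℂ[X]) (e : ℕ) (f : Surface R → ℂ) (U : Set (Surface R)) : Prop :=
  ContinuousOn f U ∧ ∀ P : AffineCurve R, (P : Surface R) ∈ U → P.1.2 ≠ 0 →
    (fun Q : AffineCurve R =>
        f Q - f P - P.1.1 ^ e / (4 * P.1.2) * (Q.1.1 - P.1.1))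
      =o[𝓝 P] (fun Q : AffineCurve R => Q.1.1 - P.1.1)

/-- `F` is a primitive of `λ^e dλ / (4 ξ)` along the continuous path `γ`: locally it is the
composition of `γ` with a local primitive. -/
def IsPrimitiveAlong {R : ℂ[X]} (e : ℕ) {P Q : Surface R} (γ : Path P Q)
    (F : unitInterval → ℂ) : Prop :=
  ∀ t, ∃ U : Set (Surface R), IsOpen U ∧ γ t ∈ U ∧ ∃ f, IsPrimitiveOn R e f U ∧
    ∀ᶠ s in 𝓝 t, F s = f (γ s)

open Classical in
/-- The integral of `λ^e dλ / (4 ξ)` along the continuous path `γ`. -/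
def pathIntegral {R : ℂ[X]} (e : ℕ) {P Q : Surface R} (γ : Path P Q) : ℂ :=
  if h : ∃ F, IsPrimitiveAlong e γ F then h.choose 1 - h.choose 0 else 0

/-- The class of a closed path in the first homology group `H_1(Γ, ℤ) = π_1(Γ, P₀)^ab`. -/
def homologyClass {R : ℂ[X]} {P₀ : Surface R} (γ : Path P₀ P₀) :
    Abelianization (FundamentalGroup (Surface R) P₀) :=
  Abelianization.of (FundamentalGroup.fromPath (Path.Homotopic.Quotient.mk γ))

/-- The classes of the closed paths `a_j`, `b_j` generate `H_1(Γ, ℤ)`. As this group is free of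
rank `2 (N - 1)`, they are then a basis. -/
def GenerateHomology {R : ℂ[X]} {P₀ : Surface R} {g : ℕ} (a b : Fin g → Path P₀ P₀) : Prop :=
  Subgroup.closure (Set.range (fun j => homologyClass (a j)) ∪
    Set.range (fun j => homologyClass (b j))) = ⊤

/-! ### Normalized differentials, Jacobi variety, Abel map

The index `j : Fin (N - 1)` stands for the number `j + 1 ∈ {1, …, N - 1}`. -/

/-- The integral along `γ` of `ω̃_j = λ^{N-1-j} dλ / (4 ξ)`, `1 ≤ j ≤ N - 1`. -/
def intOmegaTilde {R : ℂ[X]} (N : ℕ) {P Q : Surface R} (γ : Path P Q) (j : Fin (N - 1)) : ℂ :=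
  pathIntegral (N - 2 - (j : ℕ)) γ

/-- The matrix `A_{ij} = ∫_{a_j} ω̃_i`. -/
def periodMatrix {R : ℂ[X]} {N : ℕ} {P₀ : Surface R} (a : Fin (N - 1) → Path P₀ P₀) :
    Matrix (Fin (N - 1)) (Fin (N - 1)) ℂ :=
  Matrix.of fun i j => intOmegaTilde N (a j) i

/-- The normalization matrix `C = A⁻¹`. -/
def normMatrix {R : ℂ[X]} {N : ℕ} {P₀ : Surface R} (a : Fin (N - 1) → Path P₀ P₀) :
    Matrix (Fin (N - 1)) (Fin (N - 1)) ℂ :=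
  (periodMatrix a)⁻¹

/-- The integral along `γ` of the vector `ω = C ω̃` of normalized differentials. -/
def intOmega {R : ℂ[X]} {N : ℕ} {P₀ : Surface R} (a : Fin (N - 1) → Path P₀ P₀)
    {P Q : Surface R} (γ : Path P Q) : Fin (N - 1) → ℂ :=
  (normMatrix a).mulVec (intOmegaTilde N γ)

/-- The subgroup of `ℂ^{N-1}` spanned over `ℤ` by the vectors `δ_j = ∫_{a_j} ω`,
`B_j = ∫_{b_j} ω`. -/
def periodLattice {R : ℂ[X]} {N : ℕ} {P₀ : Surface R} (a b : Fin (N - 1) → Path P₀ P₀) :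
    AddSubgroup (Fin (N - 1) → ℂ) :=
  AddSubgroup.closure (Set.range (fun j => intOmega a (a j)) ∪
    Set.range (fun j => intOmega a (b j)))

/-- The Jacobi variety `J(Γ) = ℂ^{N-1} / 𝒯`. -/
abbrev Jacobian {R : ℂ[X]} {N : ℕ} {P₀ : Surface R} (a b : Fin (N - 1) → Path P₀ P₀) :=
  (Fin (N - 1) → ℂ) ⧸ periodLattice a b

open Classical in
/-- The Abel map `P ↦ ∫_{P₀}^P ω` (along any path) with values in `J(Γ)`. -/
def abelMap {R : ℂ[X]} {N : ℕ} {P₀ : Surface R} (a b : Fin (N - 1) → Path P₀ P₀)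
    (P : Surface R) : Jacobian a b :=
  if h : Joined P₀ P then (intOmega a h.somePath : Fin (N - 1) → ℂ) else 0

open Classical in
/-- The point `(λ, ξ)` of `Γ`; it is only used for `ξ² + R(λ) = 0`. -/
def surfacePoint (R : ℂ[X]) (l ξ : ℂ) : Surface R :=
  if h : ξ ^ 2 + R.eval l = 0 then ((⟨(l, ξ), h⟩ : AffineCurve R) : Surface R) else OnePoint.infty

/-- The Abel-Jacobi variable `φ̄ = ∑_k ∫_{P₀}^{P(μ_k)} ω ∈ J(Γ)` of the phase point `z`, where
`P(μ_k) = (μ_k, ε a(μ_k) V^{11}(μ_k))` and `ε = ±1` fixes the sheet. -/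
def abelJacobi {R : ℂ[X]} {N : ℕ} {P₀ : Surface R} (lam : Fin N → ℝ)
    (a b : Fin (N - 1) → Path P₀ P₀) (ε : ℂ) (z : Phase N) : Jacobian a b :=
  ((mPoly lam z).roots.map fun μ =>
    abelMap a b (surfacePoint R μ (ε * (laxMatrix lam z 0 0).eval μ))).sum

/-! ### Frequencies and the derivative of a curve in the Jacobi variety -/

/-- `𝒜_{-k}`, the coefficient of `λ^k` in the expansion of `1 / a(λ)` at `λ = 0`. -/
def calA {N : ℕ} (lam : Fin N → ℝ) (k : ℕ) : ℂ :=
  PowerSeries.coeff k ((aPoly lam : PowerSeries ℂ)⁻¹)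

/-- `Ω_{-k} = (1/2) ∑_j 𝒜_{-(k - (N-1-j))} C_j`, the sum over those `1 ≤ j ≤ N - 1` with
`N - 1 - j ≤ k`, where `C_j` is the `j`-th column of `C`. -/
def Omega {R : ℂ[X]} {N : ℕ} {P₀ : Surface R} (lam : Fin N → ℝ)
    (a : Fin (N - 1) → Path P₀ P₀) (k : ℕ) : Fin (N - 1) → ℂ := fun i =>
  1 / 2 * ∑ j : Fin (N - 1),
    if N - 2 - (j : ℕ) ≤ k then normMatrix a i j * calA lam (k - (N - 2 - (j : ℕ))) else 0

/-- The curve `φ` in the quotient `V / T` has the constant derivative `v` on `I`: it lifts to a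
continuous curve in `V`, and every continuous lift has derivative `v` at every time of `I`. -/
def HasConstDeriv {V : Type*} [NormedAddCommGroup V] [NormedSpace ℝ V] (T : AddSubgroup V)
    (φ : ℝ → V ⧸ T) (I : Set ℝ) (v : V) : Prop :=
  (∃ Φ : ℝ → V, ContinuousOn Φ I ∧ ∀ t ∈ I, (Φ t : V ⧸ T) = φ t) ∧
  ∀ Φ : ℝ → V, ContinuousOn Φ I → (∀ t ∈ I, (Φ t : V ⧸ T) = φ t) →
    ∀ t ∈ I, HasDerivAt Φ v t

/-- Along the flow of the Hamiltonian `H`, on the level set of phase points with spectral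
polynomial `R`, one has `dφ̄/dt = v`: for every solution on an open interval that meets the level
set, the solution stays in it, and `φ̄` has constant derivative `v`. -/
def FlowDeriv {R : ℂ[X]} {N : ℕ} {P₀ : Surface R} (lam : Fin N → ℝ)
    (a b : Fin (N - 1) → Path P₀ P₀) (ε : ℂ) (H : Phase N → ℝ) (v : Fin (N - 1) → ℂ) : Prop :=
  ∀ (I : Set ℝ) (γ : ℝ → Phase N) (t₀ : ℝ), IsOpen I → IsPreconnected I → t₀ ∈ I →
    IsFlow H I γ → spectralPoly lam (γ t₀) = R →
    (∀ t ∈ I, spectralPoly lam (γ t) = R) ∧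
    HasConstDeriv (periodLattice a b) (fun t => abelJacobi lam a b ε (γ t)) I v

end Neumann

end

noncomputable section

namespace Neumann

/-! ### Real combinations of the Uhlenbeck integrals and their Dirac flows -/

/-! All Hamiltonians involved are combinations ∑ c_a F_a of the Uhlenbeck integrals with real
weights: c_a = λ_a^{-k-1} gives H_{-k} (`ham_eq_uhlenbeck`), and the real and imaginary parts of
1/(λ_a - λ) give those of the generating function, by the geometric series. It therefore suffices to
linearize the flow for arbitrary c (`flowDeriv_uhlenbeck`), with a velocity that is linear in c.

Write m = a Q(p,p), b = a Q(p,q), n = a (1 + Q(q,q)), so that R = mn - b². The velocities of m, b, n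
are given by Lax-type identities (`aPoly_mul_velPP` and its two companions), which force R to be
constant (`isospectral`). Let Y be the quotient by a of a Q(cp,p) - L m, where L interpolates c at
the nodes. At a root μ of m the identities give μ' = 2 b Y / m'. The corresponding point of Γ has ξ
= -ε b, so b cancels in μ^e μ' / (4ξ) = -(ε/2) μ^e Y(μ) / m'(μ). At a branch point ξ is the
coordinate, and the same expression results. Lagrange interpolation, in effect the residue theorem,
evaluates the sum over all roots: the total is (ε/2) ∑_j c_j λ_j^e / a'(λ_j), independent of the
phase point (`sum_roots_quotient`). For c_j = λ_j^{-k-1} this is -ε/2 times a Taylor coefficient of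
1/a (`calA_shift`), which is the asserted frequency.

To make sense of the left-hand side, Γ is covered by explicit charts in which the differentials are
holomorphic. Germs of their primitives form a covering space of Γ, so integrals along continuous
paths exist and are homotopy invariant. Closed paths then integrate into the period lattice, and the
Abel map may be computed along any path (`abelMap_eq`). The roots of m are simple because the λ_j
are real and R is squarefree (`derivative_mPoly_eval_ne_zero`), so they move differentiably by the
implicit function theorem.

This yields near each time a continuous lift that is known to be differentiable only at that time.
Since the lattice is countable, two continuous lifts on an interval differ by a constant, and the
local statements glue (`hasConstDeriv_of_local`). -/

/-- The angular momentum `p_a q_b - p_b q_a`. -/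
def angMom {N : ℕ} (z : Phase N) (a b : Fin N) : ℝ := z.1 a * z.2 b - z.1 b * z.2 a

/-- The divided difference `(c_a - c_b) / (λ_b - λ_a)`. -/
def divDiff {N : ℕ} (lam c : Fin N → ℝ) (a b : Fin N) : ℝ := (c a - c b) / (lam b - lam a)

/-- The combination `∑ c_a F_a` of the Uhlenbeck integrals
`F_a = -p_a² / 2 + (1 / 2) ∑_b (p_a q_b - p_b q_a)² / (λ_b - λ_a)`. -/
def uhlenbeck {N : ℕ} (lam c : Fin N → ℝ) (z : Phase N) : ℝ :=
  -(1 / 2) * ∑ a, c a * (z.1 a * z.1 a) +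
    1 / 4 * ∑ a, ∑ b, divDiff lam c a b * (angMom z a b * angMom z a b)

lemma divDiff_symm {N : ℕ} (lam c : Fin N → ℝ) (a b : Fin N) :
    divDiff lam c a b = divDiff lam c b a := by
  unfold divDiff
  rw [← neg_sub (c b), ← neg_sub (lam a), neg_div_neg_eq]

lemma divDiff_mul {N : ℕ} {lam : Fin N → ℝ} (hlam : Function.Injective lam) (c : Fin N → ℝ)
    (a b : Fin N) : divDiff lam c a b * (lam b - lam a) = c a - c b := by
  unfold divDiff
  by_cases h : a = b
  · subst h; simp
  · exact div_mul_cancel₀ _ (sub_ne_zero.2 fun e => h (hlam e).symm)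

lemma angMom_symm {N : ℕ} (z : Phase N) (a b : Fin N) : angMom z b a = -angMom z a b := by
  unfold angMom; ring

lemma differentiable_uhlenbeck {N : ℕ} (lam c : Fin N → ℝ) :
    Differentiable ℝ (uhlenbeck lam c) := by
  unfold uhlenbeck angMom
  fun_prop

/-! ### Differentials and brackets of the constraints and the Hamiltonians. -/

lemma fderiv_eq_of_hasDerivAt_line {N : ℕ} {f : Phase N → ℝ} {z v : Phase N} {d : ℝ}
    (hf : DifferentiableAt ℝ f z) (h : HasDerivAt (fun t : ℝ => f (z + t • v)) d 0) :
    fderiv ℝ f z v = d :=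
  (hf.hasFDerivAt.hasLineDerivAt v).unique h

lemma hasDerivAt_line_fst {N : ℕ} (z v : Phase N) (a : Fin N) :
    HasDerivAt (fun t : ℝ => (z + t • v).1 a) (v.1 a) 0 := by
  simpa using ((hasDerivAt_id (0 : ℝ)).mul_const (v.1 a)).const_add (z.1 a)

lemma hasDerivAt_line_snd {N : ℕ} (z v : Phase N) (a : Fin N) :
    HasDerivAt (fun t : ℝ => (z + t • v).2 a) (v.2 a) 0 := by
  simpa using ((hasDerivAt_id (0 : ℝ)).mul_const (v.2 a)).const_add (z.2 a)

lemma hasDerivAt_angMom {N : ℕ} (z v : Phase N) (a b : Fin N) :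
    HasDerivAt (fun t : ℝ => angMom (z + t • v) a b)
      (v.1 a * z.2 b + z.1 a * v.2 b - (v.1 b * z.2 a + z.1 b * v.2 a)) 0 := by
  have := ((hasDerivAt_line_fst z v a).fun_mul (hasDerivAt_line_snd z v b)).fun_sub
    ((hasDerivAt_line_fst z v b).fun_mul (hasDerivAt_line_snd z v a))
  simpa [angMom] using this

lemma fderiv_uhlenbeck {N : ℕ} (lam c : Fin N → ℝ) (z v : Phase N) :
    fderiv ℝ (uhlenbeck lam c) z v = -∑ a, c a * (z.1 a * v.1 a) +
      1 / 2 * ∑ a, ∑ b, divDiff lam c a b * (angMom z a b *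
        (v.1 a * z.2 b + z.1 a * v.2 b - (v.1 b * z.2 a + z.1 b * v.2 a))) := by
  apply fderiv_eq_of_hasDerivAt_line (differentiable_uhlenbeck lam c z)
  have h1 := (HasDerivAt.fun_sum (u := Finset.univ) fun a _ =>
    ((hasDerivAt_line_fst z v a).fun_mul (hasDerivAt_line_fst z v a)).const_mul (c a)).const_mul
      (-(1 / 2 : ℝ))
  have h2 := (HasDerivAt.fun_sum (u := Finset.univ) fun a _ =>
    HasDerivAt.fun_sum (u := Finset.univ) fun b _ =>
    ((hasDerivAt_angMom z v a b).fun_mul (hasDerivAt_angMom z v a b)).const_mul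
      (divDiff lam c a b)).const_mul (1 / 4 : ℝ)
  refine (h1.fun_add h2).congr_deriv ?_
  simp only [zero_smul, add_zero, Finset.mul_sum, ← Finset.sum_neg_distrib]
  congr 1
  · exact Finset.sum_congr rfl fun a _ => by ring
  · exact Finset.sum_congr rfl fun a _ => Finset.sum_congr rfl fun b _ => by ring

lemma dp_uhlenbeck {N : ℕ} (lam c : Fin N → ℝ) (z : Phase N) (j : Fin N) :
    dp (uhlenbeck lam c) j z =
      -(c j * z.1 j) + ∑ b, divDiff lam c j b * angMom z j b * z.2 b := by
  -- Exchange a and b: the divided difference is symmetric and the angular momentum antisymmetric,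
  -- so the two halves of the differential contribute equally.
  have key : ∑ a, ∑ b, divDiff lam c a b * (angMom z a b * ((Pi.single j 1 : Fin N → ℝ) b * z.2 a))
      = -∑ a, ∑ b, divDiff lam c a b * (angMom z a b * ((Pi.single j 1 : Fin N → ℝ) a * z.2 b)) := by
    rw [Finset.sum_comm, ← Finset.sum_neg_distrib]
    refine Finset.sum_congr rfl fun a _ => ?_
    rw [← Finset.sum_neg_distrib]
    refine Finset.sum_congr rfl fun b _ => ?_
    rw [divDiff_symm, angMom_symm]; ring
  unfold dp
  rw [fderiv_uhlenbeck]
  simp only [Pi.zero_apply, mul_zero, add_zero, mul_sub, Finset.sum_sub_distrib, key]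
  have e1 : ∑ a, c a * (z.1 a * (Pi.single j 1 : Fin N → ℝ) a) = c j * z.1 j := by
    rw [Finset.sum_eq_single j] <;> simp +contextual
  have e2 : ∑ a, ∑ b, divDiff lam c a b * (angMom z a b * ((Pi.single j 1 : Fin N → ℝ) a * z.2 b))
      = ∑ b, divDiff lam c j b * angMom z j b * z.2 b := by
    rw [Finset.sum_eq_single j]
    · simp [mul_assoc]
    · intro a _ ha; simp [ha]
    · simp
  rw [e1, e2]; ring

lemma dq_uhlenbeck {N : ℕ} (lam c : Fin N → ℝ) (z : Phase N) (j : Fin N) :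
    dq (uhlenbeck lam c) j z = -∑ b, divDiff lam c j b * angMom z j b * z.1 b := by
  have key : ∑ a, ∑ b, divDiff lam c a b * (angMom z a b * (z.1 a * (Pi.single j 1 : Fin N → ℝ) b))
      = -∑ a, ∑ b, divDiff lam c a b * (angMom z a b * (z.1 b * (Pi.single j 1 : Fin N → ℝ) a)) := by
    rw [Finset.sum_comm, ← Finset.sum_neg_distrib]
    refine Finset.sum_congr rfl fun a _ => ?_
    rw [← Finset.sum_neg_distrib]
    refine Finset.sum_congr rfl fun b _ => ?_
    rw [divDiff_symm, angMom_symm]; ring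
  unfold dq
  rw [fderiv_uhlenbeck]
  simp only [Pi.zero_apply, mul_zero, zero_mul, zero_add, mul_sub, Finset.sum_sub_distrib, key]
  have e2 : ∑ a, ∑ b, divDiff lam c a b * (angMom z a b * (z.1 b * (Pi.single j 1 : Fin N → ℝ) a))
      = ∑ b, divDiff lam c j b * angMom z j b * z.1 b := by
    rw [Finset.sum_eq_single j]
    · simp [mul_assoc]
    · intro a _ ha; simp [ha]
    · simp
  rw [e2]; simp; ring

lemma fderiv_casF {N : ℕ} (z v : Phase N) :
    fderiv ℝ casF z v = ∑ a, (v.1 a * z.2 a + z.1 a * v.2 a) := by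
  apply fderiv_eq_of_hasDerivAt_line
  · unfold casF; fun_prop
  · have := HasDerivAt.fun_sum (u := Finset.univ) fun a _ =>
      (hasDerivAt_line_fst z v a).fun_mul (hasDerivAt_line_snd z v a)
    simpa [casF] using this

lemma fderiv_casG {N : ℕ} (z v : Phase N) :
    fderiv ℝ casG z v = ∑ a, (v.1 a * z.1 a + z.1 a * v.1 a) := by
  apply fderiv_eq_of_hasDerivAt_line
  · unfold casG; fun_prop
  · have := (HasDerivAt.fun_sum (u := Finset.univ) fun a _ =>
      (hasDerivAt_line_fst z v a).fun_mul (hasDerivAt_line_fst z v a)).sub_const 1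
    simpa [casG] using this

lemma dp_casF {N : ℕ} (z : Phase N) (j : Fin N) : dp casF j z = z.2 j := by
  rw [dp, fderiv_casF, Finset.sum_eq_single j] <;> simp +contextual

lemma dq_casF {N : ℕ} (z : Phase N) (j : Fin N) : dq casF j z = z.1 j := by
  rw [dq, fderiv_casF, Finset.sum_eq_single j] <;> simp +contextual

lemma dp_casG {N : ℕ} (z : Phase N) (j : Fin N) : dp casG j z = 2 * z.1 j := by
  rw [dp, fderiv_casG, Finset.sum_eq_single j]
  · simp; ring
  · simp +contextual
  · simp

lemma dq_casG {N : ℕ} (z : Phase N) (j : Fin N) : dq casG j z = 0 := by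
  rw [dq, fderiv_casG]; simp

lemma poisson_casF_casG {N : ℕ} {z : Phase N} (hz : z ∈ TSphere N) :
    poisson casF casG z = 2 := by
  have h : ∑ j, z.1 j * z.1 j = 1 := by have := hz.2; unfold casG at this; linarith
  simp only [poisson, dq_casF, dp_casG, dq_casG, mul_zero, sub_zero]
  calc ∑ j, z.1 j * (2 * z.1 j) = 2 * ∑ j, z.1 j * z.1 j := by
        rw [Finset.mul_sum]; exact Finset.sum_congr rfl fun j _ => by ring
    _ = 2 := by rw [h, mul_one]

lemma poisson_fst {N : ℕ} (f : Phase N → ℝ) (z : Phase N) (j : Fin N) :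
    poisson (fun z => z.1 j) f z = -dq f j z := by
  have h1 : ∀ v : Phase N, fderiv ℝ (fun z : Phase N => z.1 j) z v = v.1 j := fun v =>
    fderiv_eq_of_hasDerivAt_line (by fun_prop) (hasDerivAt_line_fst z v j)
  have hq : ∀ i, dq (fun z : Phase N => z.1 j) i z = 0 := fun i => by rw [dq, h1]; rfl
  have hp : ∀ i, dp (fun z : Phase N => z.1 j) i z = (Pi.single i 1 : Fin N → ℝ) j :=
    fun i => by rw [dp, h1]
  simp only [poisson, hq, hp]
  rw [Finset.sum_eq_single j]
  · simp
  · intro i _ hi; simp [hi.symm]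
  · simp

lemma poisson_snd {N : ℕ} (f : Phase N → ℝ) (z : Phase N) (j : Fin N) :
    poisson (fun z => z.2 j) f z = dp f j z := by
  have h1 : ∀ v : Phase N, fderiv ℝ (fun z : Phase N => z.2 j) z v = v.2 j := fun v =>
    fderiv_eq_of_hasDerivAt_line (by fun_prop) (hasDerivAt_line_snd z v j)
  have hp : ∀ i, dp (fun z : Phase N => z.2 j) i z = 0 := fun i => by rw [dp, h1]; rfl
  have hq : ∀ i, dq (fun z : Phase N => z.2 j) i z = (Pi.single i 1 : Fin N → ℝ) j :=
    fun i => by rw [dq, h1]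
  simp only [poisson, hq, hp]
  rw [Finset.sum_eq_single j]
  · simp
  · intro i _ hi; simp [hi.symm]
  · simp

lemma sum_antisymm_eq_zero {N : ℕ} {f : Fin N → Fin N → ℝ} (h : ∀ a b, f b a = -f a b) :
    ∑ a, ∑ b, f a b = 0 := by
  have : ∑ a, ∑ b, f a b = -∑ a, ∑ b, f a b := by
    rw [← Finset.sum_neg_distrib, Finset.sum_comm]
    refine Finset.sum_congr rfl fun a _ => ?_
    rw [← Finset.sum_neg_distrib]
    exact Finset.sum_congr rfl fun b _ => h a b
  linarith

/-- Angular momenta generate rotations, which preserve ⟨p,p⟩, and functions of p commute with it.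
One of the two Dirac corrections thus disappears. -/
lemma poisson_casG_uhlenbeck {N : ℕ} (lam c : Fin N → ℝ) (z : Phase N) :
    poisson casG (uhlenbeck lam c) z = 0 := by
  simp only [poisson, dq_casG, dp_casG, dq_uhlenbeck, zero_mul, zero_sub, mul_neg, neg_neg,
    Finset.mul_sum]
  apply sum_antisymm_eq_zero
  intro a b
  rw [divDiff_symm, angMom_symm]; ring

/-- ⟨p,q⟩ generates the scaling of p against q. Angular momenta are invariant under it, so only the
part quadratic in p contributes. -/
lemma poisson_casF_uhlenbeck {N : ℕ} (lam c : Fin N → ℝ) (z : Phase N) :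
    poisson casF (uhlenbeck lam c) z = -∑ a, c a * (z.1 a * z.1 a) := by
  simp only [poisson, dq_casF, dp_casF, dq_uhlenbeck, dp_uhlenbeck]
  have key : ∑ a, ∑ b, divDiff lam c a b * angMom z a b * (z.1 a * z.2 b + z.2 a * z.1 b) = 0 := by
    apply sum_antisymm_eq_zero
    intro a b
    rw [divDiff_symm, angMom_symm]; ring
  have : -∑ a, c a * (z.1 a * z.1 a) = -∑ a, c a * (z.1 a * z.1 a) +
      ∑ a, ∑ b, divDiff lam c a b * angMom z a b * (z.1 a * z.2 b + z.2 a * z.1 b) := by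
    rw [key, add_zero]
  rw [this, ← Finset.sum_neg_distrib, ← Finset.sum_add_distrib]
  refine Finset.sum_congr rfl fun a _ => ?_
  simp only [mul_add, Finset.sum_add_distrib, mul_neg, sub_neg_eq_add, Finset.mul_sum, add_assoc]
  congr 1
  · ring
  · congr 1 <;> exact Finset.sum_congr rfl fun b _ => by ring

lemma dirac_fst_uhlenbeck {N : ℕ} (lam c : Fin N → ℝ) {z : Phase N} (hz : z ∈ TSphere N)
    (j : Fin N) : dirac (fun z => z.1 j) (uhlenbeck lam c) z =
      ∑ b, divDiff lam c j b * angMom z j b * z.1 b := by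
  rw [dirac, poisson_casF_casG hz, poisson_casG_uhlenbeck, poisson_fst, poisson_fst, poisson_fst,
    dq_casG, dq_uhlenbeck]
  ring

/-- The constraint force is the term along p: {q_j, G} = 2 p_j, multiplied by -{F, H} / {F, G} with
{F, G} = 2. The p-equation has no such term because {p_j, G} = 0. -/
lemma dirac_snd_uhlenbeck {N : ℕ} (lam c : Fin N → ℝ) {z : Phase N} (hz : z ∈ TSphere N)
    (j : Fin N) : dirac (fun z => z.2 j) (uhlenbeck lam c) z =
      -(c j * z.1 j) + (∑ a, c a * (z.1 a * z.1 a)) * z.1 j +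
        ∑ b, divDiff lam c j b * angMom z j b * z.2 b := by
  rw [dirac, poisson_casF_casG hz, poisson_casG_uhlenbeck, poisson_casF_uhlenbeck, poisson_snd,
    poisson_snd, poisson_snd, dp_casG, dp_uhlenbeck]
  ring

/-! ### The backward Hamiltonians as combinations of the Uhlenbeck integrals -/

/-- A geometric sum, combined with xy(m - l) = x - y. It exhibits the coefficients of H_{-k} as
divided differences of the weights λ^{-k-1}. -/
lemma sum_pow_mul_inv {x y l m : ℝ} (hl : l ≠ 0) (hm : m ≠ 0) (hx : x = l⁻¹) (hy : y = m⁻¹)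
    (k : ℕ) : (∑ i ∈ Finset.range (k + 1), x ^ (i + 1) * y ^ (k - i + 1)) * (m - l) =
      x ^ (k + 1) - y ^ (k + 1) := by
  have h := (Commute.all x y).geom_sum₂_mul (k + 1)
  have e : ∑ i ∈ Finset.range (k + 1), x ^ (i + 1) * y ^ (k - i + 1) =
      x * y * ∑ i ∈ Finset.range (k + 1), x ^ i * y ^ (k + 1 - 1 - i) := by
    rw [Finset.mul_sum]
    refine Finset.sum_congr rfl fun i _ => ?_
    rw [Nat.add_sub_cancel]; ring
  rw [e, ← h]
  have : x * y * (m - l) = x - y := by subst hx hy; field_simp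
  rw [← this]; ring

lemma ham_eq_uhlenbeck {N : ℕ} {lam : Fin N → ℝ} (hlam : Function.Injective lam)
    (hlam0 : ∀ j, lam j ≠ 0) (k : ℕ) :
    ham lam k = uhlenbeck lam fun a => (lam a)⁻¹ ^ (k + 1) := by
  funext z
  set w : Fin N → Fin N → ℝ := fun a b =>
    ∑ i ∈ Finset.range (k + 1), (lam a)⁻¹ ^ (i + 1) * (lam b)⁻¹ ^ (k - i + 1) with hw
  have hsymm : ∀ a b, w a b = w b a := by
    intro a b
    rw [hw]
    simp only
    rw [← Finset.sum_range_reflect]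
    refine Finset.sum_congr rfl fun i hi => ?_
    have : i ≤ k := by simpa [Nat.lt_succ_iff] using hi
    rw [show k + 1 - 1 - i = k - i by lia, show k - (k - i) = i by lia, mul_comm]
  have hwd : ∀ a b, a ≠ b → w a b = divDiff lam (fun a => (lam a)⁻¹ ^ (k + 1)) a b := by
    intro a b hab
    have hne : lam b - lam a ≠ 0 := sub_ne_zero.2 fun e => hab (hlam e).symm
    rw [divDiff, eq_div_iff hne]
    exact sum_pow_mul_inv (hlam0 a) (hlam0 b) rfl rfl k
  have h1 : ∑ i ∈ Finset.range (k + 1), (brk lam (i + 1) z.1 z.1 * brk lam (k - i + 1) z.2 z.2 -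
      brk lam (i + 1) z.1 z.2 * brk lam (k - i + 1) z.1 z.2) =
      ∑ a, ∑ b, w a b * (z.1 a * z.2 b * angMom z a b) := by
    simp only [brk, Finset.sum_mul_sum]
    simp only [← Finset.sum_sub_distrib, hw, Finset.sum_mul]
    rw [Finset.sum_comm]
    refine Finset.sum_congr rfl fun a _ => ?_
    rw [Finset.sum_comm]
    refine Finset.sum_congr rfl fun b _ => Finset.sum_congr rfl fun i _ => ?_
    unfold angMom; ring
  -- Symmetrizing in a and b completes the angular momentum to a square, at the cost of a factor 2.
  have h2 : ∑ a, ∑ b, w a b * (z.1 a * z.2 b * angMom z a b) =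
      ∑ a, ∑ b, w a b * (-(z.1 b * z.2 a) * angMom z a b) := by
    rw [Finset.sum_comm]
    refine Finset.sum_congr rfl fun a _ => Finset.sum_congr rfl fun b _ => ?_
    rw [hsymm, angMom_symm]; ring
  have h3 : ∑ a, ∑ b, w a b * (angMom z a b * angMom z a b) =
      2 * ∑ a, ∑ b, w a b * (z.1 a * z.2 b * angMom z a b) := by
    rw [two_mul]
    nth_rw 2 [h2]
    simp only [← Finset.sum_add_distrib]
    refine Finset.sum_congr rfl fun a _ => Finset.sum_congr rfl fun b _ => ?_
    unfold angMom; ring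
  have h4 : ∑ a, ∑ b, w a b * (angMom z a b * angMom z a b) = ∑ a, ∑ b,
      divDiff lam (fun a => (lam a)⁻¹ ^ (k + 1)) a b * (angMom z a b * angMom z a b) := by
    refine Finset.sum_congr rfl fun a _ => Finset.sum_congr rfl fun b _ => ?_
    -- On the diagonal `divDiff` is 0 by the convention 0 / 0 = 0 while w is not, but the angular
    -- momentum vanishes there.
    by_cases hab : a = b
    · subst hab
      have : angMom z a a = 0 := by unfold angMom; ring
      rw [this]; ring
    · rw [hwd a b hab]
  rw [ham, h1, uhlenbeck, ← h4, h3, brk]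
  congr 1
  · congr 1
    exact Finset.sum_congr rfl fun a _ => by ring
  · ring

/-- The Uhlenbeck integral `F_a`. -/
def uhlenbeckIntegral {N : ℕ} (lam : Fin N → ℝ) (z : Phase N) (a : Fin N) : ℝ :=
  -(1 / 2) * (z.1 a * z.1 a) + 1 / 2 * ∑ b, (angMom z a b * angMom z a b) / (lam b - lam a)

/-- Makes the linearity in c visible, so that the series over k can be summed weight by weight. -/
lemma uhlenbeck_eq_sum {N : ℕ} (lam c : Fin N → ℝ) (z : Phase N) :
    uhlenbeck lam c z = ∑ a, c a * uhlenbeckIntegral lam z a := by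
  have h : ∑ a, ∑ b, divDiff lam c a b * (angMom z a b * angMom z a b) =
      2 * ∑ a, ∑ b, c a * ((angMom z a b * angMom z a b) / (lam b - lam a)) := by
    have h1 : ∑ a, ∑ b, c b * ((angMom z a b * angMom z a b) / (lam b - lam a)) =
        -∑ a, ∑ b, c a * ((angMom z a b * angMom z a b) / (lam b - lam a)) := by
      rw [Finset.sum_comm, ← Finset.sum_neg_distrib]
      refine Finset.sum_congr rfl fun a _ => ?_
      rw [← Finset.sum_neg_distrib]
      refine Finset.sum_congr rfl fun b _ => ?_
      rw [angMom_symm z a b, ← neg_sub (lam b), div_neg]; ring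
    have h2 : ∀ a b, divDiff lam c a b * (angMom z a b * angMom z a b) =
        c a * ((angMom z a b * angMom z a b) / (lam b - lam a)) -
        c b * ((angMom z a b * angMom z a b) / (lam b - lam a)) := by
      intro a b; unfold divDiff; ring
    simp only [h2, Finset.sum_sub_distrib, h1]; ring
  rw [uhlenbeck, h]
  simp only [uhlenbeckIntegral, mul_add, Finset.sum_add_distrib, Finset.mul_sum]
  congr 1
  · exact Finset.sum_congr rfl fun a _ => by ring
  · exact Finset.sum_congr rfl fun a _ => Finset.sum_congr rfl fun b _ => by ring

/-- The geometric series `∑ λ_a^{-k-1} l^k = 1 / (λ_a - l)`. -/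
lemma hasSum_inv_pow_mul_pow {x : ℝ} {l : ℂ} (h : ‖l‖ < |x|) :
    HasSum (fun k : ℕ => l ^ k * (((x⁻¹ ^ (k + 1) : ℝ)) : ℂ)) ((x : ℂ) - l)⁻¹ := by
  have hx : x ≠ 0 := by rintro rfl; simp at h; exact absurd h (norm_nonneg l).not_gt
  have hxc : (x : ℂ) ≠ 0 := by exact_mod_cast hx
  have hn : ‖l * (x : ℂ)⁻¹‖ < 1 := by
    rw [norm_mul, norm_inv, Complex.norm_real, Real.norm_eq_abs, ← div_eq_mul_inv,
      div_lt_one (abs_pos.2 hx)]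
    exact h
  have := (hasSum_geometric_of_norm_lt_one hn).mul_right (x : ℂ)⁻¹
  have e : (1 - l * (x : ℂ)⁻¹)⁻¹ * (x : ℂ)⁻¹ = ((x : ℂ) - l)⁻¹ := by
    rw [← mul_inv]; congr 1; field_simp
  rw [e] at this
  exact this.congr_fun fun k => by push_cast; ring

lemma hamGen_eq_sum {N : ℕ} {lam : Fin N → ℝ} (hlam : Function.Injective lam)
    (hlam0 : ∀ j, lam j ≠ 0) {l : ℂ} (hl : ∀ j, ‖l‖ < |lam j|) (z : Phase N) :
    hamGen lam l z = ∑ a, ((lam a : ℂ) - l)⁻¹ * uhlenbeckIntegral lam z a := by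
  have := hasSum_sum (s := Finset.univ) fun a _ =>
    (hasSum_inv_pow_mul_pow (hl a)).mul_right (uhlenbeckIntegral lam z a : ℂ)
  rw [← this.tsum_eq, hamGen]
  refine tsum_congr fun k => ?_
  rw [ham_eq_uhlenbeck hlam hlam0, uhlenbeck_eq_sum]
  push_cast
  rw [Finset.sum_mul]
  exact Finset.sum_congr rfl fun a _ => by ring

lemma re_hamGen {N : ℕ} {lam : Fin N → ℝ} (hlam : Function.Injective lam)
    (hlam0 : ∀ j, lam j ≠ 0) {l : ℂ} (hl : ∀ j, ‖l‖ < |lam j|) :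
    (fun z => (hamGen lam l z).re) = uhlenbeck lam fun a => (((lam a : ℂ) - l)⁻¹).re := by
  funext z
  rw [hamGen_eq_sum hlam hlam0 hl, uhlenbeck_eq_sum, Complex.re_sum]
  exact Finset.sum_congr rfl fun a _ => by rw [Complex.re_mul_ofReal]

lemma im_hamGen {N : ℕ} {lam : Fin N → ℝ} (hlam : Function.Injective lam)
    (hlam0 : ∀ j, lam j ≠ 0) {l : ℂ} (hl : ∀ j, ‖l‖ < |lam j|) :
    (fun z => (hamGen lam l z).im) = uhlenbeck lam fun a => (((lam a : ℂ) - l)⁻¹).im := by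
  funext z
  rw [hamGen_eq_sum hlam hlam0 hl, uhlenbeck_eq_sum, Complex.im_sum]
  exact Finset.sum_congr rfl fun a _ => by rw [Complex.im_mul_ofReal]

/-! ### Polynomials with prescribed residues over `a(λ)` -/

/-- `a(λ) ∑ u_j / (λ - λ_j)`, as a polynomial. -/
def nodeSum {N : ℕ} (lam : Fin N → ℝ) (u : Fin N → ℂ) : ℂ[X] :=
  ∑ j, C (u j) * ∏ i ∈ Finset.univ.erase j, (X - C (lam i : ℂ))

lemma aQ_eq_nodeSum {N : ℕ} (lam x y : Fin N → ℝ) :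
    aQ lam x y = nodeSum lam fun j => ((x j * y j : ℝ) : ℂ) := rfl

lemma aPoly_monic {N : ℕ} (lam : Fin N → ℝ) : (aPoly lam).Monic :=
  monic_prod_of_monic _ _ fun _ _ => monic_X_sub_C _

lemma natDegree_aPoly {N : ℕ} (lam : Fin N → ℝ) : (aPoly lam).natDegree = N := by
  rw [aPoly, natDegree_prod_of_monic _ _ fun _ _ => monic_X_sub_C _]; simp

lemma aPoly_eval_eq_zero {N : ℕ} {lam : Fin N → ℝ} {x : ℂ} (h : (aPoly lam).eval x = 0) :
    ∃ j, x = lam j := by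
  rw [aPoly, eval_prod, Finset.prod_eq_zero_iff] at h
  obtain ⟨j, -, hj⟩ := h
  exact ⟨j, by simpa [sub_eq_zero] using hj⟩

/-- The value `∏_{i ≠ j} (x - λ_i)`. -/
def erasedProd {N : ℕ} (lam : Fin N → ℝ) (j : Fin N) (x : ℂ) : ℂ :=
  ∏ i ∈ Finset.univ.erase j, (x - lam i)

lemma erasedProd_mul {N : ℕ} (lam : Fin N → ℝ) (j : Fin N) (x : ℂ) :
    (x - lam j) * erasedProd lam j x = (aPoly lam).eval x := by
  rw [aPoly, eval_prod, erasedProd]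
  simp only [eval_sub, eval_X, eval_C]
  exact Finset.mul_prod_erase _ (fun i => x - (lam i : ℂ)) (Finset.mem_univ j)

lemma erasedProd_node_ne_zero {N : ℕ} {lam : Fin N → ℝ} (hlam : Function.Injective lam)
    (j : Fin N) : erasedProd lam j (lam j) ≠ 0 := by
  refine Finset.prod_ne_zero_iff.2 fun i hi => sub_ne_zero.2 ?_
  exact_mod_cast fun e => (Finset.ne_of_mem_erase hi) (hlam e).symm

lemma erasedProd_of_ne {N : ℕ} {lam : Fin N → ℝ} {i j : Fin N} (h : i ≠ j) :
    erasedProd lam j (lam i) = 0 :=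
  Finset.prod_eq_zero (Finset.mem_erase.2 ⟨h, Finset.mem_univ i⟩) (sub_self _)

lemma nodeSum_eval {N : ℕ} (lam : Fin N → ℝ) (u : Fin N → ℂ) (x : ℂ) :
    (nodeSum lam u).eval x = ∑ j, u j * erasedProd lam j x := by
  simp [nodeSum, eval_finsetSum, eval_prod, erasedProd]

lemma nodeSum_eval_node {N : ℕ} (lam : Fin N → ℝ) (u : Fin N → ℂ) (j : Fin N) :
    (nodeSum lam u).eval (lam j : ℂ) = u j * erasedProd lam j (lam j) := by
  rw [nodeSum_eval, Finset.sum_eq_single j]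
  · intro i _ hi; rw [erasedProd_of_ne hi.symm, mul_zero]
  · simp

lemma nodeSum_eval_eq_mul {N : ℕ} {lam : Fin N → ℝ} (u : Fin N → ℂ) {x : ℂ}
    (hx : ∀ j, x ≠ lam j) :
    (nodeSum lam u).eval x = (aPoly lam).eval x * ∑ j, u j * (x - lam j)⁻¹ := by
  rw [nodeSum_eval, Finset.mul_sum]
  refine Finset.sum_congr rfl fun j _ => ?_
  rw [← erasedProd_mul lam j]
  field_simp [sub_ne_zero.2 (hx j)]

lemma natDegree_erased {N : ℕ} (lam : Fin N → ℝ) (j : Fin N) :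
    (∏ i ∈ Finset.univ.erase j, (X - C (lam i : ℂ))).natDegree = N - 1 := by
  rw [natDegree_prod_of_monic _ _ fun _ _ => monic_X_sub_C _]
  simp [Finset.card_erase_of_mem]

lemma natDegree_nodeSum_le {N : ℕ} (lam : Fin N → ℝ) (u : Fin N → ℂ) :
    (nodeSum lam u).natDegree ≤ N - 1 :=
  natDegree_sum_le_of_forall_le _ _ fun j _ =>
    (natDegree_C_mul_le _ _).trans (natDegree_erased lam j).le

lemma nodeSum_coeff {N : ℕ} (lam : Fin N → ℝ) (u : Fin N → ℂ) :
    (nodeSum lam u).coeff (N - 1) = ∑ j, u j := by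
  rw [nodeSum, finsetSum_coeff]
  refine Finset.sum_congr rfl fun j _ => ?_
  have hm : (∏ i ∈ Finset.univ.erase j, (X - C (lam i : ℂ))).Monic :=
    monic_prod_of_monic _ _ fun _ _ => monic_X_sub_C _
  have := hm.coeff_natDegree
  rw [natDegree_erased] at this
  rw [coeff_C_mul, this, mul_one]

lemma aPoly_dvd {N : ℕ} {lam : Fin N → ℝ} (hlam : Function.Injective lam) {P : ℂ[X]}
    (h : ∀ j, P.eval (lam j : ℂ) = 0) : aPoly lam ∣ P := by
  refine Finset.prod_dvd_of_coprime ?_ fun j _ => dvd_iff_isRoot.2 (h j)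
  intro i _ j _ hij
  exact pairwise_coprime_X_sub_C (s := fun k => (lam k : ℂ))
    (fun i j e => hlam (Complex.ofReal_injective e)) hij

lemma infinite_off_nodes {N : ℕ} (lam : Fin N → ℝ) : {x : ℂ | ∀ j, x ≠ lam j}.Infinite := by
  have : {x : ℂ | ∀ j, x ≠ lam j} = (Set.range fun j => (lam j : ℂ))ᶜ := by
    ext x; simp [eq_comm]
  rw [this]
  exact (Set.finite_range _).infinite_compl

/-- Allows polynomial identities to be checked where the resolvents 1 / (x - λ_j) make sense. -/
lemma polynomial_eq_of_eval_off_nodes {N : ℕ} (lam : Fin N → ℝ) {P Q : ℂ[X]}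
    (h : ∀ x : ℂ, (∀ j, x ≠ lam j) → P.eval x = Q.eval x) : P = Q :=
  eq_of_infinite_eval_eq P Q ((infinite_off_nodes lam).mono fun x hx => h x hx)

lemma hasDerivAt_eval_nodeSum {N : ℕ} (lam : Fin N → ℝ) {u : ℝ → Fin N → ℂ} {u' : Fin N → ℂ}
    {x : ℝ → ℂ} {x' : ℂ} {t : ℝ} (hu : ∀ j, HasDerivAt (fun s => u s j) (u' j) t)
    (hx : HasDerivAt x x' t) :
    HasDerivAt (fun s => (nodeSum lam (u s)).eval (x s))
      ((nodeSum lam u').eval (x t) + (derivative (nodeSum lam (u t))).eval (x t) * x') t := by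
  have h : ∀ j, HasDerivAt (fun s => (C (u s j) * ∏ i ∈ Finset.univ.erase j,
      (X - C (lam i : ℂ))).eval (x s)) _ t := fun j => by
    simp only [eval_mul, eval_C]
    exact (hu j).fun_mul
      ((Polynomial.hasDerivAt (∏ i ∈ Finset.univ.erase j, (X - C (lam i : ℂ))) (x t)).comp_of_eq
        t hx rfl)
  have h2 := HasDerivAt.fun_sum (u := Finset.univ) fun j _ => h j
  simp only [nodeSum, eval_finsetSum, derivative_sum]
  refine h2.congr_deriv ?_
  rw [Finset.sum_mul, ← Finset.sum_add_distrib]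
  refine Finset.sum_congr rfl fun j _ => ?_
  simp only [eval_mul, eval_C, derivative_C_mul]
  ring

/-! ### Velocities of the entries of the Lax matrix -/

/-- The `p`-component of the Dirac vector field of `uhlenbeck lam c`. -/
def velP {N : ℕ} (lam c : Fin N → ℝ) (z : Phase N) (j : Fin N) : ℝ :=
  ∑ b, divDiff lam c j b * angMom z j b * z.1 b

/-- The `q`-component of the Dirac vector field of `uhlenbeck lam c`. -/
def velQ {N : ℕ} (lam c : Fin N → ℝ) (z : Phase N) (j : Fin N) : ℝ :=
  -(c j * z.1 j) + (∑ a, c a * (z.1 a * z.1 a)) * z.1 j +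
    ∑ b, divDiff lam c j b * angMom z j b * z.2 b

/-- `a(λ) Q_λ(c x, y)`. -/
def weighted {N : ℕ} (lam c x y : Fin N → ℝ) : ℂ[X] :=
  nodeSum lam fun j => ((c j * (x j * y j) : ℝ) : ℂ)

/-- Symmetrize in (j, b). The factor in front of 1/(x - λ_j) is antisymmetric, so the difference of
the two resolvents appears, and the resolvent identity produces λ_j - λ_b, which cancels the
denominator of the divided difference. The symmetric function s will be a bilinear expression in p
and q. -/
lemma sum_divDiff_resolvent {N : ℕ} {lam : Fin N → ℝ} (hlam : Function.Injective lam)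
    (c : Fin N → ℝ) (z : Phase N) {s : Fin N → Fin N → ℝ} (hs : ∀ a b, s a b = s b a) {x : ℂ}
    (hx : ∀ j, x ≠ lam j) :
    ∑ j, ((∑ b, divDiff lam c j b * angMom z j b * s j b : ℝ) : ℂ) * (x - lam j)⁻¹ =
      ∑ j, ∑ b, ((c b * (angMom z j b * s j b) : ℝ) : ℂ) * ((x - lam j)⁻¹ * (x - lam b)⁻¹) := by
  set r : Fin N → ℂ := fun j => (x - lam j)⁻¹ with hr
  set f : Fin N → Fin N → ℂ := fun j b => ((divDiff lam c j b * angMom z j b * s j b : ℝ) : ℂ)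
    with hf
  set g : Fin N → Fin N → ℂ := fun j b => ((c b * (angMom z j b * s j b) : ℝ) : ℂ) * (r j * r b)
    with hg
  have hrr : ∀ j b, r j - r b = (lam j - lam b) * (r j * r b) := by
    intro j b
    have := sub_ne_zero.2 (hx j); have := sub_ne_zero.2 (hx b)
    simp only [hr]; field_simp; ring
  have key : ∀ j b, f j b * r j + f b j * r b = g j b + g b j := by
    intro j b
    have h1 : f b j = -f j b := by
      simp only [hf]; rw [divDiff_symm, angMom_symm, hs b j]; push_cast; ring
    have h2 : ((divDiff lam c j b : ℝ) : ℂ) * (lam b - lam j) = c j - c b := by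
      exact_mod_cast divDiff_mul hlam c j b
    calc f j b * r j + f b j * r b = f j b * (r j - r b) := by rw [h1]; ring
      _ = -(((divDiff lam c j b : ℝ) : ℂ) * (lam b - lam j)) *
          ((angMom z j b * s j b : ℝ) : ℂ) * (r j * r b) := by
        rw [hrr]; simp only [hf]; push_cast; ring
      _ = g j b + g b j := by
        rw [h2]; simp only [hg]; rw [angMom_symm z j b, hs b j]; push_cast; ring
  have e : ∀ F : Fin N → Fin N → ℂ, ∑ j, ∑ b, (F j b + F b j) = 2 * ∑ j, ∑ b, F j b := by
    intro F
    simp only [Finset.sum_add_distrib]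
    rw [two_mul, Finset.sum_comm (f := fun j b => F b j)]
  have h2 : 2 * ∑ j, ∑ b, f j b * r j = 2 * ∑ j, ∑ b, g j b := by
    rw [← e, ← e]
    exact Finset.sum_congr rfl fun j _ => Finset.sum_congr rfl fun b _ => key j b
  have h3 := mul_left_cancel₀ two_ne_zero h2
  rw [← h3]
  refine Finset.sum_congr rfl fun j _ => ?_
  rw [← Finset.sum_mul, hf]; push_cast; rfl

/-- `a(λ) (1 + Q_λ(q, q))`. -/
def nPoly {N : ℕ} (lam : Fin N → ℝ) (z : Phase N) : ℂ[X] := aPoly lam + aQ lam z.2 z.2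

/-- The velocity of `a(λ) Q_λ(p, p)`. -/
def velPP {N : ℕ} (lam c : Fin N → ℝ) (z : Phase N) : ℂ[X] :=
  nodeSum lam fun j => ((velP lam c z j * z.1 j + z.1 j * velP lam c z j : ℝ) : ℂ)

/-- The velocity of `a(λ) Q_λ(p, q)`. -/
def velPQ {N : ℕ} (lam c : Fin N → ℝ) (z : Phase N) : ℂ[X] :=
  nodeSum lam fun j => ((velP lam c z j * z.2 j + z.1 j * velQ lam c z j : ℝ) : ℂ)

/-- The velocity of `a(λ) Q_λ(q, q)`. -/
def velQQ {N : ℕ} (lam c : Fin N → ℝ) (z : Phase N) : ℂ[X] :=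
  nodeSum lam fun j => ((velQ lam c z j * z.2 j + z.2 j * velQ lam c z j : ℝ) : ℂ)

/-- `⟨diag(c) p, p⟩`. -/
def weightSum {N : ℕ} (c : Fin N → ℝ) (z : Phase N) : ℝ := ∑ a, c a * (z.1 a * z.1 a)

/-- The three identities for `velPP`, `velPQ`, `velQQ` are the entries of the Lax equation,
multiplied by a² to clear denominators. Each one is the preceding resolvent identity with s chosen
as the matching symmetric product. -/
lemma aPoly_mul_velPP {N : ℕ} {lam : Fin N → ℝ} (hlam : Function.Injective lam)
    (c : Fin N → ℝ) (z : Phase N) :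
    aPoly lam * velPP lam c z = 2 * (aQ lam z.1 z.1 * weighted lam c z.1 z.2 -
      aQ lam z.1 z.2 * weighted lam c z.1 z.1) := by
  refine polynomial_eq_of_eval_off_nodes lam fun x hx => ?_
  have h := sum_divDiff_resolvent hlam c z (s := fun a b => 2 * (z.1 a * z.1 b))
    (fun a b => by ring) hx
  have e1 : ∀ j, ((velP lam c z j * z.1 j + z.1 j * velP lam c z j : ℝ) : ℂ) =
      ((∑ b, divDiff lam c j b * angMom z j b * (2 * (z.1 j * z.1 b)) : ℝ) : ℂ) := by
    intro j
    congr 1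
    rw [velP, Finset.sum_mul, Finset.mul_sum, ← Finset.sum_add_distrib]
    exact Finset.sum_congr rfl fun b _ => by ring
  simp only [eval_mul, eval_sub, velPP, aQ_eq_nodeSum, weighted, nodeSum_eval_eq_mul _ hx, e1, h,
    eval_ofNat]
  rw [show ∀ a s t u v w : ℂ, 2 * (a * s * (a * t) - a * u * (a * v)) =
    a * (a * (2 * (s * t - u * v))) from fun _ _ _ _ _ _ => by ring]
  · congr 2
    simp only [Finset.sum_mul_sum]
    simp only [← Finset.sum_sub_distrib, Finset.mul_sum]
    refine Finset.sum_congr rfl fun j _ => Finset.sum_congr rfl fun b _ => ?_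
    unfold angMom; push_cast; ring
  -- The variable w quantified in the rewriting identity occurs on neither side of it, so its value
  -- is arbitrary.
  · exact 0

/-- Besides the resolvent sum there are the potential term -c_j p_j and the constraint force. The
former supplies the summand a in n, the latter the multiple `weightSum` of a. -/
lemma aPoly_mul_velPQ {N : ℕ} {lam : Fin N → ℝ} (hlam : Function.Injective lam)
    (c : Fin N → ℝ) (z : Phase N) :
    aPoly lam * velPQ lam c z =
      aQ lam z.1 z.1 * (weighted lam c z.2 z.2 + C (weightSum c z : ℂ) * aPoly lam) -
        weighted lam c z.1 z.1 * nPoly lam z := by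
  refine polynomial_eq_of_eval_off_nodes lam fun x hx => ?_
  have h := sum_divDiff_resolvent hlam c z (s := fun a b => z.1 b * z.2 a + z.1 a * z.2 b)
    (fun a b => by ring) hx
  have e1 : ∀ j, ((velP lam c z j * z.2 j + z.1 j * velQ lam c z j : ℝ) : ℂ) =
      ((∑ b, divDiff lam c j b * angMom z j b * (z.1 b * z.2 j + z.1 j * z.2 b) : ℝ) : ℂ) +
      (weightSum c z * ((z.1 j * z.1 j : ℝ) : ℂ) - ((c j * (z.1 j * z.1 j) : ℝ) : ℂ)) := by
    intro j
    rw [← Complex.ofReal_mul, ← Complex.ofReal_sub, ← Complex.ofReal_add]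
    congr 1
    have : ∑ b, divDiff lam c j b * angMom z j b * (z.1 b * z.2 j + z.1 j * z.2 b) =
        (∑ b, divDiff lam c j b * angMom z j b * z.1 b) * z.2 j +
          z.1 j * ∑ b, divDiff lam c j b * angMom z j b * z.2 b := by
      rw [Finset.mul_sum, Finset.sum_mul, ← Finset.sum_add_distrib]
      exact Finset.sum_congr rfl fun b _ => by ring
    rw [this, velP, velQ, weightSum]; ring
  simp only [eval_mul, eval_sub, eval_add, eval_C, velPQ, nPoly, aQ_eq_nodeSum, weighted,
    nodeSum_eval_eq_mul _ hx, e1, add_mul, Finset.sum_add_distrib, h, sub_mul,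
    Finset.sum_sub_distrib]
  simp only [mul_assoc, ← Finset.mul_sum]
  rw [show ∀ a s t u v k : ℂ, a * (s * (a * t + k * a)) - a * (u * (a + a * v)) =
    a * (a * (s * t - v * u + (k * s - u))) from fun _ _ _ _ _ _ => by ring]
  congr 3
  simp only [Finset.sum_mul_sum]
  simp only [← Finset.sum_sub_distrib]
  refine Finset.sum_congr rfl fun j _ => Finset.sum_congr rfl fun b _ => ?_
  unfold angMom; push_cast; ring

lemma aPoly_mul_velQQ {N : ℕ} {lam : Fin N → ℝ} (hlam : Function.Injective lam)
    (c : Fin N → ℝ) (z : Phase N) :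
    aPoly lam * velQQ lam c z =
      2 * (aQ lam z.1 z.2 * (weighted lam c z.2 z.2 + C (weightSum c z : ℂ) * aPoly lam) -
        weighted lam c z.1 z.2 * nPoly lam z) := by
  refine polynomial_eq_of_eval_off_nodes lam fun x hx => ?_
  have h := sum_divDiff_resolvent hlam c z (s := fun a b => 2 * (z.2 a * z.2 b))
    (fun a b => by ring) hx
  have e1 : ∀ j, ((velQ lam c z j * z.2 j + z.2 j * velQ lam c z j : ℝ) : ℂ) =
      ((∑ b, divDiff lam c j b * angMom z j b * (2 * (z.2 j * z.2 b)) : ℝ) : ℂ) +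
      ((2 * weightSum c z) * ((z.1 j * z.2 j : ℝ) : ℂ) -
        2 * ((c j * (z.1 j * z.2 j) : ℝ) : ℂ)) := by
    intro j
    have : ∑ b, divDiff lam c j b * angMom z j b * (2 * (z.2 j * z.2 b)) =
        2 * z.2 j * ∑ b, divDiff lam c j b * angMom z j b * z.2 b := by
      rw [Finset.mul_sum]; exact Finset.sum_congr rfl fun b _ => by ring
    rw [this, velQ, weightSum]; push_cast; ring
  simp only [eval_mul, eval_sub, eval_add, eval_C, eval_ofNat, velQQ, nPoly, aQ_eq_nodeSum,
    weighted, nodeSum_eval_eq_mul _ hx, e1, add_mul, Finset.sum_add_distrib, h, sub_mul,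
    Finset.sum_sub_distrib]
  simp only [mul_assoc, ← Finset.mul_sum]
  rw [show ∀ a s t u v k : ℂ, 2 * (a * (s * (a * t + k * a)) - a * (u * (a + a * v))) =
    a * (a * (2 * (s * t - v * u) + (2 * (k * s) - 2 * u))) from fun _ _ _ _ _ _ => by ring]
  congr 3
  simp only [Finset.sum_mul_sum]
  simp only [← Finset.sum_sub_distrib, Finset.mul_sum]
  refine Finset.sum_congr rfl fun j _ => Finset.sum_congr rfl fun b _ => ?_
  unfold angMom; push_cast; ring

lemma spectralPoly_eq {N : ℕ} (lam : Fin N → ℝ) (z : Phase N) :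
    spectralPoly lam z = aQ lam z.1 z.1 * nPoly lam z - aQ lam z.1 z.2 * aQ lam z.1 z.2 := by
  rw [spectralPoly, laxMatrix, Matrix.det_fin_two_of, nPoly]; ring

lemma mPoly_eq {N : ℕ} (lam : Fin N → ℝ) (z : Phase N) : mPoly lam z = aQ lam z.1 z.1 := rfl

/-- The velocity of the spectral polynomial vanishes. -/
lemma isospectral {N : ℕ} {lam : Fin N → ℝ} (hlam : Function.Injective lam)
    (c : Fin N → ℝ) (z : Phase N) :
    velPP lam c z * nPoly lam z + aQ lam z.1 z.1 * velQQ lam c z -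
      (velPQ lam c z * aQ lam z.1 z.2 + aQ lam z.1 z.2 * velPQ lam c z) = 0 := by
  -- After multiplication by a, the three Lax identities cancel identically.
  apply mul_left_cancel₀ (aPoly_monic lam).ne_zero
  linear_combination nPoly lam z * aPoly_mul_velPP hlam c z +
    aQ lam z.1 z.1 * aPoly_mul_velQQ hlam c z - 2 * aQ lam z.1 z.2 * aPoly_mul_velPQ hlam c z

/-! ### Simplicity of the elliptic variables -/

lemma sum_sq_eq_one {N : ℕ} {z : Phase N} (hz : z ∈ TSphere N) : ∑ j, z.1 j * z.1 j = 1 := by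
  have := hz.2; unfold casG at this; linarith

lemma mPoly_monic {N : ℕ} (lam : Fin N → ℝ) {z : Phase N} (hz : z ∈ TSphere N) :
    (mPoly lam z).Monic := by
  refine monic_of_natDegree_le_of_coeff_eq_one (N - 1) (natDegree_nodeSum_le _ _) ?_
  refine (nodeSum_coeff _ _).trans ?_
  exact_mod_cast sum_sq_eq_one hz

lemma natDegree_mPoly {N : ℕ} (lam : Fin N → ℝ) {z : Phase N} (hz : z ∈ TSphere N) :
    (mPoly lam z).natDegree = N - 1 := by
  refine natDegree_eq_of_le_of_coeff_ne_zero (natDegree_nodeSum_le _ _) ?_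
  refine ne_of_eq_of_ne ((nodeSum_coeff _ _).trans ?_) one_ne_zero
  exact_mod_cast sum_sq_eq_one hz

/-- The Bezoutian of m and a. For y the conjugate of x and nonnegative real u the sum on the right
is a sum of nonnegative terms. -/
lemma nodeSum_wronskian {N : ℕ} (lam : Fin N → ℝ) (u : Fin N → ℂ) (x y : ℂ) :
    (nodeSum lam u).eval x * (aPoly lam).eval y - (nodeSum lam u).eval y * (aPoly lam).eval x =
      (y - x) * ∑ j, u j * (erasedProd lam j x * erasedProd lam j y) := by
  simp only [nodeSum_eval, Finset.sum_mul, Finset.mul_sum, ← Finset.sum_sub_distrib]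
  refine Finset.sum_congr rfl fun j _ => ?_
  rw [← erasedProd_mul lam j x, ← erasedProd_mul lam j y]; ring

/-- The confluent case y → x of the preceding identity, needed at real points. -/
lemma derivative_nodeSum_wronskian {N : ℕ} (lam : Fin N → ℝ) (u : Fin N → ℂ) (x : ℂ) :
    (nodeSum lam u).eval x * (derivative (aPoly lam)).eval x -
      (derivative (nodeSum lam u)).eval x * (aPoly lam).eval x =
      ∑ j, u j * (erasedProd lam j x * erasedProd lam j x) := by
  have key : ∀ j : Fin N, erasedProd lam j x * (derivative (aPoly lam)).eval x -
      (derivative (∏ i ∈ Finset.univ.erase j, (X - C (lam i : ℂ)))).eval x * (aPoly lam).eval x =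
      erasedProd lam j x * erasedProd lam j x := by
    intro j
    have h : aPoly lam = (X - C (lam j : ℂ)) * ∏ i ∈ Finset.univ.erase j, (X - C (lam i : ℂ)) :=
      (Finset.mul_prod_erase _ _ (Finset.mem_univ j)).symm
    have h2 : (∏ i ∈ Finset.univ.erase j, (X - C (lam i : ℂ))).eval x = erasedProd lam j x := by
      simp [eval_prod, erasedProd]
    rw [h, derivative_mul]
    simp [h2]; ring
  rw [nodeSum_eval, Finset.sum_mul]
  simp only [nodeSum, derivative_sum, eval_finsetSum, Finset.sum_mul, ← Finset.sum_sub_distrib]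
  refine Finset.sum_congr rfl fun j _ => ?_
  rw [← key j]; simp; ring

lemma conj_erasedProd {N : ℕ} (lam : Fin N → ℝ) (j : Fin N) (x : ℂ) :
    erasedProd lam j (starRingEnd ℂ x) = starRingEnd ℂ (erasedProd lam j x) := by
  simp [erasedProd, map_prod]

lemma conj_aQ_eval {N : ℕ} (lam x y : Fin N → ℝ) (l : ℂ) :
    (aQ lam x y).eval (starRingEnd ℂ l) = starRingEnd ℂ ((aQ lam x y).eval l) := by
  simp [aQ_eq_nodeSum, nodeSum_eval, conj_erasedProd]

lemma sum_sq_erasedProd_eq_zero {N : ℕ} {lam : Fin N → ℝ} {z : Phase N} (hz : z ∈ TSphere N)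
    {μ : ℂ} (h : ∑ j, ((z.1 j * z.1 j : ℝ) : ℂ) *
      (erasedProd lam j μ * starRingEnd ℂ (erasedProd lam j μ)) = 0) :
    ∃ j, μ = lam j := by
  have h' : ∑ j, z.1 j * z.1 j * Complex.normSq (erasedProd lam j μ) = 0 := by
    rw [← Complex.ofReal_eq_zero, ← h]
    push_cast
    exact Finset.sum_congr rfl fun j _ => by rw [Complex.mul_conj]
  rw [Finset.sum_eq_zero_iff_of_nonneg fun j _ =>
    mul_nonneg (mul_self_nonneg _) (Complex.normSq_nonneg _)] at h'
  obtain ⟨j, hj⟩ : ∃ j, z.1 j ≠ 0 := by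
    by_contra hcon
    push Not at hcon
    have := sum_sq_eq_one hz
    simp [hcon] at this
  have h2 : erasedProd lam j μ = 0 := by simpa [hj] using h' j (Finset.mem_univ j)
  exact aPoly_eval_eq_zero (by rw [← erasedProd_mul lam j, h2, mul_zero])

/-- The value at a node is p_j² times a nonzero factor, so p_j = 0, and then every entry containing
p vanishes there. -/
lemma aQ_eval_node_eq_zero {N : ℕ} {lam : Fin N → ℝ} (hlam : Function.Injective lam)
    {z : Phase N} {j : Fin N} (h : (aQ lam z.1 z.1).eval (lam j : ℂ) = 0) :
    (aQ lam z.1 z.2).eval (lam j : ℂ) = 0 := by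
  rw [aQ_eq_nodeSum, nodeSum_eval_node] at h ⊢
  have : z.1 j = 0 := by simpa [erasedProd_node_ne_zero hlam j] using h
  simp [this]

/-- A nonreal root, or a real double root, makes ∑ p_j² |∏_{i≠j}(μ - λ_i)|² vanish, by the Bezoutian
or its confluent form. As p ≠ 0, such a μ is a node. At a node where m vanishes b vanishes too, so a
double root of m would be a double root of mn - b², against squarefreeness. -/
lemma derivative_mPoly_eval_ne_zero {N : ℕ} {lam : Fin N → ℝ} (hlam : Function.Injective lam)
    {z : Phase N} (hz : z ∈ TSphere N) (hR : Squarefree (spectralPoly lam z)) {μ : ℂ}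
    (hμ : (mPoly lam z).eval μ = 0) : (derivative (mPoly lam z)).eval μ ≠ 0 := by
  rw [mPoly_eq] at *
  intro hd
  have hnode : ∃ j, μ = lam j := by
    have h1 := nodeSum_wronskian lam (fun j => ((z.1 j * z.1 j : ℝ) : ℂ)) μ (starRingEnd ℂ μ)
    rw [← aQ_eq_nodeSum, conj_aQ_eval, hμ, map_zero, zero_mul, zero_mul, sub_zero, eq_comm,
      mul_eq_zero] at h1
    simp only [conj_erasedProd] at h1
    rcases h1 with h1 | h1
    · have h2 := derivative_nodeSum_wronskian lam (fun j => ((z.1 j * z.1 j : ℝ) : ℂ)) μ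
      rw [← aQ_eq_nodeSum, hμ, hd, zero_mul, zero_mul, sub_zero] at h2
      refine sum_sq_erasedProd_eq_zero (lam := lam) hz (μ := μ) ?_
      rw [h2]
      exact Finset.sum_congr rfl fun j _ => by rw [← conj_erasedProd, sub_eq_zero.1 h1]
    · exact sum_sq_erasedProd_eq_zero hz h1
  obtain ⟨j, rfl⟩ := hnode
  have hb := aQ_eval_node_eq_zero hlam hμ
  have d1 : (X - C (lam j : ℂ)) * (X - C (lam j : ℂ)) ∣ aQ lam z.1 z.1 := by
    obtain ⟨P, hP⟩ := dvd_iff_isRoot.2 hμ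
    rw [hP] at hd ⊢
    refine mul_dvd_mul_left _ (dvd_iff_isRoot.2 ?_)
    simpa [derivative_mul] using hd
  have d2 := mul_dvd_mul (dvd_iff_isRoot.2 hb) (dvd_iff_isRoot.2 hb)
  have := hR _ (spectralPoly_eq lam z ▸ dvd_sub (dvd_mul_of_dvd_left d1 _) d2)
  exact not_isUnit_X_sub_C _ this

/-! ### The residue sum -/

/-- `∑_j c_j λ_j^e / a'(λ_j)`. -/
def residueSum {N : ℕ} (lam : Fin N → ℝ) (c : Fin N → ℂ) (e : ℕ) : ℂ :=
  ∑ j, c j * (lam j : ℂ) ^ e / erasedProd lam j (lam j)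

/-- The polynomial of degree less than `N` with value `c_j λ_j^e` at `λ_j`. -/
def nodeInterp {N : ℕ} (lam : Fin N → ℝ) (c : Fin N → ℝ) (e : ℕ) : ℂ[X] :=
  Lagrange.interpolate Finset.univ (fun j => (lam j : ℂ)) fun j => (c j : ℂ) * (lam j : ℂ) ^ e

lemma nodes_injOn {N : ℕ} {lam : Fin N → ℝ} (hlam : Function.Injective lam) :
    Set.InjOn (fun j => (lam j : ℂ)) (Finset.univ : Finset (Fin N)) :=
  fun _ _ _ _ e => hlam (Complex.ofReal_injective e)

lemma nodeInterp_eval {N : ℕ} {lam : Fin N → ℝ} (hlam : Function.Injective lam)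
    (c : Fin N → ℝ) (e : ℕ) (j : Fin N) :
    (nodeInterp lam c e).eval (lam j : ℂ) = c j * (lam j : ℂ) ^ e :=
  Lagrange.eval_interpolate_at_node _ (nodes_injOn hlam) (Finset.mem_univ j)

lemma degree_nodeInterp_lt {N : ℕ} {lam : Fin N → ℝ} (hlam : Function.Injective lam)
    (c : Fin N → ℝ) (e : ℕ) : (nodeInterp lam c e).degree < N :=
  (Lagrange.degree_interpolate_lt _ (nodes_injOn hlam)).trans_eq (by simp)

lemma natDegree_nodeInterp_le {N : ℕ} {lam : Fin N → ℝ} (hlam : Function.Injective lam)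
    (c : Fin N → ℝ) (e : ℕ) : (nodeInterp lam c e).natDegree ≤ N - 1 :=
  natDegree_le_of_degree_le ((Lagrange.degree_interpolate_le _ (nodes_injOn hlam)).trans
    (by simp))

/-- Leading coefficient of Lagrange interpolation: the residues of P / a at the nodes add up to
minus the residue at infinity. -/
lemma coeff_eq_residueSum {N : ℕ} {lam : Fin N → ℝ} (hlam : Function.Injective lam) {P : ℂ[X]}
    (hP : P.degree < N) :
    P.coeff (N - 1) = ∑ j, P.eval (lam j : ℂ) / erasedProd lam j (lam j) := by
  have := Lagrange.coeff_eq_sum (nodes_injOn hlam) (P := P) (by simpa using hP)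
  simpa [erasedProd] using this

lemma nodeInterp_coeff {N : ℕ} {lam : Fin N → ℝ} (hlam : Function.Injective lam)
    (c : Fin N → ℝ) (e : ℕ) :
    (nodeInterp lam c e).coeff (N - 1) = residueSum lam (fun j => (c j : ℂ)) e := by
  rw [coeff_eq_residueSum hlam (degree_nodeInterp_lt hlam c e), residueSum]
  simp only [nodeInterp_eval hlam]

/-- At λ_j both products equal c_j λ_j^e x_j y_j times the erased product, so a divides their
difference. -/
lemma exists_weighted_quotient {N : ℕ} {lam : Fin N → ℝ} (hlam : Function.Injective lam)
    (c : Fin N → ℝ) (x y : Fin N → ℝ) (e : ℕ) : ∃ Y : ℂ[X],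
      X ^ e * weighted lam c x y = nodeInterp lam c e * aQ lam x y + aPoly lam * Y := by
  obtain ⟨Y, hY⟩ := aPoly_dvd hlam
    (P := X ^ e * weighted lam c x y - nodeInterp lam c e * aQ lam x y) fun j => by
      simp only [eval_sub, eval_mul, eval_pow, eval_X, weighted, aQ_eq_nodeSum,
        nodeSum_eval_node, nodeInterp_eval hlam]
      push_cast; ring
  exact ⟨Y, by rw [← hY]; ring⟩

/-- The same interpolation formula with the simple roots of m as nodes. -/
lemma sum_roots_div_derivative {m : ℂ[X]} (hm : m.Monic)
    (hs : ∀ μ, m.eval μ = 0 → (derivative m).eval μ ≠ 0) {P : ℂ[X]}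
    (hP : P.degree < m.natDegree) :
    (m.roots.map fun μ => P.eval μ / (derivative m).eval μ).sum = P.coeff (m.natDegree - 1) := by
  classical
  have hnd : m.roots.Nodup := by
    rw [Multiset.nodup_iff_count_le_one]
    intro μ
    rw [count_roots]
    by_contra hcon
    push Not at hcon
    have h0 := (one_lt_rootMultiplicity_iff_isRoot hm.ne_zero).1 hcon
    exact hs μ h0.1 h0.2
  have hcard : m.roots.toFinset.card = m.natDegree := by
    rw [Multiset.toFinset_card_of_nodup hnd]
    exact (IsAlgClosed.splits m).natDegree_eq_card_roots.symm
  have hnodal : m = Lagrange.nodal m.roots.toFinset id := by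
    rw [Lagrange.nodal, Finset.prod_eq_multiset_prod, Multiset.toFinset_val, hnd.dedup]
    exact (IsAlgClosed.splits m).eq_prod_roots_of_monic hm
  have h1 := Lagrange.coeff_eq_sum (s := m.roots.toFinset) (v := id) (Set.injOn_id _) (P := P)
    (by rw [hcard]; exact hP)
  rw [hcard] at h1
  rw [h1, Finset.sum_eq_multiset_sum, Multiset.toFinset_val, hnd.dedup]
  refine congrArg Multiset.sum (Multiset.map_congr rfl fun μ hμ => ?_)
  have h2 : (derivative m).eval μ = ∏ j ∈ m.roots.toFinset.erase μ, (μ - j) := by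
    conv_lhs => rw [hnodal]
    have := Lagrange.eval_nodal_derivative_eval_node_eq (s := m.roots.toFinset) (v := id)
      (i := μ) (by simpa using hμ)
    rw [id] at this
    rw [this, Lagrange.eval_nodal]; rfl
  rw [h2]; rfl

/-- This sum governs the velocity on the Jacobian. The polynomial X^e Y may have too large a degree
for interpolation. It is replaced by the quotient Z belonging to the weights c_j λ_j^e, which agrees
with it at the roots of m and has degree at most N - 2. -/
lemma sum_roots_quotient {N : ℕ} {lam : Fin N → ℝ} (hlam : Function.Injective lam)
    (c : Fin N → ℝ) {z : Phase N} (hz : z ∈ TSphere N) (hR : Squarefree (spectralPoly lam z))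
    {Y : ℂ[X]} (hY : weighted lam c z.1 z.1 =
      nodeInterp lam c 0 * aQ lam z.1 z.1 + aPoly lam * Y) {e : ℕ} (he : e < N - 1) :
    ((mPoly lam z).roots.map fun μ => μ ^ e * Y.eval μ / (derivative (mPoly lam z)).eval μ).sum =
      -residueSum lam (fun j => (c j : ℂ)) e := by
  obtain ⟨Z, hZ⟩ := exists_weighted_quotient hlam c z.1 z.1 e
  have hroot : ∀ μ, (mPoly lam z).eval μ = 0 → Z.eval μ = μ ^ e * Y.eval μ := by
    -- Both interpolants take the value c_j λ_j^e at the nodes. Hence Z and X^e Y differ by a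
    -- multiple of m.
    obtain ⟨S, hS⟩ := aPoly_dvd hlam (P := X ^ e * nodeInterp lam c 0 - nodeInterp lam c e)
      fun j => by
        simp only [eval_sub, eval_mul, eval_pow, eval_X, nodeInterp_eval hlam]; ring
    have : Z = X ^ e * Y + S * mPoly lam z := by
      apply mul_left_cancel₀ (aPoly_monic lam).ne_zero
      rw [mPoly_eq]
      linear_combination X ^ e * hY - hZ + aQ lam z.1 z.1 * hS
    intro μ hμ
    rw [this]; simp [hμ]
  have hdeg : Z.natDegree ≤ N - 2 := by
    by_cases hZ0 : Z = 0
    · simp [hZ0]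
    have h1 : (aPoly lam * Z).natDegree = N + Z.natDegree := by
      rw [(aPoly_monic lam).natDegree_mul' hZ0, natDegree_aPoly]
    have h2 : (aPoly lam * Z).natDegree ≤ 2 * N - 2 := by
      have : aPoly lam * Z = X ^ e * weighted lam c z.1 z.1 -
        nodeInterp lam c e * aQ lam z.1 z.1 := by rw [hZ]; ring
      rw [this]
      refine (natDegree_sub_le _ _).trans (max_le ?_ ?_)
      · have := natDegree_nodeSum_le lam fun j => ((c j * (z.1 j * z.1 j) : ℝ) : ℂ)
        refine natDegree_mul_le.trans ?_
        rw [natDegree_X_pow]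
        unfold weighted; lia
      · have h3 := natDegree_nodeSum_le lam fun j => ((z.1 j * z.1 j : ℝ) : ℂ)
        have h4 := natDegree_nodeInterp_le hlam c e
        refine natDegree_mul_le.trans ?_
        rw [aQ_eq_nodeSum]; lia
    lia
  -- Compare coefficients of degree 2N - 2: the product X^e a Q(cp,p) does not reach it since e < N
  -- - 1, and the leading coefficient of m is ⟨p,p⟩ = 1.
  have hcoeff : Z.coeff (N - 2) = -residueSum lam (fun j => (c j : ℂ)) e := by
    have h1 : (aPoly lam * Z).coeff (N + (N - 2)) = Z.coeff (N - 2) := by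
      rw [coeff_mul_add_eq_of_natDegree_le (natDegree_aPoly lam).le hdeg]
      have := (aPoly_monic lam).coeff_natDegree
      rw [natDegree_aPoly] at this
      rw [this, one_mul]
    have h2 : (X ^ e * weighted lam c z.1 z.1).coeff (N + (N - 2)) = 0 := by
      apply coeff_eq_zero_of_natDegree_lt
      have := natDegree_nodeSum_le lam fun j => ((c j * (z.1 j * z.1 j) : ℝ) : ℂ)
      refine natDegree_mul_le.trans_lt ?_
      rw [natDegree_X_pow]
      unfold weighted; lia
    have h3 : (nodeInterp lam c e * aQ lam z.1 z.1).coeff (N + (N - 2)) =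
        residueSum lam (fun j => (c j : ℂ)) e := by
      have h4 := natDegree_nodeInterp_le hlam c e
      rw [show N + (N - 2) = (N - 1) + (N - 1) by lia, aQ_eq_nodeSum,
        coeff_mul_add_eq_of_natDegree_le h4 (natDegree_nodeSum_le _ _), nodeInterp_coeff hlam,
        nodeSum_coeff]
      have : ∑ j, ((z.1 j * z.1 j : ℝ) : ℂ) = 1 := by exact_mod_cast sum_sq_eq_one hz
      rw [this, mul_one]
    rw [hZ, coeff_add, h3, h1] at h2
    linear_combination h2
  rw [← hcoeff, show N - 2 = (mPoly lam z).natDegree - 1 by rw [natDegree_mPoly lam hz]; lia,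
    ← sum_roots_div_derivative (mPoly_monic lam hz)
      (fun μ hμ => derivative_mPoly_eval_ne_zero hlam hz hR hμ)]
  · refine congrArg Multiset.sum (Multiset.map_congr rfl fun μ hμ => ?_)
    rw [hroot μ (isRoot_of_mem_roots hμ)]
  · rw [natDegree_mPoly lam hz]
    refine lt_of_le_of_lt degree_le_natDegree ?_
    exact_mod_cast (by lia : Z.natDegree < N - 1)

/-- At an elliptic variable `μ` the velocities of the entries of the Lax matrix are governed by
the quotient `Y`. -/
lemma velocities_at_root {N : ℕ} {lam : Fin N → ℝ} (hlam : Function.Injective lam)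
    (c : Fin N → ℝ) (z : Phase N)
    {Y : ℂ[X]} (hY : weighted lam c z.1 z.1 =
      nodeInterp lam c 0 * aQ lam z.1 z.1 + aPoly lam * Y) {μ : ℂ}
    (hμ : (mPoly lam z).eval μ = 0) :
    (velPP lam c z).eval μ = -2 * (aQ lam z.1 z.2).eval μ * Y.eval μ ∧
      (velPQ lam c z).eval μ = -(Y.eval μ * (nPoly lam z).eval μ) := by
  rw [mPoly_eq] at hμ
  obtain ⟨Y₁, h1⟩ := exists_weighted_quotient hlam c z.1 z.2 0
  obtain ⟨Y₂, h2⟩ := exists_weighted_quotient hlam c z.2 z.2 0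
  rw [pow_zero, one_mul] at h1 h2
  constructor
  · have : velPP lam c z = 2 * (aQ lam z.1 z.1 * Y₁ - aQ lam z.1 z.2 * Y) := by
      apply mul_left_cancel₀ (aPoly_monic lam).ne_zero
      linear_combination aPoly_mul_velPP hlam c z + 2 * aQ lam z.1 z.1 * h1 -
        2 * aQ lam z.1 z.2 * hY
    rw [this]; simp [hμ]; ring
  · have : velPQ lam c z = aQ lam z.1 z.1 * (Y₂ + C (weightSum c z : ℂ) - nodeInterp lam c 0) -
        Y * nPoly lam z := by
      apply mul_left_cancel₀ (aPoly_monic lam).ne_zero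
      have hn : nPoly lam z = aPoly lam + aQ lam z.2 z.2 := rfl
      rw [hn]
      linear_combination aPoly_mul_velPQ hlam c z + aQ lam z.1 z.1 * h2 -
        (aPoly lam + aQ lam z.2 z.2) * hY - weighted lam c z.1 z.1 * hn
    rw [this]; simp [hμ]

/-! ### The frequencies as residue sums -/

/-- Partial fractions 1/a = ∑ 1 / (a'(λ_j)(λ - λ_j)), each term expanded as a geometric series at 0.
-/
lemma calA_eq {N : ℕ} {lam : Fin N → ℝ} (hlam : Function.Injective lam)
    (hlam0 : ∀ j, lam j ≠ 0) (hN : 0 < N) (k : ℕ) :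
    calA lam k = -∑ j, (((lam j)⁻¹ ^ (k + 1) : ℝ) : ℂ) / erasedProd lam j (lam j) := by
  set w : Fin N → ℂ := fun j => (erasedProd lam j (lam j))⁻¹ with hw
  -- The partial fraction expansion multiplied by a: the two sides agree at the N nodes and have
  -- degree below N.
  have hone : nodeSum lam w = 1 := by
    have hd : (nodeSum lam w - 1).natDegree < N := by
      refine (natDegree_sub_le _ _).trans_lt ?_
      have := natDegree_nodeSum_le lam w
      rw [natDegree_one]; lia
    obtain ⟨Q, hQ⟩ := aPoly_dvd hlam (P := nodeSum lam w - 1) fun j => by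
      rw [eval_sub, nodeSum_eval_node, hw, inv_mul_cancel₀ (erasedProd_node_ne_zero hlam j)]
      simp
    by_cases hQ0 : Q = 0
    · rw [hQ0, mul_zero] at hQ; exact sub_eq_zero.1 hQ
    · rw [hQ, (aPoly_monic lam).natDegree_mul' hQ0, natDegree_aPoly] at hd
      lia
  have hgeom : ∀ j, ((X - C (lam j : ℂ) : ℂ[X]) : PowerSeries ℂ) *
      PowerSeries.mk (fun k => -(((lam j)⁻¹ ^ (k + 1) : ℝ) : ℂ)) = 1 := by
    intro j
    have hj : (lam j : ℂ) ≠ 0 := by exact_mod_cast hlam0 j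
    ext n
    rw [Polynomial.coe_sub, Polynomial.coe_X, Polynomial.coe_C, sub_mul, map_sub,
      PowerSeries.coeff_C_mul, PowerSeries.coeff_mk]
    cases n with
    | zero =>
      rw [PowerSeries.coeff_zero_X_mul]
      push_cast; simp [hj]
    | succ n =>
      rw [PowerSeries.coeff_succ_X_mul, PowerSeries.coeff_mk, PowerSeries.coeff_one]
      push_cast
      rw [pow_succ _ (n + 1)]
      field_simp; ring
  set S : PowerSeries ℂ := ∑ j, PowerSeries.C (w j) *
    PowerSeries.mk (fun k => -(((lam j)⁻¹ ^ (k + 1) : ℝ) : ℂ)) with hS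
  have hmul : S * (aPoly lam : PowerSeries ℂ) = 1 := by
    rw [hS, Finset.sum_mul]
    have : ((nodeSum lam w : ℂ[X]) : PowerSeries ℂ) = 1 := by rw [hone, Polynomial.coe_one]
    rw [← this, nodeSum, ← Polynomial.coeToPowerSeries.ringHom_apply (φ := ∑ j, _),
      map_sum]
    refine Finset.sum_congr rfl fun j _ => ?_
    have ha : aPoly lam = (X - C (lam j : ℂ)) * ∏ i ∈ Finset.univ.erase j, (X - C (lam i : ℂ)) :=
      (Finset.mul_prod_erase _ _ (Finset.mem_univ j)).symm
    rw [ha, Polynomial.coeToPowerSeries.ringHom_apply, Polynomial.coe_mul, Polynomial.coe_mul,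
      Polynomial.coe_C]
    linear_combination PowerSeries.C (w j) *
      ((∏ i ∈ Finset.univ.erase j, (X - C (lam i : ℂ)) : ℂ[X]) : PowerSeries ℂ) * hgeom j
  have h0 : PowerSeries.constantCoeff (aPoly lam : PowerSeries ℂ) ≠ 0 := by
    intro h
    have := congrArg PowerSeries.constantCoeff hmul
    rw [map_mul, h, mul_zero, map_one] at this
    exact zero_ne_one this
  rw [calA, ← (PowerSeries.eq_inv_iff_mul_eq_one h0).2 hmul, hS, map_sum, ← Finset.sum_neg_distrib]
  refine Finset.sum_congr rfl fun j _ => ?_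
  rw [PowerSeries.coeff_C_mul, PowerSeries.coeff_mk, hw, div_eq_mul_inv]; ring

/-- For e ≤ k the factor λ_j^e only lowers the exponent. For e > k the sum is ∑ λ_j^d / a'(λ_j) with
d = e - k - 1 < N - 1, which vanishes as the coefficient of degree N - 1 of X^d. -/
lemma calA_shift {N : ℕ} {lam : Fin N → ℝ} (hlam : Function.Injective lam)
    (hlam0 : ∀ j, lam j ≠ 0) {e : ℕ} (he : e < N - 1) (k : ℕ) :
    (if e ≤ k then calA lam (k - e) else 0) =
      -residueSum lam (fun j => (((lam j)⁻¹ ^ (k + 1) : ℝ) : ℂ)) e := by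
  have hc : ∀ j, (lam j : ℂ) ≠ 0 := fun j => by exact_mod_cast hlam0 j
  split_ifs with h
  · rw [calA_eq hlam hlam0 (by lia), residueSum]
    congr 1
    refine Finset.sum_congr rfl fun j _ => ?_
    congr 1
    obtain ⟨d, rfl⟩ := Nat.exists_eq_add_of_le h
    have := hc j
    rw [Nat.add_sub_cancel_left]
    push_cast
    rw [show e + d + 1 = (d + 1) + e by ring, pow_add _ (d + 1) e, mul_assoc, ← mul_pow,
      inv_mul_cancel₀ this, one_pow, mul_one]
  · push Not at h
    obtain ⟨d, rfl⟩ := Nat.exists_eq_add_of_lt h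
    have h1 := coeff_eq_residueSum hlam (P := X ^ d) (by
      rw [degree_X_pow]; exact_mod_cast (by lia : d < N))
    rw [coeff_X_pow, if_neg (by lia)] at h1
    rw [eq_comm, neg_eq_zero, residueSum, h1]
    refine Finset.sum_congr rfl fun j _ => ?_
    have := hc j
    congr 1
    rw [eval_pow, eval_X]
    push_cast
    rw [show k + d + 1 = (k + 1) + d by ring, pow_add _ (k + 1) d, ← mul_assoc, ← mul_pow,
      inv_mul_cancel₀ this, one_pow, one_mul]

/-- The velocity of the Abel-Jacobi variable for residue weights `c`. -/
def abelVelocity {R : ℂ[X]} {N : ℕ} {P₀ : Surface R} (lam : Fin N → ℝ)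
    (a : Fin (N - 1) → Path P₀ P₀) (ε : ℂ) (c : Fin N → ℂ) : Fin (N - 1) → ℂ :=
  (normMatrix a).mulVec fun j => ε / 2 * residueSum lam c (N - 2 - (j : ℕ))

lemma neg_smul_Omega {R : ℂ[X]} {N : ℕ} {P₀ : Surface R} {lam : Fin N → ℝ}
    (hlam : Function.Injective lam) (hlam0 : ∀ j, lam j ≠ 0) (a : Fin (N - 1) → Path P₀ P₀)
    (ε : ℂ) (k : ℕ) :
    -ε • Omega lam a k = abelVelocity lam a ε fun j => (((lam j)⁻¹ ^ (k + 1) : ℝ) : ℂ) := by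
  funext i
  simp only [Pi.smul_apply, smul_eq_mul, Omega, abelVelocity, Matrix.mulVec, dotProduct,
    Finset.mul_sum]
  refine Finset.sum_congr rfl fun j _ => ?_
  have := calA_shift hlam hlam0 (e := N - 2 - (j : ℕ)) (by have := j.2; lia) k
  rw [← neg_eq_iff_eq_neg] at this
  rw [← this]
  split_ifs <;> ring

/-- The velocity is ℂ-linear in c, so the flows of the real and imaginary parts recombine. -/
lemma abelVelocity_add_I_smul {R : ℂ[X]} {N : ℕ} {P₀ : Surface R} (lam : Fin N → ℝ)
    (a : Fin (N - 1) → Path P₀ P₀) (ε : ℂ) (c : Fin N → ℂ) :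
    abelVelocity lam a ε (fun j => ((c j).re : ℂ)) +
      Complex.I • abelVelocity lam a ε (fun j => ((c j).im : ℂ)) = abelVelocity lam a ε c := by
  funext i
  simp only [Pi.add_apply, Pi.smul_apply, smul_eq_mul, abelVelocity, Matrix.mulVec, dotProduct,
    Finset.mul_sum, residueSum, ← Finset.sum_add_distrib]
  refine Finset.sum_congr rfl fun j _ => Finset.sum_congr rfl fun b _ => ?_
  conv_rhs => rw [← Complex.re_add_im (c b)]
  ring

lemma hasSum_abelVelocity {R : ℂ[X]} {N : ℕ} {P₀ : Surface R} (lam : Fin N → ℝ)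
    (a : Fin (N - 1) → Path P₀ P₀) (ε : ℂ) {l : ℂ} {c : ℕ → Fin N → ℂ} {c' : Fin N → ℂ}
    (h : ∀ j, HasSum (fun k => l ^ k * c k j) (c' j)) :
    HasSum (fun k => l ^ k • abelVelocity lam a ε (c k)) (abelVelocity lam a ε c') := by
  rw [Pi.hasSum]
  intro i
  simp only [Pi.smul_apply, smul_eq_mul, abelVelocity, Matrix.mulVec, dotProduct, residueSum]
  have := hasSum_sum (s := Finset.univ) fun (j : Fin (N - 1)) _ =>
    ((hasSum_sum (s := Finset.univ) fun (b : Fin N) _ => ((h b).mul_right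
      ((lam b : ℂ) ^ (N - 2 - (j : ℕ)))).div_const (erasedProd lam b (lam b))).mul_left
        (ε / 2)).mul_left (normMatrix a i j)
  refine this.congr_fun fun k => ?_
  rw [Finset.mul_sum]
  refine Finset.sum_congr rfl fun j _ => ?_
  simp only [Finset.mul_sum]
  exact Finset.sum_congr rfl fun b _ => by ring

/-! ### Local charts of the hyperelliptic surface -/

/-- The coordinate `λ` on the surface (with value `0` at infinity). -/
def lamCoord {R : ℂ[X]} (x : Surface R) : ℂ := OnePoint.elim x 0 fun Q : AffineCurve R => Q.1.1

/-- The coordinate `ξ` on the surface (with value `0` at infinity). -/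
def xiCoord {R : ℂ[X]} (x : Surface R) : ℂ := OnePoint.elim x 0 fun Q : AffineCurve R => Q.1.2

lemma surfacePoint_eq {R : ℂ[X]} {l ξ : ℂ} (h : ξ ^ 2 + R.eval l = 0) :
    surfacePoint R l ξ = ((⟨(l, ξ), h⟩ : AffineCurve R) : Surface R) := dif_pos h

/-- `surfacePoint` jumps to ∞ off the curve, so the equation is required on the whole set. -/
lemma continuousOn_surfacePoint {T : Type*} [TopologicalSpace T] {R : ℂ[X]} {s : Set T}
    {x y : T → ℂ} (hx : ContinuousOn x s) (hy : ContinuousOn y s)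
    (h : ∀ t ∈ s, y t ^ 2 + R.eval (x t) = 0) :
    ContinuousOn (fun t => surfacePoint R (x t) (y t)) s := by
  rw [continuousOn_iff_continuous_domRestrict]
  have : s.domRestrict (fun t => surfacePoint R (x t) (y t)) =
      fun t : s => ((⟨(x t, y t), h t t.2⟩ : AffineCurve R) : Surface R) := by
    funext t; exact surfacePoint_eq (h t t.2)
  rw [this]
  exact OnePoint.continuous_coe.comp (Continuous.subtype_mk
    ((continuousOn_iff_continuous_domRestrict.1 hx).prodMk
      (continuousOn_iff_continuous_domRestrict.1 hy)) _)

/-- `φ` is a chart of the surface centred at `P` whose image is the disc of radius `ρ`, such that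
for `e < g` the differential `λ^e dλ / (4 ξ)` is `h e s ds` in the coordinate `s`. -/
structure IsChart {R : ℂ[X]} (g : ℕ) (P : Surface R) (φ : OpenPartialHomeomorph (Surface R) ℂ)
    (ρ : ℝ) (h : ℕ → ℂ → ℂ) : Prop where
  pos : 0 < ρ
  mem_source : P ∈ φ.source
  map_center : φ P = 0
  target_eq : φ.target = Metric.ball 0 ρ
  differentiableOn : ∀ e < g, DifferentiableOn ℂ (h e) (Metric.ball 0 ρ)
  symm_of_ne : ∀ s ∈ Metric.ball (0 : ℂ) ρ, s ≠ 0 →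
    ∃ Q : AffineCurve R, φ.symm s = Q ∧ Q.1.2 ≠ 0
  hasDerivAt : ∀ Q : AffineCurve R, (Q : Surface R) ∈ φ.source → Q.1.2 ≠ 0 →
    ∃ d ≠ 0, HasDerivAt (fun s => lamCoord (φ.symm s)) d (φ Q) ∧
      ∀ e < g, h e (φ Q) = Q.1.1 ^ e / (4 * Q.1.2) * d
  branch : ∀ Q : AffineCurve R, (Q : Surface R) = P → Q.1.2 = 0 →
    ∃ d ≠ 0, HasDerivAt (fun s => xiCoord (φ.symm s)) d 0 ∧
      ∀ e < g, h e 0 * (-2 * (derivative R).eval Q.1.1) = Q.1.1 ^ e * d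

/-- Common construction for the two kinds of affine charts: σ is the coordinate, and (x, y)
parametrizes the curve. -/
lemma exists_affine_homeomorph {R : ℂ[X]} {V : Set (AffineCurve R)} (hV : IsOpen V)
    {σ : AffineCurve R → ℂ} (hσ : ContinuousOn σ V) {ρ : ℝ} {x y : ℂ → ℂ}
    (hx : ContinuousOn x (Metric.ball 0 ρ)) (hy : ContinuousOn y (Metric.ball 0 ρ))
    (hxy : ∀ s ∈ Metric.ball (0 : ℂ) ρ, ∃ Q ∈ V, Q.1 = (x s, y s) ∧ σ Q = s)
    (hmap : ∀ Q ∈ V, σ Q ∈ Metric.ball (0 : ℂ) ρ)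
    (hinv : ∀ Q ∈ V, (x (σ Q), y (σ Q)) = Q.1) :
    ∃ φ : OpenPartialHomeomorph (Surface R) ℂ, φ.source = (↑) '' V ∧
      φ.target = Metric.ball 0 ρ ∧ (∀ Q : AffineCurve R, φ Q = σ Q) ∧
      ∀ s, φ.symm s = surfacePoint R (x s) (y s) := by
  have hQ : ∀ Q : AffineCurve R, surfacePoint R Q.1.1 Q.1.2 = Q := fun Q => surfacePoint_eq Q.2
  have hcurve : ∀ s ∈ Metric.ball (0 : ℂ) ρ, y s ^ 2 + R.eval (x s) = 0 := by
    intro s hs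
    obtain ⟨Q, -, h1, -⟩ := hxy s hs
    have := Q.2
    rwa [h1] at this
  have hpt : ∀ s ∈ Metric.ball (0 : ℂ) ρ, ∃ Q ∈ V, surfacePoint R (x s) (y s) = Q ∧ σ Q = s := by
    intro s hs
    obtain ⟨Q, h0, h1, h2⟩ := hxy s hs
    refine ⟨Q, h0, ?_, h2⟩
    rw [← hQ Q, h1]
  refine ⟨{ toFun := fun P => OnePoint.elim P 0 σ
            invFun := fun s => surfacePoint R (x s) (y s)
            source := (↑) '' V
            target := Metric.ball 0 ρ
            map_source' := ?_
            map_target' := ?_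
            left_inv' := ?_
            right_inv' := ?_
            open_source := OnePoint.isOpen_image_coe.2 hV
            open_target := Metric.isOpen_ball
            continuousOn_toFun := ?_
            continuousOn_invFun := continuousOn_surfacePoint hx hy hcurve }, rfl, rfl,
            fun _ => rfl, fun _ => rfl⟩
  · rintro _ ⟨Q, hQV, rfl⟩
    exact hmap Q hQV
  · intro s hs
    obtain ⟨Q, h0, h1, -⟩ := hpt s hs
    exact ⟨Q, h0, h1.symm⟩
  · rintro _ ⟨Q, hQV, rfl⟩
    have := hinv Q hQV
    change surfacePoint R (x (σ Q)) (y (σ Q)) = Q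
    rw [← hQ Q, ← this]
  · intro s hs
    obtain ⟨Q, h0, h1, h2⟩ := hpt s hs
    rw [h1]; exact h2
  · rintro _ ⟨Q, hQV, rfl⟩
    apply ContinuousAt.continuousWithinAt
    rw [OnePoint.continuousAt_coe]
    exact hσ.continuousAt (hV.mem_nhds hQV)

lemma sub_mem_ball_zero {l x : ℂ} {ρ : ℝ} (h : x ∈ Metric.ball l ρ) :
    x - l ∈ Metric.ball (0 : ℂ) ρ := by
  rwa [mem_ball_zero_iff, ← dist_eq_norm]

/-- The principal root of P / w₀², which is 1 at x₀ and hence stays in the slit plane nearby. -/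
lemma exists_sqrt (P : ℂ[X]) {x₀ w₀ : ℂ} (hw : w₀ ^ 2 = P.eval x₀) (h0 : w₀ ≠ 0) :
    ∃ ρ > 0, ∃ w : ℂ → ℂ, DifferentiableOn ℂ w (Metric.ball x₀ ρ) ∧
      (∀ x ∈ Metric.ball x₀ ρ, w x ^ 2 = P.eval x ∧ w x ≠ 0) ∧ w x₀ = w₀ := by
  have hsq : w₀ ^ 2 ≠ 0 := pow_ne_zero 2 h0
  have hcont : Continuous fun x => P.eval x / w₀ ^ 2 := by fun_prop
  have hmem : (fun x => P.eval x / w₀ ^ 2) ⁻¹' Complex.slitPlane ∈ 𝓝 x₀ := by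
    refine hcont.continuousAt.preimage_mem_nhds (Complex.isOpen_slitPlane.mem_nhds ?_)
    rw [← hw, div_self hsq]; exact Complex.one_mem_slitPlane
  obtain ⟨ρ, hρ, hball⟩ := Metric.mem_nhds_iff.1 hmem
  refine ⟨ρ, hρ, fun x => w₀ * (P.eval x / w₀ ^ 2) ^ ((2 : ℕ) : ℂ)⁻¹, ?_, ?_, ?_⟩
  · intro x hx
    apply DifferentiableAt.differentiableWithinAt
    exact ((P.differentiableAt.div_const _).cpow_const (hball hx)).const_mul _
  · intro x hx
    have hsq' : (w₀ * (P.eval x / w₀ ^ 2) ^ ((2 : ℕ) : ℂ)⁻¹) ^ 2 = P.eval x := by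
      rw [mul_pow, Complex.cpow_nat_inv_pow _ two_ne_zero, mul_div_cancel₀ _ hsq]
    refine ⟨hsq', fun h => ?_⟩
    have := Complex.slitPlane_ne_zero (hball hx)
    simp only at h
    rw [h] at hsq'
    simp [← hsq'] at this
  · simp only
    rw [← hw, div_self hsq, Complex.one_cpow, mul_one]

lemma continuous_affine_fst {R : ℂ[X]} : Continuous fun Q : AffineCurve R => Q.1.1 := by fun_prop

lemma continuous_affine_snd {R : ℂ[X]} : Continuous fun Q : AffineCurve R => Q.1.2 := by fun_prop

/-- Away from branch points λ is a coordinate, and ξ is a holomorphic branch w of √(-R). -/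
lemma exists_chart_of_ne {R : ℂ[X]} (g : ℕ) (P : AffineCurve R) (hP : P.1.2 ≠ 0) :
    ∃ φ ρ h, IsChart g (P : Surface R) φ ρ h := by
  obtain ⟨ρ, hρ, w, hwd, hw, hw0⟩ := exists_sqrt (-R) (x₀ := P.1.1) (w₀ := P.1.2)
    (by rw [eval_neg]; linear_combination P.2) hP
  set l := P.1.1 with hl
  set O : Set (AffineCurve R) := (fun Q : AffineCurve R => Q.1.1) ⁻¹' Metric.ball l ρ with hO
  have hOo : IsOpen O := Metric.isOpen_ball.preimage continuous_affine_fst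
  have hwO : ContinuousOn (fun Q : AffineCurve R => w Q.1.1) O :=
    hwd.continuousOn.comp continuous_affine_fst.continuousOn fun Q hQ => hQ
  -- Over the disc ξ = ±w. The open condition |ξ - w| < |ξ + w| selects the sheet ξ = w.
  set V : Set (AffineCurve R) := O ∩ (fun Q : AffineCurve R =>
    ‖Q.1.2 - w Q.1.1‖ - ‖Q.1.2 + w Q.1.1‖) ⁻¹' Set.Iio 0 with hV
  have hVo : IsOpen V := ContinuousOn.isOpen_inter_preimage
    (((continuous_affine_snd.continuousOn.sub hwO).norm).sub
      (continuous_affine_snd.continuousOn.add hwO).norm) hOo isOpen_Iio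
  have hVw : ∀ Q ∈ V, Q.1.2 = w Q.1.1 := by
    intro Q hQ
    have h1 := (hw _ hQ.1).1
    rw [eval_neg] at h1
    have h2 : (Q.1.2 - w Q.1.1) * (Q.1.2 + w Q.1.1) = 0 := by
      linear_combination Q.2 - h1
    rcases mul_eq_zero.1 h2 with h3 | h3
    · exact sub_eq_zero.1 h3
    · have h4 : ‖Q.1.2 - w Q.1.1‖ - ‖Q.1.2 + w Q.1.1‖ < 0 := hQ.2
      rw [h3, norm_zero, sub_zero] at h4
      exact absurd h4 (norm_nonneg _).not_gt
  have hball : ∀ s ∈ Metric.ball (0 : ℂ) ρ, l + s ∈ Metric.ball l ρ := by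
    intro s hs; simpa using hs
  have hadd : DifferentiableOn ℂ (fun s => w (l + s)) (Metric.ball 0 ρ) :=
    hwd.comp (by fun_prop) hball
  have hmemV : ∀ Q : AffineCurve R, Q.1.1 ∈ Metric.ball l ρ → Q.1.2 = w Q.1.1 → Q ∈ V := by
    intro Q h1 h2
    refine ⟨h1, ?_⟩
    have := (hw _ h1).2
    simp only [Set.mem_preimage, Set.mem_Iio, h2, sub_self, norm_zero, zero_sub, neg_lt_zero,
      norm_pos_iff]
    rw [← two_mul]; exact mul_ne_zero two_ne_zero this
  obtain ⟨φ, hsrc, ht, hφ, hφs⟩ := exists_affine_homeomorph hVo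
    (σ := fun Q => Q.1.1 - l) (ρ := ρ) (x := fun s => l + s) (y := fun s => w (l + s))
    (by fun_prop) (by fun_prop) hadd.continuousOn
    (fun s hs => by
      have h1 := (hw _ (hball s hs)).1
      rw [eval_neg] at h1
      refine ⟨⟨(l + s, w (l + s)), by simp only; rw [h1]; ring⟩, ?_, rfl, ?_⟩
      · exact hmemV _ (hball s hs) rfl
      · simp)
    (fun Q hQ => sub_mem_ball_zero hQ.1)
    (fun Q hQ => by
      simp only [add_sub_cancel]
      rw [← hVw Q hQ])
  refine ⟨φ, ρ, fun e s => (l + s) ^ e / (4 * w (l + s)), hρ, ?_, ?_, ht, ?_, ?_, ?_, ?_⟩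
  · rw [hsrc]
    exact ⟨P, hmemV P (Metric.mem_ball_self hρ) hw0.symm, rfl⟩
  · rw [hφ, sub_self]
  · intro e _
    refine DifferentiableOn.div (by fun_prop) (hadd.const_mul 4) fun s hs => ?_
    exact mul_ne_zero (by norm_num) (hw _ (hball s hs)).2
  · intro s hs _
    have h1 := (hw _ (hball s hs)).1
    rw [eval_neg] at h1
    exact ⟨⟨(l + s, w (l + s)), by simp only; rw [h1]; ring⟩,
      (hφs s).trans (surfacePoint_eq _), (hw _ (hball s hs)).2⟩
  · intro Q hQ _
    rw [hsrc] at hQ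
    obtain ⟨Q', hQ', e⟩ := hQ
    obtain rfl := OnePoint.coe_injective e
    refine ⟨1, one_ne_zero, ?_, fun e _ => ?_⟩
    · have hev : (fun s => lamCoord (φ.symm s)) =ᶠ[𝓝 (φ Q')] fun s => l + s := by
        rw [hφ]
        have : Q'.1.1 - l ∈ Metric.ball (0 : ℂ) ρ := sub_mem_ball_zero hQ'.1
        filter_upwards [Metric.isOpen_ball.mem_nhds this] with s hs
        have h1 := (hw _ (hball s hs)).1
        rw [eval_neg] at h1
        rw [hφs, surfacePoint_eq (by rw [h1]; ring)]; rfl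
      refine HasDerivAt.congr_of_eventuallyEq ?_ hev
      exact (hasDerivAt_id _).const_add l
    · simp only [hφ, add_sub_cancel, mul_one]
      rw [← hVw Q' hQ']
  · intro Q hQ h0
    obtain rfl := OnePoint.coe_injective hQ
    exact absurd h0 hP

lemma sq_mem_ball {ρ : ℝ} (s : ℂ) : s ∈ Metric.ball (0 : ℂ) √ρ ↔ s ^ 2 ∈ Metric.ball (0 : ℂ) ρ := by
  rw [mem_ball_zero_iff, mem_ball_zero_iff, norm_pow, Real.lt_sqrt (norm_nonneg _)]

/-- At a simple root r write R = (X - r) S and w² = -S. The curve is λ = r + s², ξ = s w(λ), and dλ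
/ (4ξ) becomes ds / (2w), which is regular. -/
lemma exists_chart_of_eq {R : ℂ[X]} (hR : Squarefree R) (g : ℕ) (P : AffineCurve R)
    (hP : P.1.2 = 0) : ∃ φ ρ h, IsChart g (P : Surface R) φ ρ h := by
  set r := P.1.1 with hr
  have hroot : R.IsRoot r := by have := P.2; rw [hP] at this; simpa using this
  obtain ⟨S, hS⟩ := dvd_iff_isRoot.2 hroot
  have hSr : S.eval r ≠ 0 := by
    intro h
    obtain ⟨T, hT⟩ := dvd_iff_isRoot.2 h
    exact not_isUnit_X_sub_C r (hR (X - C r) ⟨T, by rw [hS, hT]; ring⟩)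
  obtain ⟨w₀, hw₀⟩ := IsAlgClosed.exists_pow_nat_eq (-S.eval r) two_pos
  have hw₀' : w₀ ≠ 0 := by
    rintro rfl
    exact hSr (by simpa using hw₀.symm)
  obtain ⟨ρ, hρ, w, hwd, hw, hw0⟩ := exists_sqrt (-S) (x₀ := r) (w₀ := w₀)
    (by rw [eval_neg, hw₀]) hw₀'
  have hRS : ∀ x, R.eval x = (x - r) * S.eval x := fun x => by rw [hS]; simp
  have hSw : ∀ x ∈ Metric.ball r ρ, S.eval x = -w x ^ 2 := fun x hx => by
    rw [(hw x hx).1, eval_neg, neg_neg]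
  set V : Set (AffineCurve R) := (fun Q : AffineCurve R => Q.1.1) ⁻¹' Metric.ball r ρ with hV
  have hVo : IsOpen V := Metric.isOpen_ball.preimage continuous_affine_fst
  have hball : ∀ s ∈ Metric.ball (0 : ℂ) √ρ, r + s ^ 2 ∈ Metric.ball r ρ := by
    intro s hs; rw [sq_mem_ball] at hs; simpa using hs
  have hwd' : DifferentiableOn ℂ (fun s => w (r + s ^ 2)) (Metric.ball 0 √ρ) :=
    hwd.comp (by fun_prop) hball
  have hcurve : ∀ s ∈ Metric.ball (0 : ℂ) √ρ,
      (s * w (r + s ^ 2)) ^ 2 + R.eval (r + s ^ 2) = 0 := by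
    intro s hs
    rw [hRS, hSw _ (hball s hs)]; ring
  have hsq : ∀ Q ∈ V, (Q.1.2 / w Q.1.1) ^ 2 = Q.1.1 - r := by
    intro Q hQ
    have h1 := Q.2
    rw [hRS, hSw _ hQ] at h1
    have := (hw _ hQ).2
    field_simp
    linear_combination h1
  obtain ⟨φ, hsrc, ht, hφ, hφs⟩ := exists_affine_homeomorph hVo
    (σ := fun Q => Q.1.2 / w Q.1.1) (ρ := √ρ) (x := fun s => r + s ^ 2)
    (y := fun s => s * w (r + s ^ 2))
    (continuous_affine_snd.continuousOn.div
      (hwd.continuousOn.comp continuous_affine_fst.continuousOn fun Q hQ => hQ)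
      fun Q hQ => (hw _ hQ).2)
    (by fun_prop) (continuousOn_id.mul hwd'.continuousOn)
    (fun s hs => ⟨⟨(r + s ^ 2, s * w (r + s ^ 2)), hcurve s hs⟩, hball s hs, rfl,
      mul_div_cancel_right₀ _ (hw _ (hball s hs)).2⟩)
    (fun Q hQ => by
      rw [sq_mem_ball, hsq Q hQ]; exact sub_mem_ball_zero hQ)
    (fun Q hQ => by
      simp only [hsq Q hQ, add_sub_cancel, div_mul_cancel₀ _ (hw _ hQ).2])
  have hcoord : ∀ s (hs : s ∈ Metric.ball (0 : ℂ) √ρ), φ.symm s =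
      ((⟨(r + s ^ 2, s * w (r + s ^ 2)), hcurve s hs⟩ : AffineCurve R) : Surface R) :=
    fun s hs => (hφs s).trans (surfacePoint_eq _)
  refine ⟨φ, √ρ, fun e s => (r + s ^ 2) ^ e / (2 * w (r + s ^ 2)), Real.sqrt_pos.2 hρ, ?_, ?_, ht,
    ?_, ?_, ?_, ?_⟩
  · rw [hsrc]
    exact ⟨P, Metric.mem_ball_self hρ, rfl⟩
  · rw [hφ, hP, zero_div]
  · intro e _
    refine DifferentiableOn.div (by fun_prop) (hwd'.const_mul 2) fun s hs => ?_
    exact mul_ne_zero two_ne_zero (hw _ (hball s hs)).2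
  · intro s hs hs0
    exact ⟨_, hcoord s hs, mul_ne_zero hs0 (hw _ (hball s hs)).2⟩
  · intro Q hQ hQ0
    rw [hsrc] at hQ
    obtain ⟨Q', hQ', e⟩ := hQ
    obtain rfl := OnePoint.coe_injective e
    have hwQ := (hw _ hQ').2
    refine ⟨2 * (Q'.1.2 / w Q'.1.1), mul_ne_zero two_ne_zero (div_ne_zero hQ0 hwQ), ?_,
      fun e _ => ?_⟩
    · have hmem : φ Q' ∈ Metric.ball (0 : ℂ) √ρ := by
        rw [hφ, sq_mem_ball, hsq Q' hQ']; exact sub_mem_ball_zero hQ'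
      have hev : (fun s => lamCoord (φ.symm s)) =ᶠ[𝓝 (φ Q')] fun s => r + s ^ 2 := by
        filter_upwards [Metric.isOpen_ball.mem_nhds hmem] with s hs
        rw [hcoord s hs]; rfl
      refine HasDerivAt.congr_of_eventuallyEq ?_ hev
      rw [hφ]
      simpa using (hasDerivAt_pow 2 (Q'.1.2 / w Q'.1.1)).const_add r
    · simp only [hφ, hsq Q' hQ', add_sub_cancel]
      field_simp; norm_num
  · intro Q hQ _
    obtain rfl := OnePoint.coe_injective hQ
    refine ⟨w₀, hw₀', ?_, fun e _ => ?_⟩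
    · have hmem : (0 : ℂ) ∈ Metric.ball (0 : ℂ) √ρ := Metric.mem_ball_self (Real.sqrt_pos.2 hρ)
      have hev : (fun s => xiCoord (φ.symm s)) =ᶠ[𝓝 0] fun s => s * w (r + s ^ 2) := by
        filter_upwards [Metric.isOpen_ball.mem_nhds hmem] with s hs
        rw [hcoord s hs]; rfl
      refine HasDerivAt.congr_of_eventuallyEq ?_ hev
      have hd := (hwd'.differentiableAt (Metric.isOpen_ball.mem_nhds hmem)).hasDerivAt
      simpa [hw0] using (hasDerivAt_id (0 : ℂ)).fun_mul hd
    · have hd : (derivative R).eval r = -w₀ ^ 2 := by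
        rw [hS, hw₀]; simp [derivative_mul]
      rw [← hr, hd]
      simp only [ne_eq, OfNat.ofNat_ne_zero, not_false_eq_true, zero_pow, add_zero, hw0]
      field_simp

/-- Transports the equation of the curve to the coordinate 1/λ at infinity. -/
lemma eval_eq_pow_mul_reverse (R : ℂ[X]) {x : ℂ} (hx : x ≠ 0) :
    R.eval x = x ^ R.natDegree * R.reverse.eval x⁻¹ := by
  have := invertibleOfNonzero hx
  have h := eval₂_reverse_mul_pow (RingHom.id ℂ) x R
  rw [invOf_eq_inv] at h
  rw [← eval₂_id, ← eval₂_id, ← h, mul_comm]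

lemma isClosedEmbedding_affineCurve (R : ℂ[X]) :
    IsClosedEmbedding (Subtype.val : AffineCurve R → ℂ × ℂ) := by
  apply IsClosed.isClosedEmbedding_subtypeVal
  exact isClosed_eq (by fun_prop) continuous_const

/-- Bounded λ forces bounded ξ through ξ² = -R(λ). The complements of these sets are therefore
punctured neighbourhoods of ∞. -/
lemma isCompact_affine_norm_le (R : ℂ[X]) (M : ℝ) :
    IsCompact {Q : AffineCurve R | ‖Q.1.1‖ ≤ M} := by
  obtain ⟨B, hB⟩ := (isCompact_closedBall (0 : ℂ) M).exists_bound_of_continuousOn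
    (f := fun x => R.eval x) (by fun_prop)
  have hK := (isClosedEmbedding_affineCurve R).isCompact_preimage
    ((isCompact_closedBall (0 : ℂ) M).prod (isCompact_closedBall (0 : ℂ) √B))
  convert hK using 1
  ext Q
  simp only [Set.mem_ofPred_eq, Set.mem_preimage, Set.mem_prod, mem_closedBall_zero_iff]
  refine ⟨fun h => ⟨h, ?_⟩, fun h => h.1⟩
  apply Real.le_sqrt_of_sq_le
  rw [← norm_pow, eq_neg_of_add_eq_zero_left Q.2, norm_neg]
  exact hB _ (mem_closedBall_zero_iff.2 h)

/-- Since the degree is odd, infinity is a branch point: λ = s⁻², ξ = w(s²) / s^{2g+1} with w² equal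
to minus the reversed polynomial. In this coordinate λ^e dλ / (4ξ) is -s^{2(g-1-e)} ds / (2w),
regular exactly because e < g. -/
lemma exists_chart_infty {R : ℂ[X]} {g : ℕ} (hdeg : R.natDegree = 2 * g + 1) :
    ∃ φ ρ h, IsChart g (OnePoint.infty : Surface R) φ ρ h := by
  have hR0 : R ≠ 0 := by rintro rfl; simp at hdeg
  have hT0 : R.reverse.eval 0 ≠ 0 := by
    rw [← coeff_zero_eq_eval_zero, coeff_zero_reverse]
    exact leadingCoeff_ne_zero.2 hR0
  obtain ⟨w₀, hw₀⟩ := IsAlgClosed.exists_pow_nat_eq (-R.reverse.eval 0) two_pos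
  have hw₀' : w₀ ≠ 0 := by
    rintro rfl
    exact hT0 (by simpa using hw₀.symm)
  obtain ⟨ρ, hρ, w, hwd, hw, hw0⟩ := exists_sqrt (-R.reverse) (x₀ := 0) (w₀ := w₀)
    (by rw [eval_neg, hw₀]) hw₀'
  have hTw : ∀ x ∈ Metric.ball (0 : ℂ) ρ, R.reverse.eval x = -w x ^ 2 := fun x hx => by
    rw [(hw x hx).1, eval_neg, neg_neg]
  set V : Set (AffineCurve R) := {Q | ρ⁻¹ < ‖Q.1.1‖} with hV
  have hVo : IsOpen V := isOpen_lt continuous_const continuous_affine_fst.norm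
  have hVne : ∀ Q ∈ V, Q.1.1 ≠ 0 := by
    intro Q hQ h0
    have : ρ⁻¹ < ‖Q.1.1‖ := hQ
    rw [h0, norm_zero] at this
    exact absurd this (inv_pos.2 hρ).not_gt
  have hVball : ∀ Q ∈ V, Q.1.1⁻¹ ∈ Metric.ball (0 : ℂ) ρ := by
    intro Q hQ
    rw [mem_ball_zero_iff, norm_inv]
    exact inv_lt_of_inv_lt₀ hρ hQ
  set U : Set (Surface R) := insert OnePoint.infty ((↑) '' V) with hU
  have hUpre : (((↑) : AffineCurve R → Surface R) ⁻¹' U) = V := by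
    ext Q; simp [hU]
  have hUo : IsOpen U := by
    rw [OnePoint.isOpen_iff_of_mem (by simp [hU]), hUpre]
    refine ⟨hVo.isClosed_compl, ?_⟩
    convert isCompact_affine_norm_le R ρ⁻¹ using 1
    ext Q; simp [hV]
  have hball : ∀ s ∈ Metric.ball (0 : ℂ) √ρ, s ^ 2 ∈ Metric.ball (0 : ℂ) ρ :=
    fun s hs => (sq_mem_ball s).1 hs
  have hwd' : DifferentiableOn ℂ (fun s => w (s ^ 2)) (Metric.ball 0 √ρ) :=
    hwd.comp (by fun_prop) hball
  set x : ℂ → ℂ := fun s => (s ^ 2)⁻¹ with hx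
  set y : ℂ → ℂ := fun s => w (s ^ 2) / s ^ (2 * g + 1) with hy
  have hcurve : ∀ s ∈ Metric.ball (0 : ℂ) √ρ, s ≠ 0 → y s ^ 2 + R.eval (x s) = 0 := by
    intro s hs h0
    have h2 : x s ≠ 0 := inv_ne_zero (pow_ne_zero 2 h0)
    rw [eval_eq_pow_mul_reverse R h2, hdeg]
    simp only [hx, hy, inv_inv]
    rw [hTw _ (hball s hs), div_pow, inv_pow, ← pow_mul s 2, mul_comm 2 (2 * g + 1), pow_mul s _ 2]
    ring
  have hyne : ∀ s ∈ Metric.ball (0 : ℂ) √ρ, s ≠ 0 → y s ≠ 0 := fun s hs h0 =>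
    div_ne_zero (hw _ (hball s hs)).2 (pow_ne_zero _ h0)
  have hxV : ∀ s ∈ Metric.ball (0 : ℂ) √ρ, s ≠ 0 → ρ⁻¹ < ‖x s‖ := by
    intro s hs h0
    have := hball s hs
    rw [mem_ball_zero_iff] at this
    rw [hx, norm_inv]
    exact inv_strictAnti₀ (norm_pos_iff.2 (pow_ne_zero 2 h0)) this
  -- Solve ξ = w / s^{2g+1} for s, using s^{2g} = λ^{-g}.
  set σ : AffineCurve R → ℂ := fun Q => w Q.1.1⁻¹ * Q.1.1 ^ g / Q.1.2 with hσ
  have hQne : ∀ Q ∈ V, Q.1.2 ≠ 0 := by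
    intro Q hQ h0
    have h1 := Q.2
    rw [h0, eval_eq_pow_mul_reverse R (hVne Q hQ), hTw _ (hVball Q hQ)] at h1
    have h3 := (hw _ (hVball Q hQ)).2
    have h4 := hVne Q hQ
    simp [h3, h4] at h1
  have hσsq : ∀ Q ∈ V, σ Q ^ 2 = Q.1.1⁻¹ := by
    intro Q hQ
    have h1 := Q.2
    have h4 := hVne Q hQ
    have h5 := hQne Q hQ
    rw [eval_eq_pow_mul_reverse R h4, hTw _ (hVball Q hQ), hdeg] at h1
    change (w Q.1.1⁻¹ * Q.1.1 ^ g / Q.1.2) ^ 2 = Q.1.1⁻¹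
    generalize w Q.1.1⁻¹ = W at h1
    rw [div_pow, div_eq_iff (pow_ne_zero 2 h5), inv_eq_one_div, div_mul_eq_mul_div, eq_div_iff h4]
    linear_combination -h1
  have hσne : ∀ Q ∈ V, σ Q ≠ 0 := by
    intro Q hQ h
    have := hσsq Q hQ
    rw [h] at this
    exact inv_ne_zero (hVne Q hQ) (by simpa using this.symm)
  have hσball : ∀ Q ∈ V, σ Q ∈ Metric.ball (0 : ℂ) √ρ := fun Q hQ => by
    rw [sq_mem_ball, hσsq Q hQ]; exact hVball Q hQ
  have hσV : ContinuousOn σ V := by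
    refine ContinuousOn.div (ContinuousOn.mul ?_ (continuous_affine_fst.pow g).continuousOn)
      continuous_affine_snd.continuousOn hQne
    exact hwd.continuousOn.comp (continuous_affine_fst.continuousOn.inv₀ hVne) hVball
  have hxσ : ∀ Q ∈ V, x (σ Q) = Q.1.1 := fun Q hQ => by
    simp only [hx]; rw [hσsq Q hQ, inv_inv]
  have hyσ : ∀ Q ∈ V, y (σ Q) = Q.1.2 := fun Q hQ => by
    have h4 := hVne Q hQ
    have h5 := hQne Q hQ
    have h6 := (hw _ (hVball Q hQ)).2
    simp only [hy]
    rw [pow_succ (σ Q) (2 * g), pow_mul (σ Q) 2 g, hσsq Q hQ]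
    change w Q.1.1⁻¹ / (Q.1.1⁻¹ ^ g * (w Q.1.1⁻¹ * Q.1.1 ^ g / Q.1.2)) = Q.1.2
    generalize w Q.1.1⁻¹ = W at h6 ⊢
    rw [inv_pow]
    field_simp
  have hσxy : ∀ s ∈ Metric.ball (0 : ℂ) √ρ, s ≠ 0 → w (x s)⁻¹ * x s ^ g / y s = s := by
    intro s hs h0
    have h6 := (hw _ (hball s hs)).2
    simp only [hx, hy, inv_inv]
    rw [inv_pow, ← pow_mul, pow_succ s (2 * g)]
    field_simp
  classical
  set inv : ℂ → Surface R := fun s => if s = 0 then OnePoint.infty else surfacePoint R (x s) (y s)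
    with hinv
  have hinvne : ∀ s (hs : s ∈ Metric.ball (0 : ℂ) √ρ) (h0 : s ≠ 0), inv s =
      ((⟨(x s, y s), hcurve s hs h0⟩ : AffineCurve R) : Surface R) := by
    intro s hs h0
    simp only [hinv, if_neg h0]
    exact surfacePoint_eq _
  have hinvcont : ContinuousOn inv (Metric.ball 0 √ρ) := by
    intro s hs
    apply ContinuousAt.continuousWithinAt
    by_cases h0 : s = 0
    · subst h0
      have h00 : inv 0 = OnePoint.infty := by simp [hinv]
      rw [ContinuousAt, h00, Filter.Tendsto, OnePoint.le_nhds_infty]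
      -- Continuity at the centre: λ is bounded on a compact set K, whereas |x s| tends to infinity,
      -- so K is eventually left.
      intro K _ hK
      obtain ⟨M, hM⟩ := hK.exists_bound_of_continuousOn (continuous_affine_fst (R := R)).continuousOn
      have h1 : Filter.Tendsto (fun s : ℂ => ‖x s‖) (𝓝[≠] 0) Filter.atTop := by
        have h2 : Filter.Tendsto (fun s : ℂ => s ^ 2) (𝓝[≠] 0) (𝓝[≠] 0) := by
          refine tendsto_nhdsWithin_iff.2 ⟨?_, ?_⟩
          · have : ContinuousAt (fun s : ℂ => s ^ 2) 0 := by fun_prop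
            simpa [ContinuousAt] using this.tendsto.mono_left nhdsWithin_le_nhds
          · filter_upwards [self_mem_nhdsWithin] with s hs
            exact pow_ne_zero 2 hs
        exact (tendsto_norm_inv_nhdsNE_zero_atTop (α := ℂ)).comp h2
      have h3 : ∀ᶠ s in 𝓝[≠] (0 : ℂ), M < ‖x s‖ := h1.eventually_gt_atTop M
      rw [eventually_nhdsWithin_iff] at h3
      change ∀ᶠ s in 𝓝 0, inv s ∈ _
      filter_upwards [h3, Metric.isOpen_ball.mem_nhds hs] with s h4 h5
      by_cases h0 : s = 0
      · right; simp [h0, h00]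
      · left
        refine ⟨⟨(x s, y s), hcurve s h5 h0⟩, fun hKs => ?_, (hinvne s h5 h0).symm⟩
        exact absurd (h4 h0) (hM _ hKs).not_gt
    · have hopen : IsOpen (Metric.ball (0 : ℂ) √ρ ∩ {0}ᶜ) :=
        Metric.isOpen_ball.inter isOpen_compl_singleton
      have hc : ContinuousOn (fun s => surfacePoint R (x s) (y s))
          (Metric.ball (0 : ℂ) √ρ ∩ {0}ᶜ) := by
        refine continuousOn_surfacePoint ?_ ?_ fun s hs => hcurve s hs.1 hs.2
        · exact ContinuousOn.inv₀ (by fun_prop) fun s hs => pow_ne_zero 2 hs.2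
        · exact ContinuousOn.div (hwd'.continuousOn.mono Set.inter_subset_left) (by fun_prop)
            fun s hs => pow_ne_zero _ hs.2
      refine (hc.continuousAt (hopen.mem_nhds ⟨hs, h0⟩)).congr ?_
      filter_upwards [isOpen_compl_singleton.mem_nhds h0] with t ht
      exact (if_neg ht).symm
  set φ : OpenPartialHomeomorph (Surface R) ℂ :=
    { toFun := fun P => OnePoint.elim P 0 σ
      invFun := inv
      source := U
      target := Metric.ball 0 √ρ
      map_source' := by
        rintro _ (rfl | ⟨Q, hQ, rfl⟩)
        · exact Metric.mem_ball_self (Real.sqrt_pos.2 hρ)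
        · exact hσball Q hQ
      map_target' := by
        intro s hs
        by_cases h0 : s = 0
        · left; simp [hinv, h0]
        · right; rw [hinvne s hs h0]
          exact ⟨_, hxV s hs h0, rfl⟩
      left_inv' := by
        rintro _ (rfl | ⟨Q, hQ, rfl⟩)
        · simp [hinv]
        · simp only [OnePoint.elim_some]
          rw [hinvne _ (hσball Q hQ) (hσne Q hQ)]
          congr 1
          apply Subtype.ext
          simp only [hxσ Q hQ, hyσ Q hQ]
      right_inv' := by
        intro s hs
        by_cases h0 : s = 0
        · simp [hinv, h0]
        · rw [hinvne s hs h0, OnePoint.elim_some]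
          exact hσxy s hs h0
      open_source := hUo
      open_target := Metric.isOpen_ball
      continuousOn_toFun := by
        rintro _ (rfl | ⟨Q, hQ, rfl⟩)
        · apply ContinuousAt.continuousWithinAt
          rw [OnePoint.continuousAt_infty', Filter.coclosedCompact_eq_cocompact]
          simp only [OnePoint.elim_infty]
          rw [tendsto_zero_iff_norm_tendsto_zero, Metric.tendsto_nhds]
          intro δ hδ
          have hc := (isCompact_affine_norm_le R (max ρ⁻¹ (δ ^ 2)⁻¹)).compl_mem_cocompact
          filter_upwards [hc] with Q hQ
          simp only [Set.mem_compl_iff, Set.mem_ofPred_eq, not_le, max_lt_iff] at hQ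
          have h1 := hσsq Q hQ.1
          have h2 : ‖σ Q‖ ^ 2 < δ ^ 2 := by
            rw [← norm_pow, h1, norm_inv]
            exact inv_lt_of_inv_lt₀ (by positivity) hQ.2
          simp only [Function.comp_apply, OnePoint.elim_some, dist_zero_right, norm_norm]
          exact lt_of_pow_lt_pow_left₀ 2 hδ.le h2
        · apply ContinuousAt.continuousWithinAt
          rw [OnePoint.continuousAt_coe]
          exact hσV.continuousAt (hVo.mem_nhds hQ)
      continuousOn_invFun := hinvcont } with hφdef
  have hφ : ∀ Q : AffineCurve R, φ Q = σ Q := fun _ => rfl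
  have hφs : ∀ s, φ.symm s = inv s := fun _ => rfl
  refine ⟨φ, √ρ, fun e s => -s ^ (2 * (g - 1 - e)) / (2 * w (s ^ 2)), Real.sqrt_pos.2 hρ,
    Set.mem_insert _ _, rfl, rfl, ?_, ?_, ?_, ?_⟩
  · intro e _
    refine DifferentiableOn.div (by fun_prop) (hwd'.const_mul 2) fun s hs => ?_
    exact mul_ne_zero two_ne_zero (hw _ (hball s hs)).2
  · intro s hs h0
    exact ⟨_, hinvne s hs h0, hyne s hs h0⟩
  · intro Q hQ _
    have hQV : Q ∈ V := by rw [← hUpre]; exact hQ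
    have hs := hσball Q hQV
    have h0 := hσne Q hQV
    rw [hφ]
    refine ⟨-2 / σ Q ^ 3, div_ne_zero (by norm_num) (pow_ne_zero 3 h0), ?_, fun e he => ?_⟩
    · have hev : (fun s => lamCoord (φ.symm s)) =ᶠ[𝓝 (σ Q)] x := by
        filter_upwards [Metric.isOpen_ball.mem_nhds hs, isOpen_compl_singleton.mem_nhds h0]
          with s h1 h2
        rw [hφs, hinvne s h1 h2]; rfl
      refine HasDerivAt.congr_of_eventuallyEq ?_ hev
      refine ((hasDerivAt_pow 2 (σ Q)).inv (pow_ne_zero 2 h0)).congr_deriv ?_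
      field_simp; ring
    · rw [← hxσ Q hQV, ← hyσ Q hQV]
      simp only [hx, hy, inv_pow, ← pow_mul]
      set s := σ Q with hsdef
      have h6 := (hw _ (hball s hs)).2
      obtain ⟨d, rfl⟩ := Nat.exists_eq_add_of_lt he
      rw [show e + d + 1 - 1 - e = d by lia]
      field_simp
      ring
  · intro Q hQ _
    exact absurd hQ (OnePoint.coe_ne_infty Q)

/-- Every point of the surface is the centre of a chart. -/
lemma exists_chart {R : ℂ[X]} (hR : Squarefree R) {g : ℕ} (hdeg : R.natDegree = 2 * g + 1)
    (P : Surface R) : ∃ φ ρ h, IsChart g P φ ρ h := by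
  induction P using OnePoint.rec with
  | infty => exact exists_chart_infty hdeg
  | coe P =>
    by_cases hP : P.1.2 = 0
    · exact exists_chart_of_eq hR g P hP
    · exact exists_chart_of_ne g P hP

/-! ### Local primitives -/

lemma IsChart.symm_center {R : ℂ[X]} {g : ℕ} {P : Surface R}
    {φ : OpenPartialHomeomorph (Surface R) ℂ} {ρ : ℝ} {h : ℕ → ℂ → ℂ} (hc : IsChart g P φ ρ h) :
    φ.symm 0 = P := by
  have h := φ.left_inv hc.mem_source
  rwa [hc.map_center] at h

/-- Passes from the chart coordinate to another coordinate x: a nonzero derivative makes the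
increments of s bounded by those of x. -/
lemma isLittleO_of_chart {R : ℂ[X]} {φ : OpenPartialHomeomorph (Surface R) ℂ} {G : ℂ → ℂ}
    {x : Surface R → ℂ} {Q : AffineCurve R} (hQ : (Q : Surface R) ∈ φ.source) {c d k : ℂ}
    (hG : HasDerivAt G c (φ Q)) (hx : HasDerivAt (fun s => x (φ.symm s)) d (φ Q)) (hd : d ≠ 0)
    (hk : c = k * d) :
    (fun Q' : AffineCurve R => G (φ Q') - G (φ Q) - k * (x Q' - x Q)) =o[𝓝 Q]
      fun Q' : AffineCurve R => x Q' - x Q := by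
  have h1 : (fun s => G s - G (φ Q) - k * (x (φ.symm s) - x (φ.symm (φ Q)))) =o[𝓝 (φ Q)]
      fun s => s - φ Q := by
    have := hasDerivAt_iff_isLittleO.1 (hG.sub (hx.const_mul k))
    refine this.congr_left fun s => ?_
    simp only [hk, sub_self, smul_zero, sub_zero, Pi.sub_apply]
    ring
  have h2 : (fun s => s - φ Q) =O[𝓝 (φ Q)] fun s => x (φ.symm s) - x (φ.symm (φ Q)) := by
    have h : Filter.Tendsto (fun s => (s, φ Q)) (𝓝 (φ Q)) (𝓝 (φ Q) ×ˢ pure (φ Q)) :=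
      Filter.tendsto_id.prodMk (Filter.tendsto_pure_pure (fun _ : ℂ => φ Q) 0 |>.comp
        (Filter.tendsto_pure.2 (Filter.Eventually.of_forall fun _ => rfl)))
    exact (HasDerivAtFilter.isTheta_sub hx hd).isBigO_symm.comp_tendsto h
  have h3 : Filter.Tendsto (fun Q' : AffineCurve R => φ Q') (𝓝 Q) (𝓝 (φ Q)) :=
    (φ.continuousAt hQ).tendsto.comp OnePoint.continuous_coe.continuousAt
  have h4 := (h1.trans_isBigO h2).comp_tendsto h3
  have h5 : ∀ᶠ Q' : AffineCurve R in 𝓝 Q, φ.symm (φ Q') = Q' := by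
    filter_upwards [OnePoint.continuous_coe.continuousAt.preimage_mem_nhds
      (φ.open_source.mem_nhds hQ)] with Q' hQ'
    exact φ.left_inv hQ'
  rw [φ.left_inv hQ] at h4
  refine h4.congr' ?_ ?_ <;> filter_upwards [h5] with Q' hQ' <;> simp [hQ']

lemma _root_.Squarefree.derivative_eval_ne_zero {R : ℂ[X]} (hR : Squarefree R) {x : ℂ}
    (hx : R.eval x = 0) : (derivative R).eval x ≠ 0 := by
  have := (PerfectField.separable_iff_squarefree.2 hR).aeval_derivative_ne_zero (x := x)
    (by simpa using hx)
  simpa using this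

/-- A holomorphic function on a disc has a primitive, which is pulled back by the chart. The second
clause records its derivative in ξ at a branch point, where 2ξ dξ = -R' dλ turns dλ / (4ξ) into dξ /
(-2R'). -/
lemma IsChart.exists_primitive {R : ℂ[X]} (hR : Squarefree R) {g : ℕ} {P : Surface R}
    {φ : OpenPartialHomeomorph (Surface R) ℂ} {ρ : ℝ} {h : ℕ → ℂ → ℂ} (hc : IsChart g P φ ρ h)
    {e : ℕ} (he : e < g) : ∃ f, IsPrimitiveOn R e f φ.source ∧
      ∀ Q : AffineCurve R, (Q : Surface R) = P → Q.1.2 = 0 →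
        (fun Q' : AffineCurve R =>
          f Q' - f Q - Q.1.1 ^ e / (-2 * (derivative R).eval Q.1.1) * (Q'.1.2 - Q.1.2))
          =o[𝓝 Q] fun Q' : AffineCurve R => Q'.1.2 - Q.1.2 := by
  obtain ⟨G, hG⟩ := (hc.differentiableOn e he).isExactOn_ball
  have hmap : ∀ y ∈ φ.source, φ y ∈ Metric.ball (0 : ℂ) ρ := fun y hy => by
    rw [← hc.target_eq]; exact φ.map_source hy
  refine ⟨fun y => G (φ y), ⟨?_, fun Q hQ hQ0 => ?_⟩, fun Q hQ hQ0 => ?_⟩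
  · exact ContinuousOn.comp (fun s hs => (hG s hs).continuousAt.continuousWithinAt)
      φ.continuousOn hmap
  · obtain ⟨d, hd, hder, hh⟩ := hc.hasDerivAt Q hQ hQ0
    exact isLittleO_of_chart (x := lamCoord) hQ (hG _ (hmap _ hQ)) hder hd (hh e he)
  · have hQs : (Q : Surface R) ∈ φ.source := hQ ▸ hc.mem_source
    have hφQ : φ Q = 0 := by rw [hQ, hc.map_center]
    obtain ⟨d, hd, hder, hh⟩ := hc.branch Q hQ hQ0
    have h1 := hh e he
    refine isLittleO_of_chart (x := xiCoord) hQs (hG _ (hmap _ hQs)) (by rw [hφQ]; exact hder) hd ?_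
    rw [hφQ]
    have hR' := hR.derivative_eval_ne_zero (by simpa [hQ0] using Q.2)
    field_simp
    linear_combination -h1

/-- The centre is a removable singularity, and the derivative there vanishes by continuity. -/
lemma eventually_eq_const_of_hasDerivAt_zero {k : ℂ → ℂ} {r : ℝ}
    (hcont : ContinuousOn k (Metric.ball 0 r))
    (hk : ∀ s ∈ Metric.ball (0 : ℂ) r, s ≠ 0 → HasDerivAt k 0 s) {s : ℂ}
    (hs : s ∈ Metric.ball (0 : ℂ) r) : k s = k 0 := by
  have hr : 0 < r := (norm_nonneg s).trans_lt (mem_ball_zero_iff.1 hs)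
  have h0 : (0 : ℂ) ∈ Metric.ball (0 : ℂ) r := Metric.mem_ball_self hr
  have hnhds := Metric.isOpen_ball.mem_nhds h0
  have hd : DifferentiableOn ℂ k (Metric.ball 0 r) :=
    (Complex.differentiableOn_compl_singleton_and_continuousAt_iff hnhds).1
      ⟨fun s hs => (hk s hs.1 hs.2).differentiableAt.differentiableWithinAt,
        hcont.continuousAt hnhds⟩
  have hd' : deriv k 0 = 0 := by
    have h1 := ((hd.deriv Metric.isOpen_ball).continuousOn.continuousAt hnhds).tendsto.mono_left
      (nhdsWithin_le_nhds (s := {0}ᶜ))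
    refine tendsto_nhds_unique h1 (tendsto_const_nhds.congr' ?_)
    filter_upwards [self_mem_nhdsWithin, mem_nhdsWithin_of_mem_nhds hnhds] with s h2 h3
    exact (hk s h3 h2).deriv.symm
  refine IsOpen.is_const_of_deriv_eq_zero Metric.isOpen_ball
    (convex_ball 0 r).isPreconnected hd (fun s hs => ?_) hs h0
  by_cases h : s = 0
  · subst h; exact hd'
  · exact (hk s hs h).deriv

/-- In a chart the difference has zero derivative off the centre, the only place where ξ = 0 or λ =
∞ can occur, and it is continuous there. -/
lemma IsChart.primitive_sub_const {R : ℂ[X]} {g : ℕ} {P : Surface R}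
    {φ : OpenPartialHomeomorph (Surface R) ℂ} {ρ : ℝ} {h : ℕ → ℂ → ℂ} (hc : IsChart g P φ ρ h)
    {e : ℕ} {f₁ f₂ : Surface R → ℂ} {U : Set (Surface R)} (hU : IsOpen U) (hP : P ∈ U)
    (h₁ : IsPrimitiveOn R e f₁ U) (h₂ : IsPrimitiveOn R e f₂ U) :
    ∀ᶠ y in 𝓝 P, f₁ y - f₂ y = f₁ P - f₂ P := by
  have hopen : IsOpen (Metric.ball (0 : ℂ) ρ ∩ φ.symm ⁻¹' U) := by
    have := φ.symm.continuousOn.isOpen_inter_preimage φ.symm.open_source hU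
    rwa [φ.symm_source, hc.target_eq] at this
  have h0 : (0 : ℂ) ∈ Metric.ball (0 : ℂ) ρ ∩ φ.symm ⁻¹' U :=
    ⟨Metric.mem_ball_self hc.pos, by rw [Set.mem_preimage, hc.symm_center]; exact hP⟩
  obtain ⟨r, hr, hball⟩ := Metric.isOpen_iff.1 hopen 0 h0
  have hsymm : ∀ s ∈ Metric.ball (0 : ℂ) r, ContinuousAt φ.symm s := fun s hs =>
    φ.symm.continuousAt (by rw [φ.symm_source, hc.target_eq]; exact (hball hs).1)
  set k : ℂ → ℂ := fun s => f₁ (φ.symm s) - f₂ (φ.symm s) with hk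
  have hcont : ContinuousOn k (Metric.ball 0 r) := by
    intro s hs
    have hn : U ∈ 𝓝 (φ.symm s) := hU.mem_nhds (hball hs).2
    exact (((h₁.1.continuousAt hn).comp (hsymm s hs)).sub
      ((h₂.1.continuousAt hn).comp (hsymm s hs))).continuousWithinAt
  have hder : ∀ s ∈ Metric.ball (0 : ℂ) r, s ≠ 0 → HasDerivAt k 0 s := by
    intro s hs hs0
    obtain ⟨Q, hQ, hQ0⟩ := hc.symm_of_ne s (hball hs).1 hs0
    have hQU : (Q : Surface R) ∈ U := hQ ▸ (hball hs).2
    have hst : s ∈ φ.target := by rw [hc.target_eq]; exact (hball hs).1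
    have hQs : (Q : Surface R) ∈ φ.source := hQ ▸ φ.map_target hst
    have hφQ : φ Q = s := by rw [← hQ, φ.right_inv hst]
    obtain ⟨d, -, hd, -⟩ := hc.hasDerivAt Q hQs hQ0
    rw [hφQ] at hd
    have h3 : (fun y : Surface R => f₁ y - f₂ y - (f₁ Q - f₂ Q)) =o[𝓝 (Q : Surface R)]
        fun y => lamCoord y - lamCoord (Q : Surface R) := by
      rw [OnePoint.nhds_coe_eq, Asymptotics.isLittleO_map]
      refine ((h₁.2 Q hQU hQ0).sub (h₂.2 Q hQU hQ0)).congr_left fun y => ?_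
      simp only [Function.comp_apply]; ring
    rw [← hQ] at h3
    have h4 := h3.comp_tendsto (hsymm s hs).tendsto
    have h5 := h4.trans_isBigO hd.isBigO_sub
    rw [hasDerivAt_iff_isLittleO]
    refine h5.congr_left fun y => ?_
    simp [hk]
  have hev : ∀ᶠ y in 𝓝 P, φ y ∈ Metric.ball (0 : ℂ) r := by
    refine (φ.continuousAt hc.mem_source).preimage_mem_nhds ?_
    rw [hc.map_center]
    exact Metric.ball_mem_nhds 0 hr
  filter_upwards [hev, φ.open_source.mem_nhds hc.mem_source] with y hy hys
  have := eventually_eq_const_of_hasDerivAt_zero hcont hder hy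
  simpa [hk, φ.left_inv hys, hc.symm_center] using this

lemma IsChart.exists_path {R : ℂ[X]} {g : ℕ} {P : Surface R}
    {φ : OpenPartialHomeomorph (Surface R) ℂ} {ρ : ℝ} {h : ℕ → ℂ → ℂ} (hc : IsChart g P φ ρ h)
    {y : Surface R} (hy : y ∈ φ.source) : ∃ γ : Path P y, ∀ t, γ t ∈ φ.source := by
  have hb : ∀ t : unitInterval, ((t : ℝ) : ℂ) * φ y ∈ φ.target := by
    intro t
    have h1 : φ y ∈ φ.target := φ.map_source hy
    rw [hc.target_eq, mem_ball_zero_iff] at h1 ⊢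
    rw [norm_mul, Complex.norm_real, Real.norm_eq_abs, abs_of_nonneg t.2.1]
    exact (mul_le_of_le_one_left (norm_nonneg _) t.2.2).trans_lt h1
  refine ⟨{ toFun := fun t => φ.symm (((t : ℝ) : ℂ) * φ y)
            continuous_toFun := ?_
            source' := by simp [hc.symm_center]
            target' := by simp [φ.left_inv hy] }, fun t => φ.map_target (hb t)⟩
  exact φ.symm.continuousOn.comp_continuous (by fun_prop) hb

/-- The differential `λ^e dλ / (4 ξ)` has primitives near every point of the surface, unique up
to constants. -/
structure HasPrimitives (R : ℂ[X]) (e : ℕ) : Prop where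
  exists_primitive : ∀ P : Surface R, ∃ U f, IsOpen U ∧ P ∈ U ∧ IsPrimitiveOn R e f U
  sub_const : ∀ (P : Surface R) (U : Set (Surface R)) (f₁ f₂ : Surface R → ℂ), IsOpen U → P ∈ U →
    IsPrimitiveOn R e f₁ U → IsPrimitiveOn R e f₂ U →
    ∀ᶠ y in 𝓝 P, f₁ y - f₂ y = f₁ P - f₂ P

lemma hasPrimitives {R : ℂ[X]} (hR : Squarefree R) {g : ℕ} (hdeg : R.natDegree = 2 * g + 1)
    {e : ℕ} (he : e < g) : HasPrimitives R e := by
  constructor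
  · intro P
    obtain ⟨φ, ρ, h, hc⟩ := exists_chart hR hdeg P
    obtain ⟨f, hf, -⟩ := hc.exists_primitive hR he
    exact ⟨φ.source, f, φ.open_source, hc.mem_source, hf⟩
  · intro P U f₁ f₂ hU hP h₁ h₂
    obtain ⟨φ, ρ, h, hc⟩ := exists_chart hR hdeg P
    exact hc.primitive_sub_const hU hP h₁ h₂

lemma IsPrimitiveOn.mono {R : ℂ[X]} {e : ℕ} {f : Surface R → ℂ} {U V : Set (Surface R)}
    (h : IsPrimitiveOn R e f U) (hVU : V ⊆ U) : IsPrimitiveOn R e f V :=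
  ⟨h.1.mono hVU, fun P hP => h.2 P (hVU hP)⟩

lemma IsPrimitiveOn.add_const {R : ℂ[X]} {e : ℕ} {f : Surface R → ℂ} {U : Set (Surface R)}
    (h : IsPrimitiveOn R e f U) (c : ℂ) : IsPrimitiveOn R e (fun y => f y + c) U := by
  refine ⟨h.1.add continuousOn_const, fun P hP h0 => (h.2 P hP h0).congr_left fun Q => ?_⟩
  ring

/-! ### Primitives along paths -/

lemma IsPrimitiveAlong.comp {R : ℂ[X]} {e : ℕ} {P Q P' Q' : Surface R} {γ : Path P Q}
    {γ' : Path P' Q'} {F : unitInterval → ℂ} (h : IsPrimitiveAlong e γ F)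
    {r : unitInterval → unitInterval} (hr : Continuous r) (hγ : ∀ t, γ' t = γ (r t)) :
    IsPrimitiveAlong e γ' (F ∘ r) := by
  intro t
  obtain ⟨U, hU, hmem, f, hf, hev⟩ := h (r t)
  refine ⟨U, hU, by rw [hγ]; exact hmem, f, hf, ?_⟩
  filter_upwards [hr.continuousAt.eventually hev] with s hs
  rw [Function.comp_apply, hs, hγ]

lemma isPrimitiveAlong_of_subset {R : ℂ[X]} {e : ℕ} {P Q : Surface R} (γ : Path P Q)
    {U : Set (Surface R)} (hU : IsOpen U) (hγ : ∀ t, γ t ∈ U) {f : Surface R → ℂ}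
    (hf : IsPrimitiveOn R e f U) : IsPrimitiveAlong e γ fun t => f (γ t) :=
  fun t => ⟨U, hU, hγ t, f, hf, Filter.Eventually.of_forall fun _ => rfl⟩

lemma IsPrimitiveAlong.sub_eq {R : ℂ[X]} {e : ℕ} (H : HasPrimitives R e) {P Q : Surface R}
    {γ : Path P Q} {F₁ F₂ : unitInterval → ℂ} (h₁ : IsPrimitiveAlong e γ F₁)
    (h₂ : IsPrimitiveAlong e γ F₂) : F₁ 1 - F₁ 0 = F₂ 1 - F₂ 0 := by
  have hloc : IsLocallyConstant fun t => F₁ t - F₂ t := by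
    rw [IsLocallyConstant.iff_eventually_eq]
    intro t
    obtain ⟨U₁, hU₁, hm₁, f₁, hf₁, he₁⟩ := h₁ t
    obtain ⟨U₂, hU₂, hm₂, f₂, hf₂, he₂⟩ := h₂ t
    have hev := H.sub_const (γ t) (U₁ ∩ U₂) f₁ f₂ (hU₁.inter hU₂) ⟨hm₁, hm₂⟩
      (hf₁.mono Set.inter_subset_left) (hf₂.mono Set.inter_subset_right)
    filter_upwards [he₁, he₂, γ.continuous.continuousAt.eventually hev] with s h3 h4 h5
    rw [h3, h4, h5, he₁.self_of_nhds, he₂.self_of_nhds]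
  have := hloc.apply_eq_of_preconnectedSpace 1 0
  linear_combination this

lemma IsPrimitiveAlong.pathIntegral_eq {R : ℂ[X]} {e : ℕ} (H : HasPrimitives R e)
    {P Q : Surface R} {γ : Path P Q} {F : unitInterval → ℂ} (h : IsPrimitiveAlong e γ F) :
    pathIntegral e γ = F 1 - F 0 := by
  have hex : ∃ F, IsPrimitiveAlong e γ F := ⟨F, h⟩
  rw [pathIntegral, dif_pos hex]
  exact IsPrimitiveAlong.sub_eq H hex.choose_spec h

/-- The complex numbers with the discrete topology. -/
structure DiscreteComplex where
  /-- the underlying complex number -/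
  val : ℂ

instance : TopologicalSpace DiscreteComplex := ⊥

instance : DiscreteTopology DiscreteComplex := ⟨rfl⟩

/-- The open sets with a primitive of `λ^e dλ / (4 ξ)`. -/
abbrev PrimitiveIndex (R : ℂ[X]) (e : ℕ) :=
  {i : Set (Surface R) × (Surface R → ℂ) // IsOpen i.1 ∧ IsPrimitiveOn R e i.2 i.1}

/-- The covering of the surface by the germs of primitives of `λ^e dλ / (4 ξ)`. -/
def primitiveBundle {R : ℂ[X]} {e : ℕ} (H : HasPrimitives R e) :
    FiberBundleCore (PrimitiveIndex R e) (Surface R) DiscreteComplex where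
  baseSet i := i.1.1
  isOpen_baseSet i := i.2.1
  indexAt P := ⟨((H.exists_primitive P).choose, (H.exists_primitive P).choose_spec.choose),
    (H.exists_primitive P).choose_spec.choose_spec.1,
    (H.exists_primitive P).choose_spec.choose_spec.2.2⟩
  mem_baseSet_at P := (H.exists_primitive P).choose_spec.choose_spec.2.1
  -- The coordinate v over i stands for the germ of f_i plus v. Transition constants are locally
  -- constant by uniqueness of primitives, which gives continuity for the discrete fibre.
  coordChange i j x v := ⟨v.val + i.1.2 x - j.1.2 x⟩
  coordChange_self i x _ v := by simp
  continuousOn_coordChange i j := by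
    rintro ⟨x, v⟩ ⟨hx, -⟩
    apply ContinuousAt.continuousWithinAt
    have hev := H.sub_const x (i.1.1 ∩ j.1.1) i.1.2 j.1.2 (i.2.1.inter j.2.1) hx
      (i.2.2.mono Set.inter_subset_left) (j.2.2.mono Set.inter_subset_right)
    have hv : ∀ᶠ w : DiscreteComplex in 𝓝 v, w = v := by rw [nhds_discrete]; exact rfl
    refine (continuousAt_const (y := (⟨v.val + i.1.2 x - j.1.2 x⟩ : DiscreteComplex))).congr ?_
    filter_upwards [hev.prod_nhds hv] with p hp
    rw [hp.2, DiscreteComplex.mk.injEq]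
    linear_combination -hp.1
  coordChange_comp i j k x _ v := by
    rw [DiscreteComplex.mk.injEq]; ring

lemma isCoveringMap_primitiveBundle {R : ℂ[X]} {e : ℕ} (H : HasPrimitives R e) :
    IsCoveringMap (Bundle.TotalSpace.proj : (primitiveBundle H).TotalSpace → Surface R) :=
  FiberBundle.isCoveringMap

/-- The value of the germ `v` of a primitive. -/
def germValue {R : ℂ[X]} {e : ℕ} (H : HasPrimitives R e) (v : (primitiveBundle H).TotalSpace) :
    ℂ := DiscreteComplex.val v.2 + ((primitiveBundle H).indexAt v.1).1.2 v.1

/-- In a trivialization the fibre coordinate of a continuous lift is locally constant, so the value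
of the germ is a fixed local primitive plus a constant. -/
lemma isPrimitiveAlong_lift {R : ℂ[X]} {e : ℕ} (H : HasPrimitives R e) {P Q : Surface R}
    (γ : Path P Q) (Γ : C(unitInterval, (primitiveBundle H).TotalSpace))
    (hΓ : ∀ t, (Γ t).proj = γ t) : IsPrimitiveAlong e γ fun t => germValue H (Γ t) := by
  intro t
  set i := (primitiveBundle H).indexAt (γ t) with hi
  have hmem : γ t ∈ i.1.1 := (primitiveBundle H).mem_baseSet_at (γ t)
  have hcont : ContinuousAt (fun s => ((primitiveBundle H).localTriv i (Γ s)).2) t := by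
    have h1 : Γ t ∈ ((primitiveBundle H).localTriv i).source := by
      change (Γ t).proj ∈ i.1.1
      rw [hΓ]; exact hmem
    exact continuous_snd.continuousAt.comp
      ((((primitiveBundle H).localTriv i).continuousAt h1).comp Γ.continuous.continuousAt)
  have hev : ∀ᶠ s in 𝓝 t, ((primitiveBundle H).localTriv i (Γ s)).2 =
      ((primitiveBundle H).localTriv i (Γ t)).2 := by
    have := hcont.tendsto
    rw [nhds_discrete DiscreteComplex, Filter.tendsto_pure] at this
    exact this
  have hval : ∀ s, germValue H (Γ s) =
      i.1.2 (γ s) + DiscreteComplex.val ((primitiveBundle H).localTriv i (Γ s)).2 := by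
    intro s
    change _ = i.1.2 (γ s) + (DiscreteComplex.val (Γ s).2 +
      ((primitiveBundle H).indexAt (Γ s).1).1.2 (Γ s).1 - i.1.2 (Γ s).1)
    rw [germValue, ← hΓ s]; ring
  refine ⟨i.1.1, i.2.1, hmem, _,
    i.2.2.add_const (DiscreteComplex.val ((primitiveBundle H).localTriv i (Γ t)).2), ?_⟩
  filter_upwards [hev] with s hs
  rw [hval, hs]

lemma exists_germ {R : ℂ[X]} {e : ℕ} (H : HasPrimitives R e) (P : Surface R) :
    ∃ v : (primitiveBundle H).TotalSpace, v.proj = P := ⟨⟨P, (⟨0⟩ : DiscreteComplex)⟩, rfl⟩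

lemma exists_isPrimitiveAlong {R : ℂ[X]} {e : ℕ} (H : HasPrimitives R e) {P Q : Surface R}
    (γ : Path P Q) : ∃ F, IsPrimitiveAlong e γ F := by
  obtain ⟨v, hv⟩ := exists_germ H P
  obtain ⟨Γ, hΓ, -⟩ := (isCoveringMap_primitiveBundle H).exists_path_lifts γ.toContinuousMap v
    (by rw [hv]; exact γ.source)
  exact ⟨_, isPrimitiveAlong_lift H γ Γ fun t => congrFun hΓ t⟩

/-- Homotopy lifting: lifts of homotopic paths from the same germ end in the same germ. -/
lemma pathIntegral_eq_of_homotopic {R : ℂ[X]} {e : ℕ} (H : HasPrimitives R e) {P Q : Surface R}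
    {γ γ' : Path P Q} (h : γ.Homotopic γ') : pathIntegral e γ = pathIntegral e γ' := by
  obtain ⟨v, hv⟩ := exists_germ H P
  have cov := isCoveringMap_primitiveBundle H
  have h₀ : γ.toContinuousMap 0 = v.proj := by rw [hv]; exact γ.source
  have h₁ : γ'.toContinuousMap 0 = v.proj := by rw [hv]; exact γ'.source
  have hend := cov.liftPath_apply_one_eq_of_homotopicRel h v h₀ h₁
  have e₀ := (isPrimitiveAlong_lift H γ (cov.liftPath γ.toContinuousMap v h₀)
    fun t => congrFun (cov.liftPath_lifts γ.toContinuousMap v h₀) t).pathIntegral_eq H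
  have e₁ := (isPrimitiveAlong_lift H γ' (cov.liftPath γ'.toContinuousMap v h₁)
    fun t => congrFun (cov.liftPath_lifts γ'.toContinuousMap v h₁) t).pathIntegral_eq H
  rw [e₀, e₁, hend, cov.liftPath_zero, cov.liftPath_zero]

lemma pathIntegral_trans {R : ℂ[X]} {e : ℕ} (H : HasPrimitives R e) {P Q S : Surface R}
    (γ : Path P Q) (γ' : Path Q S) :
    pathIntegral e (γ.trans γ') = pathIntegral e γ + pathIntegral e γ' := by
  obtain ⟨F, hF⟩ := exists_isPrimitiveAlong H (γ.trans γ')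
  set r₁ : unitInterval → unitInterval := fun t =>
    ⟨(t : ℝ) / 2, by have := t.2.1; positivity, by have := t.2.2; linarith⟩ with hr₁
  set r₂ : unitInterval → unitInterval := fun t =>
    ⟨(1 + (t : ℝ)) / 2, by have := t.2.1; positivity, by have := t.2.2; linarith⟩ with hr₂
  have h₁ : IsPrimitiveAlong e γ (F ∘ r₁) := by
    refine hF.comp (Continuous.subtype_mk (by fun_prop) _) fun t => ?_
    have ht : ((r₁ t : unitInterval) : ℝ) ≤ 1 / 2 := by
      have := t.2.2; simp only [hr₁]; linarith
    rw [Path.trans_apply, dif_pos ht]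
    congr 1; ext; simp only [hr₁]; ring
  have h₂ : IsPrimitiveAlong e γ' (F ∘ r₂) := by
    refine hF.comp (Continuous.subtype_mk (by fun_prop) _) fun t => ?_
    by_cases ht : ((r₂ t : unitInterval) : ℝ) ≤ 1 / 2
    -- The second half starts at parameter 1/2, which `Path.trans` assigns to the first path. There
    -- both equal Q.
    · have h0 : (t : ℝ) = 0 := le_antisymm (by simp only [hr₂] at ht; linarith) t.2.1
      have h0' : t = 0 := Subtype.ext h0
      have e1 : γ' t = Q := by rw [h0', γ'.source]
      rw [Path.trans_apply, dif_pos ht, e1]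
      refine γ.target.symm.trans (congrArg γ ?_)
      ext; simp only [hr₂]; rw [h0]; norm_num
    · rw [Path.trans_apply, dif_neg ht]
      congr 1; ext; simp only [hr₂]; ring
  rw [hF.pathIntegral_eq H, h₁.pathIntegral_eq H, h₂.pathIntegral_eq H]
  have e0 : r₁ 0 = 0 := by ext; simp [hr₁]
  have e1 : r₁ 1 = r₂ 0 := by ext; simp [hr₁, hr₂]
  have e2 : r₂ 1 = 1 := by ext; simp [hr₂]
  simp only [Function.comp_apply, e0, e1, e2]
  ring

lemma pathIntegral_symm {R : ℂ[X]} {e : ℕ} (H : HasPrimitives R e) {P Q : Surface R}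
    (γ : Path P Q) : pathIntegral e γ.symm = -pathIntegral e γ := by
  obtain ⟨F, hF⟩ := exists_isPrimitiveAlong H γ
  have h := hF.comp (γ' := γ.symm) unitInterval.continuous_symm fun t => rfl
  rw [hF.pathIntegral_eq H, h.pathIntegral_eq H]
  simp

lemma pathIntegral_of_subset {R : ℂ[X]} {e : ℕ} (H : HasPrimitives R e) {P Q : Surface R}
    (γ : Path P Q) {U : Set (Surface R)} (hU : IsOpen U) (hγ : ∀ t, γ t ∈ U)
    {f : Surface R → ℂ} (hf : IsPrimitiveOn R e f U) : pathIntegral e γ = f Q - f P := by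
  rw [(isPrimitiveAlong_of_subset γ hU hγ hf).pathIntegral_eq H, γ.target, γ.source]

/-! ### Closed paths have integrals in the period lattice -/

lemma intOmega_trans {R : ℂ[X]} {N : ℕ} (H : ∀ e < N - 1, HasPrimitives R e) {P₀ : Surface R}
    (a : Fin (N - 1) → Path P₀ P₀) {P Q S : Surface R} (γ : Path P Q) (γ' : Path Q S) :
    intOmega a (γ.trans γ') = intOmega a γ + intOmega a γ' := by
  rw [intOmega, intOmega, intOmega, ← Matrix.mulVec_add]
  congr 1
  funext j
  exact pathIntegral_trans (H _ (by have := j.2; lia)) γ γ'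

lemma intOmega_symm {R : ℂ[X]} {N : ℕ} (H : ∀ e < N - 1, HasPrimitives R e) {P₀ : Surface R}
    (a : Fin (N - 1) → Path P₀ P₀) {P Q : Surface R} (γ : Path P Q) :
    intOmega a γ.symm = -intOmega a γ := by
  rw [intOmega, intOmega, ← Matrix.mulVec_neg]
  congr 1
  funext j
  exact pathIntegral_symm (H _ (by have := j.2; lia)) γ

lemma intOmega_eq_of_homotopic {R : ℂ[X]} {N : ℕ} (H : ∀ e < N - 1, HasPrimitives R e)
    {P₀ : Surface R} (a : Fin (N - 1) → Path P₀ P₀) {P Q : Surface R} {γ γ' : Path P Q}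
    (h : γ.Homotopic γ') : intOmega a γ = intOmega a γ' := by
  rw [intOmega, intOmega]
  congr 1
  funext j
  exact pathIntegral_eq_of_homotopic (H _ (by have := j.2; lia)) h

/-- Integration of `ω` as a homomorphism on the fundamental group. -/
def periodHom {R : ℂ[X]} {N : ℕ} (H : ∀ e < N - 1, HasPrimitives R e) {P₀ : Surface R}
    (a : Fin (N - 1) → Path P₀ P₀) :
    FundamentalGroup (Surface R) P₀ →* Multiplicative (Fin (N - 1) → ℂ) :=
  MonoidHom.mk' (fun p => Quotient.lift (fun γ : Path P₀ P₀ => Multiplicative.ofAdd (intOmega a γ))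
    (fun γ γ' h => congrArg _ (intOmega_eq_of_homotopic H a h)) p.toPath) fun p q => by
      induction p, q using Path.Homotopic.Quotient.ind₂ with | mk γ γ' =>
      -- Multiplication in `FundamentalGroup` concatenates in the opposite order. The target is
      -- commutative, so this is harmless.
      change Multiplicative.ofAdd (intOmega a (γ'.trans γ)) = _
      rw [intOmega_trans H, add_comm]; rfl

/-- Integration is a homomorphism to an abelian group, hence factors through H_1, and it maps the
generators a_j, b_j into the lattice. -/
lemma intOmega_mem_periodLattice {R : ℂ[X]} {N : ℕ} (H : ∀ e < N - 1, HasPrimitives R e)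
    {P₀ : Surface R} {a b : Fin (N - 1) → Path P₀ P₀} (hab : GenerateHomology a b)
    (γ : Path P₀ P₀) : intOmega a γ ∈ periodLattice a b := by
  set Ψ := Abelianization.lift (periodHom H a) with hΨ
  have hval : ∀ γ : Path P₀ P₀, Ψ (homologyClass γ) = Multiplicative.ofAdd (intOmega a γ) := by
    intro γ
    rw [hΨ, homologyClass, Abelianization.lift_apply_of]
    rfl
  have hle : Subgroup.closure (Set.range (fun j => homologyClass (a j)) ∪
      Set.range (fun j => homologyClass (b j))) ≤
      (AddSubgroup.toSubgroup (periodLattice a b)).comap Ψ := by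
    rw [Subgroup.closure_le]
    rintro _ (⟨j, rfl⟩ | ⟨j, rfl⟩)
    · rw [SetLike.mem_coe, Subgroup.mem_comap, hval]
      have h : intOmega a (a j) ∈ periodLattice a b :=
        AddSubgroup.subset_closure (Or.inl ⟨j, rfl⟩)
      exact h
    · rw [SetLike.mem_coe, Subgroup.mem_comap, hval]
      have h : intOmega a (b j) ∈ periodLattice a b :=
        AddSubgroup.subset_closure (Or.inr ⟨j, rfl⟩)
      exact h
  rw [hab] at hle
  have := hle (Subgroup.mem_top (homologyClass γ))
  rw [Subgroup.mem_comap, hval] at this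
  exact this

/-- The Abel map can be computed along any path. -/
lemma abelMap_eq {R : ℂ[X]} {N : ℕ} (H : ∀ e < N - 1, HasPrimitives R e) {P₀ : Surface R}
    {a b : Fin (N - 1) → Path P₀ P₀} (hab : GenerateHomology a b) {P : Surface R}
    (γ : Path P₀ P) : abelMap a b P = (intOmega a γ : Fin (N - 1) → ℂ) := by
  have hj : Joined P₀ P := ⟨γ⟩
  rw [abelMap, dif_pos hj]
  refine QuotientAddGroup.eq.2 ?_
  -- Following one path out and the other back is a closed path at P₀.
  have := intOmega_mem_periodLattice H hab (γ.trans hj.somePath.symm)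
  rwa [intOmega_trans H, intOmega_symm H, add_comm] at this

/-! ### Paths on the affine curve -/

/-- After division by B the line is parallel to the real axis. Off that axis the principal logarithm
works. On it √x + i √(-x) does, one summand always being zero. -/
lemma exists_continuous_sqrt_affine (A B : ℂ) :
    ∃ s : ℝ → ℂ, Continuous s ∧ ∀ t : ℝ, s t ^ 2 = A + t * B := by
  by_cases hB : B = 0
  · obtain ⟨w, hw⟩ := IsAlgClosed.exists_pow_nat_eq A two_pos
    exact ⟨fun _ => w, continuous_const, fun t => by rw [hw, hB]; ring⟩
  obtain ⟨w, hw⟩ := IsAlgClosed.exists_pow_nat_eq B two_pos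
  suffices h : ∃ s : ℝ → ℂ, Continuous s ∧ ∀ t : ℝ, s t ^ 2 = A / B + t by
    obtain ⟨s, hs, h⟩ := h
    exact ⟨fun t => w * s t, by fun_prop, fun t => by rw [mul_pow, hw, h]; field_simp⟩
  by_cases him : (A / B).im = 0
  · refine ⟨fun t => (√((A / B).re + t) : ℝ) + (√(-((A / B).re + t)) : ℝ) * Complex.I,
      by fun_prop, fun t => ?_⟩
    have hAB : A / B + t = (((A / B).re + t : ℝ) : ℂ) := by
      apply Complex.ext <;> simp [him]
    rw [hAB]
    beta_reduce
    generalize (A / B).re + t = x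
    rcases le_total 0 x with hx | hx
    · rw [Real.sqrt_eq_zero_of_nonpos (neg_nonpos.2 hx), Complex.ofReal_zero, zero_mul, add_zero,
        ← Complex.ofReal_pow, Real.sq_sqrt hx]
    · rw [Real.sqrt_eq_zero_of_nonpos hx, Complex.ofReal_zero, zero_add, mul_pow, Complex.I_sq,
        ← Complex.ofReal_pow, Real.sq_sqrt (neg_nonneg.2 hx)]
      push_cast; ring
  · have him' : ∀ t : ℝ, (A / B + t).im ≠ 0 := fun t => by simpa using him
    refine ⟨fun t => Complex.exp (Complex.log (A / B + t) / 2), ?_, fun t => ?_⟩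
    · have : Continuous fun t : ℝ => Complex.log (A / B + t) :=
        Continuous.clog (by fun_prop) fun t => Or.inr (him' t)
      fun_prop
    · rw [← Complex.exp_nat_mul]
      have h0 : A / B + t ≠ 0 := fun h => him' t (by rw [h]; rfl)
      conv_rhs => rw [← Complex.exp_log h0]
      congr 1; push_cast; ring

/-- Multiply the square roots of the linear factors. The line may pass through roots of P, since no
branch is analytically continued. -/
lemma exists_continuous_sqrt_eval (P : ℂ[X]) (A B : ℂ) :
    ∃ s : ℝ → ℂ, Continuous s ∧ ∀ t : ℝ, s t ^ 2 = P.eval (A + t * B) := by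
  have key : ∀ S : Multiset ℂ, ∃ s : ℝ → ℂ, Continuous s ∧
      ∀ t : ℝ, s t ^ 2 = (S.map fun c => A + t * B - c).prod := by
    intro S
    induction S using Multiset.induction with
    | empty => exact ⟨fun _ => 1, continuous_const, fun t => by simp⟩
    | cons c S ih =>
      obtain ⟨s, hs, h⟩ := ih
      obtain ⟨r, hr, h'⟩ := exists_continuous_sqrt_affine (A - c) B
      refine ⟨fun t => r t * s t, by fun_prop, fun t => ?_⟩
      rw [Multiset.map_cons, Multiset.prod_cons, mul_pow, h, h']; ring
  obtain ⟨s, hs, h⟩ := key P.roots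
  obtain ⟨w, hw⟩ := IsAlgClosed.exists_pow_nat_eq P.leadingCoeff two_pos
  refine ⟨fun t => w * s t, by fun_prop, fun t => ?_⟩
  rw [(IsAlgClosed.splits P).eval_eq_prod_roots, mul_pow, hw, h]

/-- Lift the segment from λ(P) to r by a continuous square root of -R, with the sign adjusted to
start at P. Both sheets meet at ξ = 0, so one branch point connects all finite points. -/
lemma joined_branch_point {R : ℂ[X]} {r : ℂ} (hr : (0 : ℂ) ^ 2 + R.eval r = 0)
    (P : AffineCurve R) : Joined (P : Surface R) ((⟨(r, 0), hr⟩ : AffineCurve R) : Surface R) := by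
  obtain ⟨s, hs, h⟩ := exists_continuous_sqrt_eval (-R) P.1.1 (r - P.1.1)
  have h0 : s 0 ^ 2 = P.1.2 ^ 2 := by
    rw [h 0]
    simp only [Complex.ofReal_zero, zero_mul, add_zero, eval_neg]
    linear_combination -P.2
  obtain ⟨δ, hδ, hδ0⟩ : ∃ δ : ℂ, δ ^ 2 = 1 ∧ δ * s 0 = P.1.2 := by
    rcases sq_eq_sq_iff_eq_or_eq_neg.1 h0 with h1 | h1
    · exact ⟨1, by norm_num, by rw [h1]; ring⟩
    · exact ⟨-1, by norm_num, by rw [h1]; ring⟩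
  have h1 : s 1 = 0 := by
    have := h 1
    simp only [Complex.ofReal_one, one_mul, add_sub_cancel, eval_neg] at this
    have h2 : s 1 ^ 2 = 0 := by rw [this]; linear_combination -hr
    exact pow_eq_zero_iff two_ne_zero |>.1 h2
  have hcurve : ∀ t : unitInterval, (δ * s t) ^ 2 +
      R.eval (P.1.1 + ((t : ℝ) : ℂ) * (r - P.1.1)) = 0 := by
    intro t
    rw [mul_pow, hδ, h t, eval_neg]; ring
  refine ⟨{ toFun := fun t => ((⟨(P.1.1 + ((t : ℝ) : ℂ) * (r - P.1.1), δ * s t), hcurve t⟩ :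
              AffineCurve R) : Surface R)
            continuous_toFun := ?_
            source' := ?_
            target' := ?_ }⟩
  · exact OnePoint.continuous_coe.comp (Continuous.subtype_mk (by fun_prop) _)
  · congr 1
    apply Subtype.ext
    simp [hδ0]
  · congr 1
    apply Subtype.ext
    simp [h1]

lemma joined_affine {R : ℂ[X]} (hR : R.natDegree ≠ 0) (P Q : AffineCurve R) :
    Joined (P : Surface R) (Q : Surface R) := by
  obtain ⟨r, hr⟩ := IsAlgClosed.exists_root R fun h => hR (natDegree_eq_zero_iff_degree_le_zero.2
    h.le)
  have hr' : (0 : ℂ) ^ 2 + R.eval r = 0 := by rw [hr.eq_zero]; ring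
  exact (joined_branch_point hr' P).trans (joined_branch_point hr' Q).symm

/-! ### Local lifts of the Abel map -/

/-- Extend a path to P by one inside the chart, along which the integral is the increment of a local
primitive. -/
lemma abelMap_eq_add {R : ℂ[X]} {N : ℕ} (H : ∀ e < N - 1, HasPrimitives R e) {P₀ : Surface R}
    {a b : Fin (N - 1) → Path P₀ P₀} (hab : GenerateHomology a b) {P : Surface R}
    {φ : OpenPartialHomeomorph (Surface R) ℂ} {ρ : ℝ} {h : ℕ → ℂ → ℂ}
    (hc : IsChart (N - 1) P φ ρ h) (hP : Joined P₀ P) {f : ℕ → Surface R → ℂ}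
    (hf : ∀ e < N - 1, IsPrimitiveOn R e (f e) φ.source) {y : Surface R} (hy : y ∈ φ.source) :
    abelMap a b y = abelMap a b P + (((normMatrix a).mulVec fun j : Fin (N - 1) =>
      f (N - 2 - (j : ℕ)) y - f (N - 2 - (j : ℕ)) P : Fin (N - 1) → ℂ) : Jacobian a b) := by
  obtain ⟨γ⟩ := hP
  obtain ⟨δ, hδ⟩ := hc.exists_path hy
  rw [abelMap_eq H hab (γ.trans δ), abelMap_eq H hab γ, intOmega_trans H, QuotientAddGroup.mk_add]
  have hδi : intOmega a δ = (normMatrix a).mulVec fun j : Fin (N - 1) =>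
      f (N - 2 - (j : ℕ)) y - f (N - 2 - (j : ℕ)) P := by
    refine congrArg (normMatrix a).mulVec (funext fun j => ?_)
    have hj : N - 2 - (j : ℕ) < N - 1 := by have := j.2; lia
    exact pathIntegral_of_subset (H _ hj) δ φ.open_source hδ (hf _ hj)
  rw [hδi]

/-- A curve on the surface that is differentiable at `t₀` has a lift of its Abel image which is
differentiable at `t₀`. -/
lemma exists_abelMap_lift {R : ℂ[X]} (hR : Squarefree R) {N : ℕ}
    (hdeg : R.natDegree = 2 * (N - 1) + 1) {P₀ : AffineCurve R}
    {a b : Fin (N - 1) → Path (P₀ : Surface R) (P₀ : Surface R)} (hab : GenerateHomology a b)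
    {x y : ℝ → ℂ} {x' y' : ℂ} {t₀ : ℝ} (hx : HasDerivAt x x' t₀) (hy : HasDerivAt y y' t₀)
    (hxc : ∀ᶠ t in 𝓝 t₀, ContinuousAt x t) (hyc : ∀ᶠ t in 𝓝 t₀, ContinuousAt y t)
    (hcurve : ∀ᶠ t in 𝓝 t₀, y t ^ 2 + R.eval (x t) = 0) {w : ℕ → ℂ}
    (hw : ∀ e, y t₀ ≠ 0 → w e = x t₀ ^ e / (4 * y t₀) * x')
    (hw0 : ∀ e, y t₀ = 0 → w e = x t₀ ^ e / (-2 * (derivative R).eval (x t₀)) * y') :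
    ∃ Φ : ℝ → Fin (N - 1) → ℂ, (∀ᶠ t in 𝓝 t₀, ContinuousAt Φ t) ∧
      (∀ᶠ t in 𝓝 t₀, (Φ t : Jacobian a b) = abelMap a b (surfacePoint R (x t) (y t))) ∧
      HasDerivAt Φ ((normMatrix a).mulVec fun j => w (N - 2 - (j : ℕ))) t₀ := by
  have H : ∀ e < N - 1, HasPrimitives R e := fun e he => hasPrimitives hR hdeg he
  set p : ℝ → Surface R := fun t => surfacePoint R (x t) (y t) with hp
  have hpc : ∀ᶠ t in 𝓝 t₀, ContinuousAt p t := by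
    obtain ⟨B, hB, hBo, hB0⟩ := eventually_nhds_iff.1 (hxc.and (hyc.and hcurve))
    have : ContinuousOn p B := continuousOn_surfacePoint
      (fun t ht => (hB t ht).1.continuousWithinAt) (fun t ht => (hB t ht).2.1.continuousWithinAt)
      fun t ht => (hB t ht).2.2
    filter_upwards [hBo.mem_nhds hB0] with t ht
    exact this.continuousAt (hBo.mem_nhds ht)
  set Q : AffineCurve R := ⟨(x t₀, y t₀), hcurve.self_of_nhds⟩ with hQ
  have hpt : ∀ t, ∀ h : y t ^ 2 + R.eval (x t) = 0,
      p t = ((⟨(x t, y t), h⟩ : AffineCurve R) : Surface R) := fun t h => surfacePoint_eq h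
  have hpQ : p t₀ = Q := hpt _ _
  obtain ⟨φ, ρ, h, hc⟩ := exists_chart hR hdeg (Q : Surface R)
  have hfex : ∀ e, ∃ f, e < N - 1 → IsPrimitiveOn R e f φ.source ∧
      ∀ Q' : AffineCurve R, (Q' : Surface R) = Q → Q'.1.2 = 0 →
        (fun Q'' : AffineCurve R =>
          f Q'' - f Q' - Q'.1.1 ^ e / (-2 * (derivative R).eval Q'.1.1) * (Q''.1.2 - Q'.1.2))
          =o[𝓝 Q'] fun Q'' : AffineCurve R => Q''.1.2 - Q'.1.2 := by
    intro e
    by_cases he : e < N - 1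
    · obtain ⟨f, hf⟩ := hc.exists_primitive hR he
      exact ⟨f, fun _ => hf⟩
    · exact ⟨0, fun h => absurd h he⟩
  choose f hf using hfex
  have hsrc : ∀ᶠ t in 𝓝 t₀, p t ∈ φ.source := by
    refine hpc.self_of_nhds.preimage_mem_nhds (φ.open_source.mem_nhds ?_)
    rw [hpQ]; exact hc.mem_source
  obtain ⟨v₀, hv₀⟩ := QuotientAddGroup.mk_surjective (abelMap a b (Q : Surface R))
  have hfd : ∀ e < N - 1, HasDerivAt (fun t => f e (p t)) (w e) t₀ := by
    intro e he
    obtain ⟨B, hB, hBo, hB0⟩ := eventually_nhds_iff.1 hcurve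
    -- The curve as a map into the affine curve; the default Q only occurs away from t₀.
    have hlift : Filter.Tendsto (fun t => if h : y t ^ 2 + R.eval (x t) = 0 then
        (⟨(x t, y t), h⟩ : AffineCurve R) else Q) (𝓝 t₀) (𝓝 Q) := by
      rw [tendsto_subtype_rng]
      refine (hx.continuousAt.prodMk hy.continuousAt).tendsto.congr' ?_
      filter_upwards [hcurve] with t ht
      rw [dif_pos ht]
    -- Chain rule in whichever coordinate is available: ψ will be ξ at a branch point and λ
    -- elsewhere.
    have hcongr : ∀ {k : ℂ} {r : ℝ → ℂ} {r' : ℂ} {ψ : AffineCurve R → ℂ},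
        (fun Q' : AffineCurve R => f e Q' - f e Q - k * (ψ Q' - ψ Q)) =o[𝓝 Q]
          (fun Q' : AffineCurve R => ψ Q' - ψ Q) →
        HasDerivAt r r' t₀ → (∀ t, ∀ h : y t ^ 2 + R.eval (x t) = 0, ψ ⟨(x t, y t), h⟩ = r t) →
        HasDerivAt (fun t => f e (p t)) (k * r') t₀ := by
      intro k r r' ψ ho hr hψ
      have h1 := (ho.comp_tendsto hlift).congr'
        (f₂ := fun t => f e (p t) - f e (p t₀) - k * (r t - r t₀))
        (g₂ := fun t => r t - r t₀) (by
          filter_upwards [hcurve] with t ht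
          simp only [Function.comp_apply, dif_pos ht, hψ, hpt t ht, hpQ]
          rw [hQ, hψ]) (by
          filter_upwards [hcurve] with t ht
          simp only [Function.comp_apply, dif_pos ht, hψ]
          rw [hQ, hψ])
      have h2 := h1.trans_isBigO hr.isBigO_sub
      have h3 : HasDerivAt (fun t => f e (p t) - k * r t) 0 t₀ := by
        rw [hasDerivAt_iff_isLittleO]
        refine h2.congr_left fun t => ?_
        simp only [smul_zero, sub_zero]; ring
      have h4 := h3.add (hr.const_mul k)
      simpa [Pi.add_def] using h4
    by_cases hy0 : y t₀ = 0
    · rw [hw0 e hy0]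
      exact hcongr (ψ := fun Q => Q.1.2) ((hf e he).2 Q rfl hy0) hy fun t h => rfl
    · rw [hw e hy0]
      exact hcongr (ψ := fun Q => Q.1.1) ((hf e he).1.2 Q hc.mem_source hy0) hx fun t h => rfl
  have hlt : ∀ j : Fin (N - 1), N - 2 - (j : ℕ) < N - 1 := fun j => by have := j.2; lia
  refine ⟨fun t => v₀ + (normMatrix a).mulVec fun j =>
    f (N - 2 - (j : ℕ)) (p t) - f (N - 2 - (j : ℕ)) Q, ?_, ?_, ?_⟩
  · filter_upwards [hpc, hsrc] with t h1 h2
    refine continuousAt_const.add (ContinuousAt.comp (x := t)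
      (g := fun u => (normMatrix a).mulVec u) (by fun_prop) (continuousAt_pi.2 fun j => ?_))
    exact (((hf _ (hlt j)).1.1.continuousAt (φ.open_source.mem_nhds h2)).comp h1).sub
      continuousAt_const
  · filter_upwards [hsrc] with t ht
    rw [abelMap_eq_add H hab hc (joined_affine (by lia) P₀ Q) (fun e he => (hf e he).1) ht, ← hv₀]
    rfl
  · refine (HasDerivAt.const_add v₀ ?_)
    refine hasDerivAt_pi.2 fun i => ?_
    simp only [Matrix.mulVec, dotProduct]
    refine HasDerivAt.fun_sum fun j _ => ?_
    exact ((hfd _ (hlt j)).sub_const _).const_mul _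

/-! ### Curves in a quotient by a countable subgroup -/

section Quotient

variable {V : Type*} [NormedAddCommGroup V] {T : AddSubgroup V}

/-- The difference of two lifts maps a connected set into a countable one, hence is constant. -/
lemma lift_sub_eq (hT : (T : Set V).Countable) {J : Set ℝ} (hJ : IsPreconnected J)
    {Φ Ψ : ℝ → V} (hΦ : ContinuousOn Φ J) (hΨ : ContinuousOn Ψ J)
    (h : ∀ t ∈ J, (Φ t : V ⧸ T) = Ψ t) {s t : ℝ} (hs : s ∈ J) (ht : t ∈ J) :
    Φ s - Ψ s = Φ t - Ψ t := by
  refine hT.isTotallyDisconnected ((fun r => Φ r - Ψ r) '' J) ?_ (hJ.image _ (hΦ.sub hΨ))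
    ⟨s, hs, rfl⟩ ⟨t, ht, rfl⟩
  rintro _ ⟨r, hr, rfl⟩
  have := QuotientAddGroup.eq.1 (h r hr).symm
  rwa [neg_add_eq_sub] at this

variable [NormedSpace ℝ V]

/-- A lift that is continuous near t₀ differs near every nearby t by a constant from the lift that
is differentiable at t. It therefore has derivative v on a whole interval, where subtracting t • v
makes it constant. -/
lemma eventually_sub_smul_eq (hT : (T : Set V).Countable) {φ : ℝ → V ⧸ T} {I : Set ℝ}
    (hI : IsOpen I) {v : V}
    (h : ∀ t₀ ∈ I, ∃ Φ : ℝ → V, (∀ᶠ t in 𝓝 t₀, ContinuousAt Φ t) ∧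
      (∀ᶠ t in 𝓝 t₀, (Φ t : V ⧸ T) = φ t) ∧ HasDerivAt Φ v t₀) {t₀ : ℝ} (ht₀ : t₀ ∈ I) :
    ∀ᶠ t in 𝓝 t₀, φ t - ((t • v : V) : V ⧸ T) = φ t₀ - ((t₀ • v : V) : V ⧸ T) := by
  obtain ⟨Φ, hc, hl, -⟩ := h t₀ ht₀
  obtain ⟨r, hr, hB⟩ := Metric.eventually_nhds_iff_ball.1 (hc.and (hl.and (hI.mem_nhds ht₀)))
  have hder : ∀ t ∈ Metric.ball t₀ r, HasDerivAt Φ v t := by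
    intro t ht
    obtain ⟨Ψ, hc', hl', hd⟩ := h t (hB t ht).2.2
    obtain ⟨r', hr', hB'⟩ := Metric.eventually_nhds_iff_ball.1
      (hc'.and (hl'.and (Metric.isOpen_ball.mem_nhds ht)))
    refine (hd.add_const (Φ t - Ψ t)).congr_of_eventuallyEq ?_
    filter_upwards [Metric.ball_mem_nhds t hr'] with s hs
    have := lift_sub_eq hT (convex_ball t r').isPreconnected
      (Φ := Φ) (Ψ := Ψ) (fun s hs => (hB s (hB' s hs).2.2).1.continuousWithinAt)
      (fun s hs => (hB' s hs).1.continuousWithinAt)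
      (fun s hs => (hB s (hB' s hs).2.2).2.1.trans (hB' s hs).2.1.symm) hs
      (Metric.mem_ball_self hr')
    rw [← this]; abel
  have hconst : ∀ t ∈ Metric.ball t₀ r, Φ t - t • v = Φ t₀ - t₀ • v := by
    intro t ht
    have hd : ∀ s ∈ Metric.ball t₀ r, HasDerivAt (fun s => Φ s - s • v) 0 s := fun s hs => by
      have := (hder s hs).sub ((hasDerivAt_id s).smul_const v)
      rw [one_smul, sub_self] at this
      exact this
    exact Metric.isOpen_ball.is_const_of_deriv_eq_zero (convex_ball t₀ r).isPreconnected
      (fun s hs => (hd s hs).differentiableAt.differentiableWithinAt)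
      (fun s hs => (hd s hs).deriv) ht (Metric.mem_ball_self hr)
  filter_upwards [Metric.ball_mem_nhds t₀ hr] with t ht
  rw [← (hB t ht).2.1, ← (hB t₀ (Metric.mem_ball_self hr)).2.1, ← QuotientAddGroup.mk_sub,
    ← QuotientAddGroup.mk_sub, hconst t ht]

/-- φ(t) - t v is locally constant in the quotient, hence constant on I. So x + t v is a global
lift, and any continuous lift differs from it by a constant. -/
lemma hasConstDeriv_of_local (hT : (T : Set V).Countable) {φ : ℝ → V ⧸ T} {I : Set ℝ}
    (hI : IsOpen I) (hIp : IsPreconnected I) {t₁ : ℝ} (ht₁ : t₁ ∈ I) {v : V}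
    (h : ∀ t₀ ∈ I, ∃ Φ : ℝ → V, (∀ᶠ t in 𝓝 t₀, ContinuousAt Φ t) ∧
      (∀ᶠ t in 𝓝 t₀, (Φ t : V ⧸ T) = φ t) ∧ HasDerivAt Φ v t₀) : HasConstDeriv T φ I v := by
  have : PreconnectedSpace I := isPreconnected_iff_preconnectedSpace.1 hIp
  have hloc : IsLocallyConstant fun t : I => φ t - (((t : ℝ) • v : V) : V ⧸ T) := by
    rw [IsLocallyConstant.iff_eventually_eq]
    intro t
    exact continuous_subtype_val.continuousAt.eventually (eventually_sub_smul_eq hT hI h t.2)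
  obtain ⟨x, hx⟩ := QuotientAddGroup.mk_surjective (φ t₁ - ((t₁ • v : V) : V ⧸ T))
  have hlift : ∀ t ∈ I, ((x + t • v : V) : V ⧸ T) = φ t := by
    intro t ht
    have := hloc.apply_eq_of_preconnectedSpace ⟨t, ht⟩ ⟨t₁, ht₁⟩
    rw [QuotientAddGroup.mk_add, hx, ← this, sub_add_cancel]
  have hcont : Continuous fun t : ℝ => x + t • v := by fun_prop
  refine ⟨⟨fun t => x + t • v, hcont.continuousOn, hlift⟩, fun Φ hΦ hΦl t ht => ?_⟩
  have hd : HasDerivAt (fun s : ℝ => x + s • v + (Φ t - (x + t • v))) v t := by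
    have := (((hasDerivAt_id t).smul_const v).const_add x).add_const (Φ t - (x + t • v))
    rwa [one_smul] at this
  refine hd.congr_of_eventuallyEq ?_
  filter_upwards [hI.mem_nhds ht] with s hs
  rw [← lift_sub_eq hT hIp hΦ hcont.continuousOn
    (fun r hr => (hΦl r hr).trans (hlift r hr).symm) hs ht]
  abel

end Quotient

/-- Countability follows from finite generation; discreteness of the lattice is not needed for
comparing lifts. -/
lemma countable_periodLattice {R : ℂ[X]} {N : ℕ} {P₀ : Surface R}
    (a b : Fin (N - 1) → Path P₀ P₀) :
    (periodLattice a b : Set (Fin (N - 1) → ℂ)).Countable := by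
  rw [periodLattice, ← Set.Sum.elim_range, ← Submodule.span_int_eq_addSubgroupClosure]
  exact (inferInstance : Countable (Submodule.span ℤ (Set.range (Sum.elim
    (fun j => intOmega a (a j)) fun j => intOmega a (b j)))))

/-! ### The motion of the roots -/

/-- The coefficients u are only known to be differentiable in time, so the implicit function theorem
is applied to the evaluation map in (u, x), which is complex C¹, and the result is composed with u.
-/
lemma exists_root_curve {N : ℕ} (lam : Fin N → ℝ) {u : ℝ → Fin N → ℂ} {t₀ : ℝ}
    (hu : DifferentiableAt ℝ u t₀) (huc : ∀ᶠ t in 𝓝 t₀, ContinuousAt u t) {μ₀ : ℂ}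
    (h0 : (nodeSum lam (u t₀)).eval μ₀ = 0)
    (h1 : (derivative (nodeSum lam (u t₀))).eval μ₀ ≠ 0) :
    ∃ μ : ℝ → ℂ, μ t₀ = μ₀ ∧ DifferentiableAt ℝ μ t₀ ∧ (∀ᶠ t in 𝓝 t₀, ContinuousAt μ t) ∧
      ∀ᶠ t in 𝓝 t₀, (nodeSum lam (u t)).eval (μ t) = 0 := by
  set F : (Fin N → ℂ) × ℂ → ℂ := fun p => (nodeSum lam p.1).eval p.2 with hF
  have hFc : ContDiff ℂ 1 F := by
    have : F = fun p => ∑ j, p.1 j * erasedProd lam j p.2 := by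
      funext p; exact nodeSum_eval _ _ _
    rw [this]
    unfold erasedProd
    refine ContDiff.sum fun j _ => ContDiff.mul (by fun_prop) (contDiff_prod fun i _ => by fun_prop)
  have cdf : ContDiffAt ℂ 1 F (u t₀, μ₀) := hFc.contDiffAt
  have hval : (fderiv ℂ F (u t₀, μ₀) ∘L .inr ℂ (Fin N → ℂ) ℂ) 1 =
      (derivative (nodeSum lam (u t₀))).eval μ₀ := by
    have e1 : HasDerivAt (fun x : ℂ => F (u t₀, x)) (fderiv ℂ F (u t₀, μ₀) (0, 1)) μ₀ :=
      (cdf.differentiableAt one_ne_zero).hasFDerivAt.comp_hasDerivAt μ₀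
        ((hasDerivAt_const μ₀ (u t₀)).prodMk (hasDerivAt_id μ₀))
    exact e1.unique ((nodeSum lam (u t₀)).hasDerivAt μ₀)
  have hinv : (fderiv ℂ F (u t₀, μ₀) ∘L .inr ℂ (Fin N → ℂ) ℂ).IsInvertible := by
    refine ⟨ContinuousLinearEquiv.unitsEquivAut ℂ (Units.mk0 _ h1), ?_⟩
    ext
    rw [hval]
    simp
  have hψ0 := cdf.implicitFunction_apply_self one_ne_zero hinv
  have hψc := cdf.contDiffAt_implicitFunction one_ne_zero hinv
  have hψ := cdf.eventually_apply_implicitFunction one_ne_zero hinv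
  set ψ := cdf.implicitFunction one_ne_zero hinv
  have hψn : ∀ᶠ x in 𝓝 (u t₀), ContinuousAt ψ x :=
    (hψc.eventually (by simp)).mono fun x hx => hx.continuousAt
  refine ⟨fun t => ψ (u t), hψ0, ?_, ?_, ?_⟩
  · exact ((hψc.differentiableAt one_ne_zero).restrictScalars ℝ).comp t₀ hu
  · filter_upwards [huc, hu.continuousAt.eventually hψn] with t e1 e2
    exact ContinuousAt.comp (x := t) e2 e1
  · filter_upwards [hu.continuousAt.eventually hψ] with t ht
    exact ht.trans h0

lemma nodup_roots_of_derivative {m : ℂ[X]} (hm : m ≠ 0)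
    (h : ∀ μ, m.eval μ = 0 → (derivative m).eval μ ≠ 0) : m.roots.Nodup := by
  rw [Multiset.nodup_iff_count_le_one]
  intro μ
  rw [count_roots]
  by_contra! hlt
  obtain ⟨h0, h1⟩ := (one_lt_rootMultiplicity_iff_isRoot hm).1 hlt
  exact h μ h0 h1

/-- Distinct continuous roots of a monic polynomial exhaust its roots if there are enough. -/
lemma roots_eq_map {m : ℂ[X]} (hm : m ≠ 0) {S : Finset ℂ} (hS : m.natDegree ≤ S.card)
    {r : ℂ → ℂ} (hr : ∀ s ∈ S, m.eval (r s) = 0)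
    (hinj : ∀ s ∈ S, ∀ s' ∈ S, s ≠ s' → r s ≠ r s') : m.roots = S.val.map r := by
  refine (Multiset.eq_of_le_of_card_le ?_ ?_).symm
  · refine (Multiset.le_iff_subset (S.nodup.map_on fun s hs s' hs' h => ?_)).2 ?_
    · by_contra hne
      exact hinj s hs s' hs' hne h
    · intro x hx
      obtain ⟨s, hs, rfl⟩ := Multiset.mem_map.1 hx
      exact (mem_roots hm).2 (hr s hs)
  · rw [Multiset.card_map]
    exact (card_roots' m).trans hS

/-! ### Degree of the spectral polynomial. -/

lemma monic_nPoly {N : ℕ} (hN : 0 < N) (lam : Fin N → ℝ) (z : Phase N) : (nPoly lam z).Monic := by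
  refine (aPoly_monic lam).add_of_left (degree_lt_degree ?_)
  rw [natDegree_aPoly, aQ_eq_nodeSum]
  have := natDegree_nodeSum_le lam fun j => ((z.2 j * z.2 j : ℝ) : ℂ)
  lia

lemma natDegree_nPoly {N : ℕ} (hN : 0 < N) (lam : Fin N → ℝ) (z : Phase N) :
    (nPoly lam z).natDegree = N := by
  rw [nPoly, natDegree_add_eq_left_of_natDegree_lt, natDegree_aPoly]
  rw [natDegree_aPoly, aQ_eq_nodeSum]
  have := natDegree_nodeSum_le lam fun j => ((z.2 j * z.2 j : ℝ) : ℂ)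
  lia

lemma pos_of_mem_TSphere {N : ℕ} {z : Phase N} (hz : z ∈ TSphere N) : 0 < N := by
  rcases Nat.eq_zero_or_pos N with rfl | h
  · have := sum_sq_eq_one hz
    simp at this
  · exact h

/-- The product mn has degree 2N - 1, while b² has degree at most 2N - 2. The degree is odd and has
the form 2g + 1 with g = N - 1. -/
lemma natDegree_spectralPoly {N : ℕ} (lam : Fin N → ℝ) {z : Phase N} (hz : z ∈ TSphere N) :
    (spectralPoly lam z).natDegree = 2 * (N - 1) + 1 := by
  have hN := pos_of_mem_TSphere hz
  have hmn : (aQ lam z.1 z.1 * nPoly lam z).natDegree = 2 * (N - 1) + 1 := by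
    rw [← mPoly_eq, (mPoly_monic lam hz).natDegree_mul (monic_nPoly hN lam z),
      natDegree_mPoly lam hz, natDegree_nPoly hN]
    lia
  rw [spectralPoly_eq, natDegree_sub_eq_left_of_natDegree_lt, hmn]
  have h1 : (aQ lam z.1 z.2).natDegree ≤ N - 1 := by
    rw [aQ_eq_nodeSum]; exact natDegree_nodeSum_le _ _
  have h2 := natDegree_mul_le (p := aQ lam z.1 z.2) (q := aQ lam z.1 z.2)
  lia

/-! ### Solutions of the Hamiltonian systems -/

section Flow

variable {N : ℕ} {lam c : Fin N → ℝ} {I : Set ℝ} {γ : ℝ → Phase N}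

lemma IsFlow.hasDerivAt_fst (h : IsFlow (uhlenbeck lam c) I γ) {t : ℝ} (ht : t ∈ I) (j : Fin N) :
    HasDerivAt (fun s => (γ s).1 j) (velP lam c (γ t) j) t := by
  have := ((h t ht).2 j).1
  rwa [dirac_fst_uhlenbeck lam c (h t ht).1] at this

lemma IsFlow.hasDerivAt_snd (h : IsFlow (uhlenbeck lam c) I γ) {t : ℝ} (ht : t ∈ I) (j : Fin N) :
    HasDerivAt (fun s => (γ s).2 j) (velQ lam c (γ t) j) t := by
  have := ((h t ht).2 j).2
  rwa [dirac_snd_uhlenbeck lam c (h t ht).1] at this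

lemma IsFlow.hasDerivAt_PP (h : IsFlow (uhlenbeck lam c) I γ) {t : ℝ} (ht : t ∈ I) {x : ℝ → ℂ}
    {x' : ℂ} (hx : HasDerivAt x x' t) :
    HasDerivAt (fun s => (aQ lam (γ s).1 (γ s).1).eval (x s)) ((velPP lam c (γ t)).eval (x t) +
      (derivative (aQ lam (γ t).1 (γ t).1)).eval (x t) * x') t :=
  hasDerivAt_eval_nodeSum lam
    (fun j => ((h.hasDerivAt_fst ht j).mul (h.hasDerivAt_fst ht j)).ofReal_comp) hx

lemma IsFlow.hasDerivAt_PQ (h : IsFlow (uhlenbeck lam c) I γ) {t : ℝ} (ht : t ∈ I) {x : ℝ → ℂ}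
    {x' : ℂ} (hx : HasDerivAt x x' t) :
    HasDerivAt (fun s => (aQ lam (γ s).1 (γ s).2).eval (x s)) ((velPQ lam c (γ t)).eval (x t) +
      (derivative (aQ lam (γ t).1 (γ t).2)).eval (x t) * x') t :=
  hasDerivAt_eval_nodeSum lam
    (fun j => ((h.hasDerivAt_fst ht j).mul (h.hasDerivAt_snd ht j)).ofReal_comp) hx

lemma IsFlow.hasDerivAt_QQ (h : IsFlow (uhlenbeck lam c) I γ) {t : ℝ} (ht : t ∈ I) {x : ℝ → ℂ}
    {x' : ℂ} (hx : HasDerivAt x x' t) :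
    HasDerivAt (fun s => (aQ lam (γ s).2 (γ s).2).eval (x s)) ((velQQ lam c (γ t)).eval (x t) +
      (derivative (aQ lam (γ t).2 (γ t).2)).eval (x t) * x') t :=
  hasDerivAt_eval_nodeSum lam
    (fun j => ((h.hasDerivAt_snd ht j).mul (h.hasDerivAt_snd ht j)).ofReal_comp) hx

/-- The spectral polynomial is a constant of motion. -/
lemma IsFlow.spectralPoly_eq_spectralPoly (hlam : Function.Injective lam) (hI : IsOpen I)
    (hIp : IsPreconnected I) (h : IsFlow (uhlenbeck lam c) I γ) {s t : ℝ} (hs : s ∈ I)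
    (ht : t ∈ I) : spectralPoly lam (γ s) = spectralPoly lam (γ t) := by
  refine Polynomial.funext fun x => ?_
  have hder : ∀ r ∈ I, HasDerivAt (fun r => (spectralPoly lam (γ r)).eval x) 0 r := by
    intro r hr
    have hx := hasDerivAt_const r x
    have e1 := h.hasDerivAt_PP hr hx
    have e2 := h.hasDerivAt_PQ hr hx
    have e3 := (h.hasDerivAt_QQ hr hx).const_add ((aPoly lam).eval x)
    have e4 := (e1.mul e3).sub (e2.mul e2)
    have e5 : (fun r => (spectralPoly lam (γ r)).eval x) = fun r =>
        (aQ lam (γ r).1 (γ r).1).eval x * ((aPoly lam).eval x + (aQ lam (γ r).2 (γ r).2).eval x) -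
        (aQ lam (γ r).1 (γ r).2).eval x * (aQ lam (γ r).1 (γ r).2).eval x := by
      funext r
      rw [spectralPoly_eq, nPoly]
      simp only [eval_sub, eval_mul, eval_add]
    rw [e5]
    refine e4.congr_deriv ?_
    have e6 := congrArg (eval x) (isospectral hlam c (γ r))
    simp only [eval_sub, eval_mul, eval_add, eval_zero, nPoly] at e6
    linear_combination e6
  exact hI.is_const_of_deriv_eq_zero hIp
    (fun r hr => (hder r hr).differentiableAt.differentiableWithinAt)
    (fun r hr => (hder r hr).deriv) hs ht

lemma continuousAt_eval_nodeSum {u : ℝ → Fin N → ℂ} {x : ℝ → ℂ} {t : ℝ} (lam : Fin N → ℝ)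
    (hu : ∀ j, ContinuousAt (fun s => u s j) t) (hx : ContinuousAt x t) :
    ContinuousAt (fun s => (nodeSum lam (u s)).eval (x s)) t := by
  simp only [nodeSum_eval, erasedProd]
  refine tendsto_finsetSum _ fun j _ => (hu j).mul (tendsto_finsetProd _ fun i _ => ?_)
  exact hx.sub continuousAt_const

/-- Near a time `t₀`, the roots of `m` are differentiable functions of the time. -/
lemma IsFlow.exists_roots (hlam : Function.Injective lam) (hI : IsOpen I)
    (h : IsFlow (uhlenbeck lam c) I γ) {t₀ : ℝ} (ht₀ : t₀ ∈ I)
    (hR : Squarefree (spectralPoly lam (γ t₀))) :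
    ∃ (S : Finset ℂ) (μ : ℂ → ℝ → ℂ), S.val = (mPoly lam (γ t₀)).roots ∧
      (∀ s ∈ S, μ s t₀ = s ∧ DifferentiableAt ℝ (μ s) t₀ ∧
        (∀ᶠ t in 𝓝 t₀, ContinuousAt (μ s) t) ∧
        ∀ᶠ t in 𝓝 t₀, (mPoly lam (γ t)).eval (μ s t) = 0) ∧
      ∀ᶠ t in 𝓝 t₀, (mPoly lam (γ t)).roots = S.val.map fun s => μ s t := by
  have hz := (h t₀ ht₀).1
  have hnd : (mPoly lam (γ t₀)).roots.Nodup := nodup_roots_of_derivative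
    (mPoly_monic lam hz).ne_zero fun x hx => derivative_mPoly_eval_ne_zero hlam hz hR hx
  set S : Finset ℂ := ⟨(mPoly lam (γ t₀)).roots, hnd⟩ with hS
  have hcard : S.card = N - 1 := by
    rw [← natDegree_mPoly lam hz, (IsAlgClosed.splits _).natDegree_eq_card_roots]; rfl
  have hu : ∀ t ∈ I, DifferentiableAt ℝ (fun s j => (((γ s).1 j * (γ s).1 j : ℝ) : ℂ)) t :=
    fun t ht => differentiableAt_pi.2 fun j =>
      ((h.hasDerivAt_fst ht j).mul (h.hasDerivAt_fst ht j)).ofReal_comp.differentiableAt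
  have hex : ∀ s ∈ S, ∃ μ : ℝ → ℂ, μ t₀ = s ∧ DifferentiableAt ℝ μ t₀ ∧
      (∀ᶠ t in 𝓝 t₀, ContinuousAt μ t) ∧
        ∀ᶠ t in 𝓝 t₀, (mPoly lam (γ t)).eval (μ t) = 0 := by
    intro s hs
    have hs0 : (mPoly lam (γ t₀)).eval s = 0 := (mem_roots'.1 hs).2
    refine exists_root_curve lam (hu t₀ ht₀) ?_ hs0
      (derivative_mPoly_eval_ne_zero hlam hz hR hs0)
    filter_upwards [hI.mem_nhds ht₀] with t ht
    exact (hu t ht).continuousAt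
  choose! μ hμ using hex
  refine ⟨S, μ, rfl, hμ, ?_⟩
  have hroot : ∀ᶠ t in 𝓝 t₀, ∀ s ∈ S, (mPoly lam (γ t)).eval (μ s t) = 0 :=
    (Filter.eventually_all_finset S).2 fun s hs => (hμ s hs).2.2.2
  have hinj : ∀ᶠ t in 𝓝 t₀, ∀ s ∈ S, ∀ s' ∈ S, s ≠ s' → μ s t ≠ μ s' t := by
    refine (Filter.eventually_all_finset S).2 fun s hs =>
      (Filter.eventually_all_finset S).2 fun s' hs' => ?_
    by_cases hne : s = s'
    · exact Filter.Eventually.of_forall fun t h => absurd hne h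
    · have e1 := (hμ s hs).2.1.continuousAt
      have e2 := (hμ s' hs').2.1.continuousAt
      have e3 : μ s t₀ - μ s' t₀ ≠ 0 := by
        rwa [(hμ s hs).1, (hμ s' hs').1, sub_ne_zero]
      filter_upwards [(e1.sub e2).eventually_ne e3] with t ht _
      exact sub_ne_zero.1 ht
  filter_upwards [hroot, hinj, hI.mem_nhds ht₀] with t e1 e2 ht
  have hzt := (h t ht).1
  exact roots_eq_map (mPoly_monic lam hzt).ne_zero (by rw [natDegree_mPoly lam hzt, hcard]) e1 e2

end Flow

/-! ### Linearization on the Jacobi variety -/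

/-- The contribution of the root `μ` of `m` to the velocity of the Abel image. -/
lemma exists_root_lift {R : ℂ[X]} (hR : Squarefree R) {N : ℕ} {lam c : Fin N → ℝ}
    (hlam : Function.Injective lam) {P₀ : AffineCurve R}
    {a b : Fin (N - 1) → Path (P₀ : Surface R) (P₀ : Surface R)} (hab : GenerateHomology a b)
    {ε : ℂ} (hε : ε ^ 2 = 1) {I : Set ℝ} {γ : ℝ → Phase N} (hI : IsOpen I)
    (h : IsFlow (uhlenbeck lam c) I γ) (hlev : ∀ t ∈ I, spectralPoly lam (γ t) = R) {t₀ : ℝ}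
    (ht₀ : t₀ ∈ I) {Y : ℂ[X]} (hY : weighted lam c (γ t₀).1 (γ t₀).1 =
      nodeInterp lam c 0 * aQ lam (γ t₀).1 (γ t₀).1 + aPoly lam * Y)
    {μ : ℝ → ℂ} (hμ : DifferentiableAt ℝ μ t₀) (hμc : ∀ᶠ t in 𝓝 t₀, ContinuousAt μ t)
    (hroot : ∀ᶠ t in 𝓝 t₀, (mPoly lam (γ t)).eval (μ t) = 0) :
    ∃ Φ : ℝ → Fin (N - 1) → ℂ, (∀ᶠ t in 𝓝 t₀, ContinuousAt Φ t) ∧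
      (∀ᶠ t in 𝓝 t₀, (Φ t : Jacobian a b) = abelMap a b (surfacePoint R (μ t)
        (ε * (laxMatrix lam (γ t) 0 0).eval (μ t)))) ∧
      HasDerivAt Φ ((normMatrix a).mulVec fun j => -(ε / 2) * (μ t₀ ^ (N - 2 - (j : ℕ)) *
        Y.eval (μ t₀) / (derivative (mPoly lam (γ t₀))).eval (μ t₀))) t₀ := by
  have hz := (h t₀ ht₀).1
  have hdeg : R.natDegree = 2 * (N - 1) + 1 := by
    rw [← hlev t₀ ht₀]; exact natDegree_spectralPoly lam hz
  have hroot₀ := hroot.self_of_nhds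
  obtain ⟨hv1, hv2⟩ := velocities_at_root hlam c (γ t₀) hY hroot₀
  have hm : (derivative (mPoly lam (γ t₀))).eval (μ t₀) ≠ 0 :=
    derivative_mPoly_eval_ne_zero hlam hz (by rwa [hlev t₀ ht₀]) hroot₀
  have hlax : ∀ t, (laxMatrix lam (γ t) 0 0).eval (μ t) =
      -(aQ lam (γ t).1 (γ t).2).eval (μ t) := fun t => by simp [laxMatrix]
  have hdμ := hμ.hasDerivAt
  set μ' := deriv μ t₀
  -- Differentiate m(μ(t)) = 0.
  have hμ' : (velPP lam c (γ t₀)).eval (μ t₀) +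
      (derivative (mPoly lam (γ t₀))).eval (μ t₀) * μ' = 0 :=
    (h.hasDerivAt_PP ht₀ hdμ).unique ((hasDerivAt_const t₀ (0 : ℂ)).congr_of_eventuallyEq hroot)
  have hdy : HasDerivAt (fun t => ε * (laxMatrix lam (γ t) 0 0).eval (μ t))
      (ε * -((velPQ lam c (γ t₀)).eval (μ t₀) +
        (derivative (aQ lam (γ t₀).1 (γ t₀).2)).eval (μ t₀) * μ')) t₀ := by
    simp only [hlax]
    exact ((h.hasDerivAt_PQ ht₀ hdμ).neg).const_mul ε
  have hyc : ∀ᶠ t in 𝓝 t₀,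
      ContinuousAt (fun t => ε * (laxMatrix lam (γ t) 0 0).eval (μ t)) t := by
    filter_upwards [hI.mem_nhds ht₀, hμc] with t ht hc
    simp only [hlax]
    refine continuousAt_const.mul (ContinuousAt.neg (continuousAt_eval_nodeSum lam
      (u := fun s j => (((γ s).1 j * (γ s).2 j : ℝ) : ℂ)) (fun j => ?_) hc))
    exact ((h.hasDerivAt_fst ht j).mul (h.hasDerivAt_snd ht j)).ofReal_comp.continuousAt
  have heval : ∀ t, (spectralPoly lam (γ t)).eval (μ t) =
      (mPoly lam (γ t)).eval (μ t) * (nPoly lam (γ t)).eval (μ t) -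
        (aQ lam (γ t).1 (γ t).2).eval (μ t) ^ 2 := fun t => by
    rw [spectralPoly_eq, eval_sub, eval_mul, eval_mul, mPoly_eq]; ring
  have hcurve : ∀ᶠ t in 𝓝 t₀,
      (ε * (laxMatrix lam (γ t) 0 0).eval (μ t)) ^ 2 + R.eval (μ t) = 0 := by
    filter_upwards [hI.mem_nhds ht₀, hroot] with t ht hr
    rw [← hlev t ht, heval, hr, hlax, mul_pow, hε]; ring
  have hε0 : ε ≠ 0 := by rintro rfl; norm_num at hε
  refine exists_abelMap_lift hR hdeg hab hdμ hdy hμc hyc hcurve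
    (w := fun e => -(ε / 2) * (μ t₀ ^ e * Y.eval (μ t₀) /
      (derivative (mPoly lam (γ t₀))).eval (μ t₀))) (fun e hy => ?_) (fun e hy => ?_)
  -- Unbranched case: μ' = 2 b Y / m' and ξ = -ε b, so b cancels and 1/ε = ε.
  · rw [hlax] at hy ⊢
    have hb : (aQ lam (γ t₀).1 (γ t₀).2).eval (μ t₀) ≠ 0 := by
      rintro hb; exact hy (by rw [hb]; ring)
    have hμ'' : μ' = 2 * (aQ lam (γ t₀).1 (γ t₀).2).eval (μ t₀) * Y.eval (μ t₀) /
        (derivative (mPoly lam (γ t₀))).eval (μ t₀) := by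
      rw [eq_div_iff hm]
      linear_combination hμ' - hv1
    rw [hμ'']
    field_simp
    linear_combination (-4 * (μ t₀ ^ e * Y.eval (μ t₀))) * hε
  -- Branch point: b = 0 gives μ' = 0, so ξ' = ε Y n and R' = m' n. Now n cancels, leaving the same
  -- contribution.
  · rw [hlax] at hy
    have hb : (aQ lam (γ t₀).1 (γ t₀).2).eval (μ t₀) = 0 := by
      simpa [hε0] using hy
    have hμ0 : μ' = 0 := by
      have : (derivative (mPoly lam (γ t₀))).eval (μ t₀) * μ' = 0 := by
        rw [hv1, hb] at hμ'; linear_combination hμ'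
      exact (mul_eq_zero.1 this).resolve_left hm
    have hR' : (derivative R).eval (μ t₀) = (derivative (mPoly lam (γ t₀))).eval (μ t₀) *
        (nPoly lam (γ t₀)).eval (μ t₀) := by
      rw [← hlev t₀ ht₀, spectralPoly_eq, ← mPoly_eq]
      simp only [derivative_sub, derivative_mul, eval_sub, eval_add, eval_mul, hb, hroot₀]
      ring
    have hRroot : R.eval (μ t₀) = 0 := by
      rw [← hlev t₀ ht₀, heval, hroot₀, hb]; ring
    have hR0 := hR.derivative_eval_ne_zero hRroot
    rw [hR'] at hR0 ⊢
    have hn := right_ne_zero_of_mul hR0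
    rw [hv2, hμ0]
    field_simp
    ring

lemma IsFlow.exists_lift {R : ℂ[X]} (hR : Squarefree R) {N : ℕ} {lam c : Fin N → ℝ}
    (hlam : Function.Injective lam) {P₀ : AffineCurve R}
    {a b : Fin (N - 1) → Path (P₀ : Surface R) (P₀ : Surface R)} (hab : GenerateHomology a b)
    {ε : ℂ} (hε : ε ^ 2 = 1) {I : Set ℝ} {γ : ℝ → Phase N} (hI : IsOpen I)
    (h : IsFlow (uhlenbeck lam c) I γ) (hlev : ∀ t ∈ I, spectralPoly lam (γ t) = R) {t₀ : ℝ}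
    (ht₀ : t₀ ∈ I) :
    ∃ Φ : ℝ → Fin (N - 1) → ℂ, (∀ᶠ t in 𝓝 t₀, ContinuousAt Φ t) ∧
      (∀ᶠ t in 𝓝 t₀, (Φ t : Jacobian a b) = abelJacobi lam a b ε (γ t)) ∧
      HasDerivAt Φ (abelVelocity lam a ε fun j => (c j : ℂ)) t₀ := by
  have hz := (h t₀ ht₀).1
  have hR₀ : Squarefree (spectralPoly lam (γ t₀)) := by rwa [hlev t₀ ht₀]
  obtain ⟨S, μ, hS, hμ, hroots⟩ := h.exists_roots hlam hI ht₀ hR₀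
  obtain ⟨Y, hY⟩ := exists_weighted_quotient hlam c (γ t₀).1 (γ t₀).1 0
  rw [pow_zero, one_mul] at hY
  have hex := fun s (hs : s ∈ S) => exists_root_lift hR hlam hab hε hI h hlev ht₀ hY
    (hμ s hs).2.1 (hμ s hs).2.2.1 (hμ s hs).2.2.2
  choose! Φ hΦ using hex
  refine ⟨fun t => ∑ s ∈ S, Φ s t, ?_, ?_, ?_⟩
  · have := (Filter.eventually_all_finset S).2 fun s hs => (hΦ s hs).1
    filter_upwards [this] with t ht
    exact tendsto_finsetSum S fun s hs => ht s hs
  · have := (Filter.eventually_all_finset S).2 fun s hs => (hΦ s hs).2.1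
    filter_upwards [this, hroots] with t ht hr
    rw [abelJacobi, hr, Multiset.map_map]
    exact (map_sum (QuotientAddGroup.mk' (periodLattice a b)) _ _).trans
      (Finset.sum_congr rfl fun s hs => ht s hs)
  · refine (HasDerivAt.fun_sum fun s hs => (hΦ s hs).2.2).congr_deriv ?_
    rw [abelVelocity, ← Matrix.mulVec_sum]
    refine congrArg (normMatrix a).mulVec (funext fun j => ?_)
    have hj : N - 2 - (j : ℕ) < N - 1 := by have := j.2; lia
    have hsum := sum_roots_quotient hlam c hz hR₀ hY hj
    rw [← hS] at hsum
    rw [Finset.sum_apply, ← Finset.mul_sum]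
    have : ∑ s ∈ S, μ s t₀ ^ (N - 2 - (j : ℕ)) * Y.eval (μ s t₀) /
        (derivative (mPoly lam (γ t₀))).eval (μ s t₀) =
        -residueSum lam (fun j => (c j : ℂ)) (N - 2 - (j : ℕ)) := by
      rw [← hsum]
      refine Finset.sum_congr rfl fun s hs => ?_
      rw [(hμ s hs).1]
    rw [this]; ring

/-- The flows of the combinations of the Uhlenbeck integrals are linear on the Jacobi variety. -/
lemma flowDeriv_uhlenbeck {R : ℂ[X]} (hR : Squarefree R) {N : ℕ} {lam : Fin N → ℝ}
    (hlam : Function.Injective lam) {P₀ : AffineCurve R}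
    {a b : Fin (N - 1) → Path (P₀ : Surface R) (P₀ : Surface R)} (hab : GenerateHomology a b)
    {ε : ℂ} (hε : ε ^ 2 = 1) (c : Fin N → ℝ) :
    FlowDeriv lam a b ε (uhlenbeck lam c) (abelVelocity lam a ε fun j => (c j : ℂ)) := by
  intro I γ t₀ hI hIp ht₀ h hlev₀
  have hlev : ∀ t ∈ I, spectralPoly lam (γ t) = R := fun t ht =>
    (h.spectralPoly_eq_spectralPoly hlam hI hIp ht ht₀).trans hlev₀
  exact ⟨hlev, hasConstDeriv_of_local (countable_periodLattice a b) hI hIp ht₀ fun t ht =>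
    h.exists_lift hR hlam hab hε hI hlev ht⟩

end Neumann

end

theorem theorem3 {N : ℕ} (lam : Fin N → ℝ) (hlam : Function.Injective lam)
    (hlam0 : ∀ j, lam j ≠ 0) (R : ℂ[X]) (hR : Squarefree R) (P₀ : Neumann.AffineCurve R)
    (a b : Fin (N - 1) → Path (P₀ : Neumann.Surface R) (P₀ : Neumann.Surface R))
    (hab : Neumann.GenerateHomology a b) (ε : ℂ) (hε : ε = 1 ∨ ε = -1) :
    (∀ k : ℕ, Neumann.FlowDeriv lam a b ε (Neumann.ham lam k) (-ε • Neumann.Omega lam a k)) ∧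
    ∀ l : ℂ, (∀ j, ‖l‖ < |lam j|) → ∃ v w : Fin (N - 1) → ℂ,
      Neumann.FlowDeriv lam a b ε (fun z => (Neumann.hamGen lam l z).re) v ∧
      Neumann.FlowDeriv lam a b ε (fun z => (Neumann.hamGen lam l z).im) w ∧
      HasSum (fun k : ℕ => l ^ k • (-ε • Neumann.Omega lam a k)) (v + Complex.I • w) := by
  have hε2 : ε ^ 2 = 1 := by rcases hε with rfl | rfl <;> norm_num
  refine ⟨fun k => ?_, fun l hl => ?_⟩
  · rw [Neumann.ham_eq_uhlenbeck hlam hlam0, Neumann.neg_smul_Omega hlam hlam0]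
    exact Neumann.flowDeriv_uhlenbeck hR hlam hab hε2 _
  -- Summing λ_j^{-k-1} l^k over k gives the weight 1/(λ_j - l). Its real and imaginary parts are
  -- the weights of the two real flows.
  · refine ⟨Neumann.abelVelocity lam a ε fun j => ((((lam j : ℂ) - l)⁻¹.re : ℝ) : ℂ),
      Neumann.abelVelocity lam a ε fun j => ((((lam j : ℂ) - l)⁻¹.im : ℝ) : ℂ), ?_, ?_, ?_⟩
    · rw [Neumann.re_hamGen hlam hlam0 hl]
      exact Neumann.flowDeriv_uhlenbeck hR hlam hab hε2 _
    · rw [Neumann.im_hamGen hlam hlam0 hl]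
      exact Neumann.flowDeriv_uhlenbeck hR hlam hab hε2 _
    · rw [Neumann.abelVelocity_add_I_smul]
      simp only [Neumann.neg_smul_Omega hlam hlam0]
      exact Neumann.hasSum_abelVelocity lam a ε fun j => Neumann.hasSum_inv_pow_mul_pow (hl j)
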